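/- Let $C$ be a compact connected Riemann surface of genus $g>0$, $p_\infty\in C$, and let $\{\alpha_i,\beta_i\}_{i=1}^g$ be a canonical basis of $H_1(C,\mathbb Z)$. Let $dv_1,\dots,dv_g$ be the holomorphic one-forms with $\int_{\alpha_j}dv_i=\delta_{ij}$, let $\Omega=(\int_{\beta_j}dv_i)$, let $I$ be the Abel map with base point $p_\infty$ (with values in $\mathbb C^g/(\mathbb Z^g+\Omega\mathbb Z^g)$), extended additively to divisors, and let $\theta(v|\Omega)=\sum_{n\in\mathbb Z^g}\exp(\pi i\,{}^tn\Omega n+2\pi i\,{}^tnv)$. Let $\Delta$ be the Riemann divisor: a divisor of degree $g-1$ such that $2\Delta$ is a canonical divisor and $\{I(p_1+\cdots+p_{g-1}-\Delta)\mid p_1,\dots,p_{g-1}\in C\}$ is the zero set of $\theta(\cdot|\Omega)$ in $\mathbb C^g/(\mathbb Z^g+\Omega\mathbb Z^g)$ (it is determined up to linear equivalence). For $e\in\mathbb C^g$ let $L_e$ be the flat line bundle whose character is $\chi(\alpha_j)=1$, $\chi(\beta_j)=e^{2\pi i e_j}$, and put $L_{\Delta,e}=L_\Delta\otimes L_e$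 with $L_\Delta=\mathcal O(\Delta)$. Let $H^0(C,L_{\Delta,e}(*p_\infty))$ be the space of meromorphic sections of $L_{\Delta,e}$ that are holomorphic on $C\setminus\{p_\infty\}$; it is a module over the ring $R$ of meromorphic functions on $C$ that are holomorphic on $C\setminus\{p_\infty\}$. Let $z$ be a local coordinate with simply connected domain containing $p_\infty$ and $z(p_\infty)=0$. Over this domain, sections of $L_{\Delta,e}$ are written as $f(z)\sqrt{dz}$ by means of $L_\Delta^{\otimes2}\cong\Omega^1_C$ and the trivialization of the flat bundle $L_e$ (this fixes $f$ up to a nonzero constant independent of the section). Explicitly: fix a meromorphic one-form $\eta$ with divisor $2\Delta$ and a meromorphic square root $\sigma$ of $\eta/dz$ on the domain of $z$; a section is a multivalued meromorphic function $u$ on $C$ that is multiplied by $\chi(c)$ under continuation along a loop $c$ and whose divisor is $\ge-\Delta$ on $C\setminus\{p_\infty\}$, and $f=u\,\sigma$ on the domain of $z$, for the branch of $u$ continued from $p_\infty$ inside that domain. Let $M,N\ge1$, let $P_1,\dots,P_N,Q_1,\dots,Q_M$ be distinct points of the domain of $z$, different from $p_\infty$, put $p_i=z(P_i)$, $q_j=z(Q_j)$,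 and let $(a_{j,i})$ be a complex $M\times N$ matrix. Let $$b_{N+j,i}=a_{j,i}\prod_{m\ne i}\frac{p_i^{-1}-p_m^{-1}}{q_j^{-1}-p_m^{-1}},\qquad b'_{N+j,i}=b_{N+j,i}\,p_i^{-1}q_j\qquad(1\le j\le M,\ 1\le i\le N),$$ $$W_e=\Bigl\{f\in H^0(C,L_{\Delta,e}(*p_\infty))\ \Big|\ f(p_i)=-\sum_{j=1}^M b'_{N+j,i}\,f(q_j),\ 1\le i\le N\Bigr\},$$ where $f(p_i)$, $f(q_j)$ are the values of the coordinate expression $f(z)$ at $z=p_i$, $z=q_j$. Then the stabilizer $R_e=\{f\in R\mid fW_e\subset W_e\}$ of $W_e$ in $R$ is $$R_e=\{f\in R\mid f(P_i)=f(Q_j)\ \text{for all } i,j \text{ with } b_{N+j,i}\neq0\}.$$ -/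

import Mathlib

open scoped Manifold ContDiff Topology

noncomputable section

namespace KPCurve

variable {C : Type*} [TopologicalSpace C]

/-! ### First homology, intersection numbers, canonical bases -/

/-- The first integral homology group of a path connected space, as the abelianized fundamental
group, written additively. -/
abbrev H1 (C : Type*) [TopologicalSpace C] (x₀ : C) : Type _ :=
  Additive (Abelianization (FundamentalGroup C x₀))

/-- The homology class of (the homotopy class of) a loop at the base point. -/
def homologyClass {x₀ : C} (c : Path.Homotopic.Quotient x₀ x₀) : H1 C x₀ :=
  Additive.ofMul (Abelianization.of (FundamentalGroup.fromPath c))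

/-- The loop `c`, based at an arbitrary point, represents the homology class `h`. -/
def Represents {x₀ x : C} (c : Path x x) (h : H1 C x₀) : Prop :=
  ∃ γ : Path x₀ x, homologyClass (Path.Homotopic.Quotient.mk ((γ.trans c).trans γ.symm)) = h

/-- The parameter values of the crossings of two loops. -/
def crossings {x y : C} (c : Path x x) (d : Path y y) : Set (ℝ × ℝ) :=
  {p | p.1 ∈ Set.Icc (0 : ℝ) 1 ∧ p.2 ∈ Set.Icc (0 : ℝ) 1 ∧ c.extend p.1 = d.extend p.2}

/-- For loops crossing at parameters `p`, the oriented area `Im (conj c' * d')` spanned by their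
velocities in a holomorphic chart at the crossing point. It is nonzero exactly when both velocities
exist and are linearly independent over `ℝ`, and its sign does not depend on the chart. -/
def crossingArea [ChartedSpace ℂ C] {x y : C} (c : Path x x) (d : Path y y) (p : ℝ × ℝ) : ℝ :=
  ((starRingEnd ℂ) (deriv (fun s : ℝ => chartAt ℂ (c.extend p.1) (c.extend s)) p.1) *
    deriv (fun s : ℝ => chartAt ℂ (c.extend p.1) (d.extend s)) p.2).im

/-- The homology classes `h` and `k` have intersection number `n`: they are represented by loops
that cross finitely often, transversally and away from the base points of the loops, and `n` is the
sum of the signs of the crossings. -/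
def HasIntersectionNumber [ChartedSpace ℂ C] {x₀ : C} (h k : H1 C x₀) (n : ℤ) : Prop :=
  ∃ (x y : C) (c : Path x x) (d : Path y y) (hfin : (crossings c d).Finite),
    Represents c h ∧ Represents d k ∧
    (∀ p ∈ crossings c d, p.1 ∈ Set.Ioo (0 : ℝ) 1 ∧ p.2 ∈ Set.Ioo (0 : ℝ) 1 ∧
      crossingArea c d p ≠ 0) ∧
    n = ∑ p ∈ hfin.toFinset, ((SignType.sign (crossingArea c d p) : SignType) : ℤ)

/-- A basis `α_1, …, α_g, β_1, …, β_g` of the first homology (`α_i` is indexed by `Sum.inl i` and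
`β_i` by `Sum.inr i`) is canonical: `α_i·α_j = β_i·β_j = 0` and `α_i·β_j = δ_{ij}`. -/
def IsCanonicalBasis [ChartedSpace ℂ C] {x₀ : C} {g : ℕ}
    (b : Module.Basis (Fin g ⊕ Fin g) ℤ (H1 C x₀)) : Prop :=
  ∀ i j : Fin g,
    HasIntersectionNumber (b (Sum.inl i)) (b (Sum.inl j)) 0 ∧
    HasIntersectionNumber (b (Sum.inr i)) (b (Sum.inr j)) 0 ∧
    HasIntersectionNumber (b (Sum.inl i)) (b (Sum.inr j)) (if i = j then 1 else 0)

/-! ### Differentials and their line integrals -/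

/-- A (not necessarily continuous) field of complex linear forms on the tangent spaces. -/
abbrev OneForm (C : Type*) [TopologicalSpace C] [ChartedSpace ℂ C] : Type _ :=
  (x : C) → TangentSpace 𝓘(ℂ, ℂ) x →L[ℂ] ℂ

/-- The coefficient `η_φ` of a one form in a chart `φ`, so that `η = η_φ(w) dw`, `w = φ(x)`. -/
def coeff [ChartedSpace ℂ C] (η : OneForm C) (φ : OpenPartialHomeomorph C ℂ) (w : ℂ) : ℂ :=
  η (φ.symm w) (mfderiv 𝓘(ℂ, ℂ) 𝓘(ℂ, ℂ) φ.symm w (1 : ℂ))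

/-- Holomorphic one forms. -/
def IsHolomorphicForm [ChartedSpace ℂ C] (η : OneForm C) : Prop :=
  ∀ φ ∈ IsManifold.maximalAtlas 𝓘(ℂ, ℂ) ω C, AnalyticOnNhd ℂ (coeff η φ) φ.target

/-- `η` is a meromorphic one form (in normal form: the coefficients are analytic wherever they have
no pole) which does not vanish identically near any point, with divisor `D`. -/
def HasDivisor [ChartedSpace ℂ C] (η : OneForm C) (D : C →₀ ℤ) : Prop :=
  ∀ φ ∈ IsManifold.maximalAtlas 𝓘(ℂ, ℂ) ω C, ∀ x ∈ φ.source,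
    MeromorphicNFAt (coeff η φ) (φ x) ∧
      meromorphicOrderAt (coeff η φ) (φ x) = ((D x : ℤ) : WithTop ℤ)

/-- The line integral of the holomorphic form `η` along the continuous path `γ` equals `I`:
`I` is the increment of a continuous primitive of `η` along `γ`. -/
def HasLineIntegral [ChartedSpace ℂ C] (η : OneForm C) {x y : C} (γ : Path x y) (I : ℂ) : Prop :=
  ∃ F : unitInterval → ℂ,
    (∀ t₀, ∃ U : Set C, IsOpen U ∧ γ t₀ ∈ U ∧ ∃ G : C → ℂ,
      (∀ x ∈ U, HasMFDerivAt 𝓘(ℂ, ℂ) 𝓘(ℂ, ℂ) G x (η x)) ∧ ∀ᶠ t in 𝓝 t₀, F t = G (γ t)) ∧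
    F 1 - F 0 = I

/-- `dv_1, …, dv_g` are holomorphic one forms normalized by `∫_{α_j} dv_i = δ_{ij}`. -/
def IsNormalizedForms [ChartedSpace ℂ C] {x₀ : C} {g : ℕ}
    (b : Module.Basis (Fin g ⊕ Fin g) ℤ (H1 C x₀)) (dv : Fin g → OneForm C) : Prop :=
  (∀ i, IsHolomorphicForm (dv i)) ∧
  ∀ i j, ∀ c : Path x₀ x₀, homologyClass (Path.Homotopic.Quotient.mk c) = b (Sum.inl j) →
    HasLineIntegral (dv i) c (if i = j then 1 else 0)

/-- `Ω_{ij} = ∫_{β_j} dv_i`. -/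
def IsPeriodMatrix [ChartedSpace ℂ C] {x₀ : C} {g : ℕ}
    (b : Module.Basis (Fin g ⊕ Fin g) ℤ (H1 C x₀)) (dv : Fin g → OneForm C)
    (Ω : Matrix (Fin g) (Fin g) ℂ) : Prop :=
  ∀ i j, ∀ c : Path x₀ x₀, homologyClass (Path.Homotopic.Quotient.mk c) = b (Sum.inr j) →
    HasLineIntegral (dv i) c (Ω i j)

/-! ### Theta function, Abel map, Riemann divisor -/

/-- Riemann's theta function `θ(v|Ω) = ∑_{n ∈ ℤ^g} exp(πi ᵗnΩn + 2πi ᵗnv)`. -/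
def theta {g : ℕ} (Ω : Matrix (Fin g) (Fin g) ℂ) (v : Fin g → ℂ) : ℂ :=
  ∑' n : Fin g → ℤ,
    Complex.exp (Real.pi * Complex.I * ∑ i, ∑ j, (n i : ℂ) * Ω i j * (n j : ℂ) +
      2 * Real.pi * Complex.I * ∑ i, (n i : ℂ) * v i)

/-- The degree of a divisor. -/
def degree (D : C →₀ ℤ) : ℤ := D.sum fun _ k => k

/-- `v ∈ ℂ^g` represents the class of `I(D)` in `ℂ^g / (ℤ^g + Ωℤ^g)`, where `I` is the Abel map with
base point `x₀`. -/
def IsAbelValue [ChartedSpace ℂ C] (x₀ : C) {g : ℕ} (dv : Fin g → OneForm C)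
    (Ω : Matrix (Fin g) (Fin g) ℂ) (D : C →₀ ℤ) (v : Fin g → ℂ) : Prop :=
  ∃ I : C → Fin g → ℂ,
    (∀ x, ∃ γ : Path x₀ x, ∀ i, HasLineIntegral (dv i) γ (I x i)) ∧
    ∃ m n : Fin g → ℤ, ∀ i,
      v i = (D.sum fun x k => (k : ℂ) * I x i) + (m i : ℂ) + ∑ j, Ω i j * (n j : ℂ)

/-- `Δ` is the Riemann divisor (it is determined up to linear equivalence): it has degree `g - 1`,
`2Δ` is a canonical divisor, and the zero set of the theta function is
`{I(p_1 + ⋯ + p_{g-1} - Δ)}`. -/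
def IsRiemannDivisor [ChartedSpace ℂ C] (x₀ : C) {g : ℕ} (dv : Fin g → OneForm C)
    (Ω : Matrix (Fin g) (Fin g) ℂ) (Δ : C →₀ ℤ) : Prop :=
  degree Δ = (g : ℤ) - 1 ∧
  (∃ η : OneForm C, HasDivisor η (2 • Δ)) ∧
  ∀ v : Fin g → ℂ, theta Ω v = 0 ↔
    ∃ D : C →₀ ℤ, 0 ≤ D ∧ degree D = (g : ℤ) - 1 ∧ IsAbelValue x₀ dv Ω (D - Δ) v

/-! ### Functions with a pole only at the marked point -/

/-- The set `R` of meromorphic functions on `C` whose only pole is at `pinf`, as functions on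
`C ∖ {pinf}`: near each `x₀` the function is `(φ - φ(x₀))^n F` with `φ` a chart, `F` holomorphic,
and `n = 0` unless `x₀ = pinf`. -/
def functionRing [ChartedSpace ℂ C] (pinf : C) : Set ({x : C // x ≠ pinf} → ℂ) :=
  {f | ∀ x₀ : C, ∃ n : ℤ, (x₀ ≠ pinf → n = 0) ∧
    ∃ U : Set C, IsOpen U ∧ x₀ ∈ U ∧ U ⊆ (chartAt ℂ x₀).source ∧
      ∃ F : C → ℂ, MDifferentiableOn 𝓘(ℂ, ℂ) 𝓘(ℂ, ℂ) F U ∧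
        ∀ x : {x : C // x ≠ pinf}, (x : C) ∈ U →
          f x = (chartAt ℂ x₀ x - chartAt ℂ x₀ x₀) ^ n * F x}

/-! ### The line bundle `L_{Δ,e}` and its sections -/

/-- The character `χ` of the fundamental group with `χ(α_j) = 1` and `χ(β_j) = exp(2πi e_j)`. -/
def character {x₀ : C} {g : ℕ} (b : Module.Basis (Fin g ⊕ Fin g) ℤ (H1 C x₀))
    (e : Fin g → ℂ) (c : Path.Homotopic.Quotient x₀ x₀) : ℂ :=
  Complex.exp (2 * Real.pi * Complex.I *
    ∑ j, ((b.repr (homologyClass c) (Sum.inr j) : ℤ) : ℂ) * e j)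

/-- The points of `C ∖ {pinf}` outside the support of `Δ`. -/
abbrev GoodPoint (pinf : C) (Δ : C →₀ ℤ) : Type _ := {x : C // x ≠ pinf ∧ Δ x = 0}

/-- Multivalued functions on `C ∖ ({pinf} ∪ supp Δ)` that are single valued on the universal cover
of `C`: functions of a point `x` and of a homotopy class of paths in `C` from `pinf` to `x`. -/
abbrev MultiFun (pinf : C) (Δ : C →₀ ℤ) : Type _ :=
  (x : GoodPoint pinf Δ) → Path.Homotopic.Quotient pinf (x : C) → ℂ

/-- The space `H⁰(C, L_{Δ,e}(*pinf))` of meromorphic sections of `L_{Δ,e} = O(Δ) ⊗ L_e` that are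
holomorphic on `C ∖ {pinf}`, where `L_e` is the flat line bundle with character `χ`: multivalued
meromorphic functions `u` on `C` which are multiplied by `χ(c)` under continuation along a loop `c`
and whose divisor is `≥ -Δ` on `C ∖ {pinf}`. The last clause says that every branch of `u` at every
`x₀` is `(φ - φ(x₀))^n F` with `φ` a chart, `F` holomorphic near `x₀`, and `n = -Δ(x₀)` unless
`x₀ = pinf`. -/
def sections [ChartedSpace ℂ C] {pinf : C} {g : ℕ}
    (b : Module.Basis (Fin g ⊕ Fin g) ℤ (H1 C pinf)) (Δ : C →₀ ℤ) (e : Fin g → ℂ) :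
    Set (MultiFun pinf Δ) :=
  {u | (∀ (c : Path.Homotopic.Quotient pinf pinf) (x : GoodPoint pinf Δ)
      (γ : Path.Homotopic.Quotient pinf (x : C)), u x (c.trans γ) = character b e c * u x γ) ∧
    ∀ (x₀ : C) (γ₀ : Path pinf x₀), ∃ n : ℤ, (x₀ ≠ pinf → n = -Δ x₀) ∧
      ∃ U : Set C, IsOpen U ∧ x₀ ∈ U ∧ U ⊆ (chartAt ℂ x₀).source ∧
        ∃ F : C → ℂ, MDifferentiableOn 𝓘(ℂ, ℂ) 𝓘(ℂ, ℂ) F U ∧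
          ∀ (x : GoodPoint pinf Δ) (δ : Path x₀ (x : C)), (∀ t, δ t ∈ U) →
            u x (Path.Homotopic.Quotient.mk (γ₀.trans δ)) =
              (chartAt ℂ x₀ x - chartAt ℂ x₀ x₀) ^ n * F x}

/-- `σ` is a meromorphic square root of `η/dz` on the domain of the coordinate `z`. If the divisor
of `η` is `2Δ`, it expresses the canonical meromorphic section `√η` of `O(Δ)`, with
`O(Δ)^{⊗2} ≅ Ω¹`, as `σ(z)√dz`. -/
def IsSqrtCoeff [ChartedSpace ℂ C] (η : OneForm C) (z : OpenPartialHomeomorph C ℂ)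
    (σ : ℂ → ℂ) : Prop :=
  MeromorphicNFOn σ z.target ∧ ∀ w ∈ z.target, σ w ^ 2 = coeff η z w

/-- The section `u` of `L_{Δ,e}` is `f(z)√dz` in the coordinate `z` (with `z(pinf) = 0` and simply
connected domain), for the branch of `u` obtained along paths from `pinf` inside the domain of `z`;
that is, `f` is the analytic extension of `u · σ` to the whole domain of `z` except `pinf`. -/
def IsCoordExpr {pinf : C} {Δ : C →₀ ℤ} (z : OpenPartialHomeomorph C ℂ) (σ : ℂ → ℂ)
    (u : MultiFun pinf Δ) (f : ℂ → ℂ) : Prop :=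
  AnalyticOnNhd ℂ f (z.target \ {0}) ∧
  ∀ (x : GoodPoint pinf Δ) (γ : Path pinf (x : C)), (∀ t, γ t ∈ z.source) →
    f (z x) = u x (Path.Homotopic.Quotient.mk γ) * σ (z x)

/-! ### The matrix `B`, the space `W_e` and its stabilizer -/

/-- The `(N+M) × N` matrix `B`; the row index `N + i` is `Sum.inr i`. -/
def matrixB {M N : ℕ} (p : Fin N → ℂ) (q : Fin M → ℂ) (a : Matrix (Fin M) (Fin N) ℂ) :
    Matrix (Fin N ⊕ Fin M) (Fin N) ℂ :=
  Matrix.fromRows 1 (Matrix.of fun i j =>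
    a i j * ∏ m ∈ Finset.univ.erase j, ((p j)⁻¹ - (p m)⁻¹) / ((q i)⁻¹ - (p m)⁻¹))

/-- The space `W_e` of all `f` in `H⁰(C, L_{Δ,e}(*pinf))` with
`f(p_i) = -∑_j b'_{N+j,i} f(q_j)` for all `i`, where `b'_{N+j,i} = b_{N+j,i} p_i⁻¹ q_j`. -/
def spaceW [ChartedSpace ℂ C] {pinf : C} {g : ℕ}
    (b : Module.Basis (Fin g ⊕ Fin g) ℤ (H1 C pinf)) (Δ : C →₀ ℤ) (e : Fin g → ℂ)
    (z : OpenPartialHomeomorph C ℂ) (σ : ℂ → ℂ) {M N : ℕ} (p : Fin N → ℂ) (q : Fin M → ℂ)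
    (B : Matrix (Fin N ⊕ Fin M) (Fin N) ℂ) : Set (MultiFun pinf Δ) :=
  {u | u ∈ sections b Δ e ∧ ∃ f : ℂ → ℂ, IsCoordExpr z σ u f ∧
    ∀ i, f (p i) = -∑ j, (B (Sum.inr j) i * ((p i)⁻¹ * q j)) * f (q j)}

/-- The product of a function and a section. -/
def mulSection {pinf : C} {Δ : C →₀ ℤ} (f : {x : C // x ≠ pinf} → ℂ) (u : MultiFun pinf Δ) :
    MultiFun pinf Δ :=
  fun x γ => f ⟨x, x.2.1⟩ * u x γ

/-- The stabilizer `{f ∈ R | f W ⊆ W}`. -/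
def stabilizer [ChartedSpace ℂ C] {pinf : C} {Δ : C →₀ ℤ} (W : Set (MultiFun pinf Δ)) :
    Set ({x : C // x ≠ pinf} → ℂ) :=
  {f | f ∈ functionRing pinf ∧ ∀ u ∈ W, mulSection f u ∈ W}

end KPCurve

end

/-!
A function `f ∈ R` with `f(P_i) = f(Q_j)` whenever `b_{N+j,i} ≠ 0` multiplies both sides of the
conditions defining `W_e` by the same values, hence preserves `W_e`. Conversely, suppose that `f`
preserves `W_e` and `f(P_i) ≠ f(Q_j)` although `b_{N+j,i} ≠ 0`. Then `f` is not constant, and the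
existence of a nonconstant element of `R` implies that sections of `L_{Δ,e}` take arbitrary values
at finitely many points of `C ∖ {p_∞}`. So there is `u ∈ W_e` with `u(q_j) = 1`, vanishing at the
other `q_l`, and the conditions for `u` and `f u` at `p_i` give
`b'_{N+j,i} f(P_i) = b'_{N+j,i} f(Q_j)`, a contradiction.

To find a section that vanishes at some of the points but not at the point `s`, twist `Δ` by the
former, and consider the principal parts `(f - f(s))⁻ⁿ` at `s`. Finitely many linear conditions
decide whether a combination of them is realized by a meromorphic section with no other pole, so
some nontrivial combination is, and multiplication by a power of `f - f(s)` moves its pole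
to `p_∞`. The finiteness comes from solving the `∂̄`-equation over a finite atlas by discs with
Cauchy transforms. The error made in gluing the local solutions involves the Cauchy transform of a
function on the unit disc only at points of modulus at least `3/2`, where its Laurent expansion
converges geometrically: up to finitely many moments, the error operator has norm less than one.
-/

noncomputable section

namespace KPCurve

open MeasureTheory Complex Metric
open scoped ComplexConjugate

/-! ### The Wirtinger derivative -/

/-- The Wirtinger derivative `∂F/∂z̄`; like `fderiv`, it is `0` where `F` is not
real differentiable. -/
def dbar (F : ℂ → ℂ) (z : ℂ) : ℂ := (1 / 2) * (fderiv ℝ F z 1 + I * fderiv ℝ F z I)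

section Wirtinger

variable {F G : ℂ → ℂ} {z : ℂ}

theorem dbar_congr (h : F =ᶠ[𝓝 z] G) : dbar F z = dbar G z := by
  simp only [dbar, h.fderiv_eq]

theorem dbar_eq_zero (h : DifferentiableAt ℂ F z) : dbar F z = 0 := by
  simp only [dbar, (differentiableAt_complex_iff_differentiableAt_real.1 h).2, smul_eq_mul]
  linear_combination (1 / 2) * fderiv ℝ F z 1 * I_mul_I

theorem dbar_eq_zero_of_eventuallyEq_const {c : ℂ} (h : F =ᶠ[𝓝 z] fun _ => c) :
    dbar F z = 0 :=
  (dbar_congr h).trans (dbar_eq_zero (differentiableAt_const c))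

theorem differentiableAt_of_dbar_eq_zero (hF : DifferentiableAt ℝ F z) (h : dbar F z = 0) :
    DifferentiableAt ℂ F z := by
  refine differentiableAt_complex_iff_differentiableAt_real.2 ⟨hF, ?_⟩
  rw [dbar] at h
  rw [smul_eq_mul]
  linear_combination (-2 * I) * h + fderiv ℝ F z I * I_mul_I

theorem dbar_sub (hF : DifferentiableAt ℝ F z) (hG : DifferentiableAt ℝ G z) :
    dbar (fun w => F w - G w) z = dbar F z - dbar G z := by
  simp only [dbar, fderiv_fun_sub hF hG, _root_.sub_apply]
  ring

theorem dbar_sum {ι : Type*} (s : Finset ι) {F : ι → ℂ → ℂ}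
    (hF : ∀ i ∈ s, DifferentiableAt ℝ (F i) z) :
    dbar (fun w => ∑ i ∈ s, F i w) z = ∑ i ∈ s, dbar (F i) z := by
  simp only [dbar, fderiv_fun_sum hF, _root_.sum_apply, Finset.mul_sum,
    ← Finset.sum_add_distrib]

theorem dbar_mul (hF : DifferentiableAt ℝ F z) (hG : DifferentiableAt ℝ G z) :
    dbar (fun w => F w * G w) z = dbar F z * G z + F z * dbar G z := by
  simp only [dbar, fderiv_fun_mul hF hG, _root_.add_apply, _root_.smul_apply, smul_eq_mul]
  ring

theorem fderiv_eq_add_dbar_mul_conj (F : ℂ → ℂ) (z v : ℂ) :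
    fderiv ℝ F z v =
      (1 / 2) * (fderiv ℝ F z 1 - I * fderiv ℝ F z I) * v + dbar F z * conj v := by
  have fderiv_eq_re_im : fderiv ℝ F z v = v.re * fderiv ℝ F z 1 + v.im * fderiv ℝ F z I := by
    conv_lhs => rw [show v = v.re • (1 : ℂ) + v.im • I by simp [re_add_im]]
    rw [map_add, map_smul, map_smul, real_smul, real_smul]
  rw [fderiv_eq_re_im, dbar]
  have conj_eq : conj v = v.re - v.im * I := by
    apply Complex.ext <;> simp
  linear_combination (-(1 / 2) * (fderiv ℝ F z 1 - I * fderiv ℝ F z I)) * (re_add_im v).symm -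
    (1 / 2) * (fderiv ℝ F z 1 + I * fderiv ℝ F z I) * conj_eq +
    (v.im : ℂ) * fderiv ℝ F z I * I_mul_I

theorem dbar_comp {g : ℂ → ℂ} (hF : DifferentiableAt ℝ F (g z)) (hg : DifferentiableAt ℂ g z) :
    dbar (fun w => F (g w)) z = conj (deriv g z) * dbar F (g z) := by
  have fderiv_comp_apply (v : ℂ) :
      fderiv ℝ (fun w => F (g w)) z v = fderiv ℝ F (g z) (deriv g z * v) := by
    have := (hF.hasFDerivAt.comp z (hg.hasFDerivAt.restrictScalars ℝ)).fderiv
    rw [show (fun w => F (g w)) = F ∘ g from rfl, this]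
    simp [mul_comm]
  rw [dbar, fderiv_comp_apply, fderiv_comp_apply, fderiv_eq_add_dbar_mul_conj F (g z),
    fderiv_eq_add_dbar_mul_conj F (g z) (deriv g z * I)]
  simp only [mul_one, map_mul, conj_I]
  linear_combination (1 / 2) * ((1 / 2) * (fderiv ℝ F (g z) 1 - I * fderiv ℝ F (g z) I) *
    deriv g z - dbar F (g z) * conj (deriv g z)) * I_mul_I

theorem contDiffAt_dbar (hF : ContDiffAt ℝ 2 F z) : ContDiffAt ℝ 1 (dbar F) z := by
  have : ContDiffAt ℝ 1 (fderiv ℝ F) z := hF.fderiv_right (by norm_num)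
  unfold dbar
  fun_prop

theorem dbar_mul_inv_of_norm_eq_one (F : ℂ → ℂ) (z : ℂ) {u : ℂ} (hu : ‖u‖ = 1) :
    dbar F z * u⁻¹ = (1 / 2) * (fderiv ℝ F z u + I * fderiv ℝ F z (u * I)) := by
  rw [inv_eq_conj hu, fderiv_eq_add_dbar_mul_conj F z u, fderiv_eq_add_dbar_mul_conj F z (u * I)]
  simp only [map_mul, conj_I]
  linear_combination ((1 / 2) * dbar F z * conj u -
    (1 / 2) * ((1 / 2) * (fderiv ℝ F z 1 - I * fderiv ℝ F z I)) * u) * I_mul_I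

end Wirtinger

/-! ### The Cauchy–Pompeiu formula -/

section CauchyPompeiu

variable {F : ℂ → ℂ}

theorem integral_Ioi_fderiv_mul (hF : ContDiff ℝ 1 F) (hc : HasCompactSupport F) {u : ℂ}
    (hu : u ≠ 0) : ∫ r in Set.Ioi (0 : ℝ), fderiv ℝ F (r * u) u = -F 0 := by
  have deriv_ray (r : ℝ) : deriv (F ∘ fun r : ℝ => r • u) r = fderiv ℝ F (r * u) u := by
    have hasDerivAt_ray : HasDerivAt (fun r : ℝ => r • u) u r := by
      simpa using (hasDerivAt_id r).smul_const u
    simpa using ((hF.differentiable one_ne_zero _).hasFDerivAt.comp_hasDerivAt r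
      hasDerivAt_ray).deriv
  simp_rw [← deriv_ray]
  rw [(hc.comp_isClosedEmbedding (isClosedEmbedding_smul_left hu)).integral_Ioi_deriv_eq
    (hF.comp (by fun_prop))]
  simp

theorem integral_fderiv_circleMap (hF : ContDiff ℝ 1 F) (r : ℝ) :
    ∫ θ in -Real.pi..Real.pi, fderiv ℝ F (circleMap 0 r θ) (circleMap 0 r θ * I) = 0 := by
  have hasDerivAt_comp (θ : ℝ) : HasDerivAt (fun θ => F (circleMap 0 r θ))
      (fderiv ℝ F (circleMap 0 r θ) (circleMap 0 r θ * I)) θ :=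
    (hF.differentiable one_ne_zero _).hasFDerivAt.comp_hasDerivAt θ (hasDerivAt_circleMap 0 r θ)
  have := hF.continuous_fderiv one_ne_zero
  rw [intervalIntegral.integral_eq_sub_of_hasDerivAt (fun θ _ => hasDerivAt_comp θ)
    (Continuous.intervalIntegrable (by fun_prop) _ _)]
  simp [circleMap_zero, exp_neg]

theorem polarCoord_symm_eq_mul_circleMap (p : ℝ × ℝ) :
    Complex.polarCoord.symm p = p.1 * circleMap 0 1 p.2 := by
  simp [Complex.polarCoord_symm_apply, circleMap_zero, exp_mul_I]

theorem integrableOn_polarCoord_target {E : Type*} [NormedAddCommGroup E] {G : ℝ × ℝ → E} {R : ℝ}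
    (hG : Continuous G) (h0 : ∀ p : ℝ × ℝ, R ≤ p.1 → G p = 0) :
    IntegrableOn G polarCoord.target := by
  refine (hG.continuousOn.integrableOn_compact (isCompact_Icc.prod isCompact_Icc) :
    IntegrableOn G (Set.Icc 0 R ×ˢ Set.Icc (-Real.pi) Real.pi)).of_forall_sdiff_eq_zero
    (polarCoord_target ▸ measurableSet_Ioi.prod measurableSet_Ioo) ?_
  rintro p ⟨⟨hr, hθ⟩, hp⟩
  refine h0 p (le_of_not_ge fun hpR => hp ⟨⟨le_of_lt hr, hpR⟩, le_of_lt hθ.1, le_of_lt hθ.2⟩)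

theorem integrableOn_fderiv_mul_circleMap (hF : ContDiff ℝ 1 F) (hc : HasCompactSupport F)
    {v : ℝ → ℂ} (hv : Continuous v) :
    IntegrableOn (fun p : ℝ × ℝ => fderiv ℝ F (p.1 * circleMap 0 1 p.2) (v p.2))
      polarCoord.target := by
  obtain ⟨R, hR⟩ := (hc.fderiv ℝ).isCompact.isBounded.subset_ball 0
  have := hF.continuous_fderiv one_ne_zero
  refine integrableOn_polarCoord_target (R := R) (by fun_prop) fun p hp => ?_
  rw [image_eq_zero_of_notMem_tsupport (f := fderiv ℝ F) fun hmem => ?_, _root_.zero_apply]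
  have norm_lt := mem_ball_zero_iff.1 (hR hmem)
  rw [norm_mul, norm_circleMap_zero, abs_one, mul_one, norm_real] at norm_lt
  exact absurd (hp.trans (Real.le_norm_self _)) norm_lt.not_ge

theorem integral_radial_fderiv (hF : ContDiff ℝ 1 F) (hc : HasCompactSupport F) :
    ∫ p in polarCoord.target, fderiv ℝ F (p.1 * circleMap 0 1 p.2) (circleMap 0 1 p.2) =
      -(2 * Real.pi) * F 0 := by
  have integrable := integrableOn_fderiv_mul_circleMap hF hc (continuous_circleMap 0 1)
  rw [polarCoord_target] at integrable ⊢
  rw [Measure.volume_eq_prod, ← Measure.prod_restrict, integral_prod_symm _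
    (by rwa [Measure.prod_restrict])]
  have circleMap_ne_zero (θ : ℝ) : circleMap 0 1 θ ≠ 0 := circleMap_ne_center one_ne_zero
  simp only [integral_Ioi_fderiv_mul hF hc (circleMap_ne_zero _), setIntegral_const,
    Real.volume_real_Ioo, real_smul]
  rw [max_eq_left (by linarith [Real.pi_pos])]
  push_cast
  ring

theorem integral_angular_fderiv (hF : ContDiff ℝ 1 F) (hc : HasCompactSupport F) :
    ∫ p in polarCoord.target, fderiv ℝ F (p.1 * circleMap 0 1 p.2) (circleMap 0 1 p.2 * I) = 0 := by
  have integrable := integrableOn_fderiv_mul_circleMap hF hc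
    (v := fun θ => circleMap 0 1 θ * I) (by fun_prop)
  rw [polarCoord_target] at integrable ⊢
  rw [Measure.volume_eq_prod, setIntegral_prod _ integrable]
  refine setIntegral_eq_zero_of_forall_eq_zero fun r (hr : 0 < r) => ?_
  have integrand_eq (θ : ℝ) : fderiv ℝ F (r * circleMap 0 1 θ) (circleMap 0 1 θ * I) =
      r⁻¹ * fderiv ℝ F (circleMap 0 r θ) (circleMap 0 r θ * I) := by
    rw [show circleMap 0 r θ = r • circleMap 0 1 θ by simp [circleMap_zero], smul_mul_assoc,
      map_smul, real_smul, real_smul, ofReal_inv, inv_mul_cancel_left₀ (ofReal_ne_zero.2 hr.ne')]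
  simp_rw [integrand_eq]
  rw [integral_const_mul, ← integral_Ioc_eq_integral_Ioo,
    ← intervalIntegral.integral_of_le (by linarith [Real.pi_pos]),
    integral_fderiv_circleMap hF, mul_zero]

theorem integral_inv_mul_dbar (hF : ContDiff ℝ 1 F) (hc : HasCompactSupport F) :
    ∫ t : ℂ, t⁻¹ * dbar F t = -Real.pi * F 0 := by
  have integrand_eq : ∀ p ∈ polarCoord.target,
      p.1 • ((Complex.polarCoord.symm p)⁻¹ * dbar F (Complex.polarCoord.symm p)) =
        (1 / 2) * (fderiv ℝ F (p.1 * circleMap 0 1 p.2) (circleMap 0 1 p.2) +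
          I * fderiv ℝ F (p.1 * circleMap 0 1 p.2) (circleMap 0 1 p.2 * I)) := by
    intro p hp
    have hr : (p.1 : ℂ) ≠ 0 := ofReal_ne_zero.2 (ne_of_gt hp.1)
    rw [polarCoord_symm_eq_mul_circleMap, real_smul, mul_inv, mul_assoc, mul_inv_cancel_left₀ hr,
      mul_comm, dbar_mul_inv_of_norm_eq_one _ _ (by simp)]
  rw [← Complex.integral_comp_polarCoord_symm,
    setIntegral_congr_fun polarCoord.open_target.measurableSet integrand_eq, integral_const_mul,
    integral_add (integrableOn_fderiv_mul_circleMap hF hc (continuous_circleMap 0 1))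
      ((integrableOn_fderiv_mul_circleMap hF hc
        (v := fun θ => circleMap 0 1 θ * I) (by fun_prop)).const_mul I),
    integral_const_mul, integral_radial_fderiv hF hc, integral_angular_fderiv hF hc]
  ring

end CauchyPompeiu

/-! ### The Cauchy transform -/

/-- The Cauchy transform `(1/π) ∫ h(w) / (ζ - w) dA(w)`, which inverts `dbar` on compactly
supported functions. -/
def cauchyTransform (h : ℂ → ℂ) (ζ : ℂ) : ℂ := (Real.pi : ℂ)⁻¹ * ∫ w : ℂ, (ζ - w)⁻¹ * h w

section CauchyTransform

variable {h : ℂ → ℂ}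

open scoped Convolution

theorem locallyIntegrable_inv : LocallyIntegrable (fun t : ℂ => t⁻¹) :=
  locallyIntegrable_of_norm_le_rpow (C := 1) (α := 1) (by simp) (by simp)
    (.of_forall fun t => by simp [Real.rpow_neg_one]) measurable_inv.aestronglyMeasurable

theorem cauchyTransform_eq_convolution (h : ℂ → ℂ) :
    cauchyTransform h = fun ζ => (Real.pi : ℂ)⁻¹ *
      ((fun t : ℂ => t⁻¹) ⋆[ContinuousLinearMap.mul ℝ ℂ, volume] h) ζ := by
  funext ζ
  rw [convolution_eq_swap]
  rfl

theorem contDiff_cauchyTransform (hh : ContDiff ℝ 1 h) (hc : HasCompactSupport h) :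
    ContDiff ℝ 1 (cauchyTransform h) := by
  rw [cauchyTransform_eq_convolution]
  exact contDiff_const.mul
    (hc.contDiff_convolution_right (n := 1) _ locallyIntegrable_inv (by exact_mod_cast hh))

theorem convolutionExistsAt_inv_fderiv (hh : ContDiff ℝ 1 h) (hc : HasCompactSupport h) (ζ : ℂ) :
    ConvolutionExistsAt (fun t : ℂ => t⁻¹) (fderiv ℝ h) ζ
      ((ContinuousLinearMap.mul ℝ ℂ).precompR ℂ) volume :=
  (hc.fderiv ℝ).convolutionExists_right _ locallyIntegrable_inv
    (hh.continuous_fderiv one_ne_zero) ζ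

theorem fderiv_cauchyTransform_apply (hh : ContDiff ℝ 1 h) (hc : HasCompactSupport h) (ζ v : ℂ) :
    fderiv ℝ (cauchyTransform h) ζ v =
      (Real.pi : ℂ)⁻¹ * ∫ t : ℂ, t⁻¹ * fderiv ℝ h (ζ - t) v := by
  rw [cauchyTransform_eq_convolution, ((hc.hasFDerivAt_convolution_right
    (ContinuousLinearMap.mul ℝ ℂ) locallyIntegrable_inv hh ζ).const_mul _).fderiv,
    _root_.smul_apply, smul_eq_mul, convolution_def,
    ContinuousLinearMap.integral_apply (convolutionExistsAt_inv_fderiv hh hc ζ)]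
  rfl

theorem dbar_cauchyTransform_eq_integral (hh : ContDiff ℝ 1 h) (hc : HasCompactSupport h) (ζ : ℂ) :
    dbar (cauchyTransform h) ζ = (Real.pi : ℂ)⁻¹ * ∫ t : ℂ, t⁻¹ * dbar h (ζ - t) := by
  have integrable (v : ℂ) : Integrable fun t : ℂ => t⁻¹ * fderiv ℝ h (ζ - t) v :=
    (convolutionExistsAt_inv_fderiv hh hc ζ).integrable.apply_continuousLinearMap v
  have integrand_eq (t : ℂ) : t⁻¹ * dbar h (ζ - t) = (1 / 2) *
      (t⁻¹ * fderiv ℝ h (ζ - t) 1 + I * (t⁻¹ * fderiv ℝ h (ζ - t) I)) := by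
    rw [dbar]
    ring
  simp_rw [integrand_eq]
  rw [integral_const_mul, integral_add (integrable 1) ((integrable I).const_mul I),
    integral_const_mul, dbar, fderiv_cauchyTransform_apply hh hc,
    fderiv_cauchyTransform_apply hh hc]
  ring

theorem dbar_cauchyTransform (hh : ContDiff ℝ 1 h) (hc : HasCompactSupport h) (ζ : ℂ) :
    dbar (cauchyTransform h) ζ = h ζ := by
  have dbar_reflect (t : ℂ) : dbar (fun t => h (ζ - t)) t = -dbar h (ζ - t) := by
    rw [dbar_comp (hh.differentiable one_ne_zero _) (by fun_prop), deriv_const_sub, deriv_id'']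
    simp
  have pompeiu := integral_inv_mul_dbar (F := fun t => h (ζ - t)) (hh.comp (by fun_prop))
    (hc.comp_homeomorph (Homeomorph.subLeft ζ))
  simp_rw [dbar_reflect, mul_neg, integral_neg, sub_zero] at pompeiu
  have hpi : (Real.pi : ℂ) ≠ 0 := ofReal_ne_zero.2 Real.pi_ne_zero
  rw [dbar_cauchyTransform_eq_integral hh hc, inv_mul_eq_iff_eq_mul₀ hpi]
  linear_combination -pompeiu

end CauchyTransform

/-! ### Laurent expansion of the Cauchy transform at infinity -/

/-- The Cauchy transform of the restriction of `h` to the closed unit disc. -/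
def cauchyDisc (h : ℂ → ℂ) (ζ : ℂ) : ℂ :=
  (Real.pi : ℂ)⁻¹ * ∫ w in closedBall (0 : ℂ) 1, (ζ - w)⁻¹ * h w

/-- The moments of `h` on the closed unit disc; up to a shift of the index they are the Laurent
coefficients of `cauchyDisc h` at infinity. -/
def discMoment (h : ℂ → ℂ) (m : ℕ) : ℂ :=
  (Real.pi : ℂ)⁻¹ * ∫ w in closedBall (0 : ℂ) 1, w ^ m * h w

/-- The remainder after `n` terms of the Laurent expansion of `cauchyDisc h` at infinity. -/
def cauchyTail (n : ℕ) (h : ℂ → ℂ) (ζ : ℂ) : ℂ := (ζ ^ n)⁻¹ * cauchyDisc (fun w => w ^ n * h w) ζ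

section CauchyDisc

variable {h k : ℂ → ℂ} {ζ w : ℂ} {C : ℝ}

theorem cauchyTransform_eq_cauchyDisc (hs : Function.support h ⊆ closedBall 0 1) :
    cauchyTransform h = cauchyDisc h := by
  funext ζ
  rw [cauchyTransform, cauchyDisc, setIntegral_eq_integral_of_forall_compl_eq_zero]
  intro w hw
  rw [Function.notMem_support.1 fun hw' => hw (hs hw'), mul_zero]

theorem sub_one_le_norm_sub_of_mem_closedBall {r : ℝ} (hζ : r ≤ ‖ζ‖)
    (hw : w ∈ closedBall (0 : ℂ) 1) : r - 1 ≤ ‖ζ - w‖ :=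
  (sub_le_sub hζ (mem_closedBall_zero_iff.1 hw)).trans (norm_sub_norm_le ζ w)

theorem sub_ne_zero_of_mem_closedBall (hζ : 1 < ‖ζ‖) (hw : w ∈ closedBall (0 : ℂ) 1) :
    ζ - w ≠ 0 :=
  norm_pos_iff.1 ((sub_pos.2 hζ).trans_le (sub_one_le_norm_sub_of_mem_closedBall le_rfl hw))

theorem integrableOn_cauchyKernel (hh : Continuous h) (hζ : 1 < ‖ζ‖) :
    IntegrableOn (fun w => (ζ - w)⁻¹ * h w) (closedBall 0 1) :=
  ContinuousOn.integrableOn_compact (isCompact_closedBall 0 1)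
    ((ContinuousOn.inv₀ (by fun_prop) fun _ => sub_ne_zero_of_mem_closedBall hζ).mul
      hh.continuousOn)

theorem aestronglyMeasurable_deriv_cauchyKernel (hh : Continuous h) (hζ : 1 < ‖ζ‖) :
    AEStronglyMeasurable (fun w => -((ζ - w) ^ 2)⁻¹ * h w)
      (volume.restrict (closedBall 0 1)) := by
  refine ContinuousOn.aestronglyMeasurable ?_ measurableSet_closedBall
  exact (ContinuousOn.inv₀ (by fun_prop) fun _ hw =>
    pow_ne_zero 2 (sub_ne_zero_of_mem_closedBall hζ hw)).neg.mul hh.continuousOn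

theorem hasDerivAt_cauchyKernel (hζw : ζ - w ≠ 0) (c : ℂ) :
    HasDerivAt (fun ζ => (ζ - w)⁻¹ * c) (-((ζ - w) ^ 2)⁻¹ * c) ζ := by
  simpa [neg_div] using (((hasDerivAt_id ζ).sub_const w).inv hζw).mul_const c

theorem differentiableOn_cauchyDisc (hh : Continuous h) :
    DifferentiableOn ℂ (cauchyDisc h) {ζ | 1 < ‖ζ‖} := by
  intro ζ₀ hζ₀
  obtain ⟨r, one_lt_r, r_lt⟩ := exists_between (show (1 : ℝ) < ‖ζ₀‖ from hζ₀)
  obtain ⟨C, hC⟩ := (isCompact_closedBall (0 : ℂ) 1).exists_bound_of_continuousOn hh.continuousOn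
  have nhds_mem : {ζ : ℂ | r < ‖ζ‖} ∈ 𝓝 ζ₀ :=
    (isOpen_lt continuous_const continuous_norm).mem_nhds r_lt
  have hasDerivAt_integral := hasDerivAt_integral_of_dominated_loc_of_deriv_le (𝕜 := ℂ)
    (μ := volume.restrict (closedBall (0 : ℂ) 1)) (F := fun ζ w => (ζ - w)⁻¹ * h w)
    (F' := fun ζ w => -((ζ - w) ^ 2)⁻¹ * h w) (x₀ := ζ₀) (bound := fun _ => ((r - 1) ^ 2)⁻¹ * C)
    nhds_mem
    (by
      filter_upwards [nhds_mem] with ζ hζ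
      exact (integrableOn_cauchyKernel hh (one_lt_r.trans hζ)).aestronglyMeasurable)
    (integrableOn_cauchyKernel hh hζ₀) (aestronglyMeasurable_deriv_cauchyKernel hh hζ₀)
    (by
      filter_upwards [ae_restrict_mem measurableSet_closedBall] with w hw ζ hζ
      have dist_ge := sub_one_le_norm_sub_of_mem_closedBall (le_of_lt hζ) hw
      have : 0 < r - 1 := sub_pos.2 one_lt_r
      rw [norm_mul, norm_neg, norm_inv, norm_pow]
      gcongr
      exact hC w hw)
    (integrableOn_const (by simp))
    (by
      filter_upwards [ae_restrict_mem measurableSet_closedBall] with w hw ζ hζ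
      exact hasDerivAt_cauchyKernel
        (sub_ne_zero_of_mem_closedBall (one_lt_r.trans hζ) hw) (h w))
  exact (hasDerivAt_integral.2.const_mul _).differentiableAt.differentiableWithinAt

theorem differentiableOn_cauchyTail (n : ℕ) (hh : Continuous h) :
    DifferentiableOn ℂ (cauchyTail n h) {ζ | 1 < ‖ζ‖} :=
  DifferentiableOn.mul
    (DifferentiableOn.inv (by fun_prop) fun _ hζ =>
      pow_ne_zero n (norm_pos_iff.1 (zero_lt_one.trans hζ)))
    (differentiableOn_cauchyDisc (by fun_prop))

theorem norm_cauchyDisc_le (hC : ∀ w ∈ closedBall (0 : ℂ) 1, ‖h w‖ ≤ C) (hζ : 3 / 2 ≤ ‖ζ‖) :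
    ‖cauchyDisc h ζ‖ ≤ 2 * C := by
  have norm_integral_le : ‖∫ w in closedBall (0 : ℂ) 1, (ζ - w)⁻¹ * h w‖ ≤
      2 * C * volume.real (closedBall (0 : ℂ) 1) := by
    refine norm_setIntegral_le_of_norm_le_const (isCompact_closedBall (0 : ℂ) 1).measure_lt_top ?_
    intro w hw
    have half_le : 2⁻¹ ≤ ‖ζ - w‖ := by
      linarith [sub_one_le_norm_sub_of_mem_closedBall hζ hw]
    rw [norm_mul, norm_inv]
    exact mul_le_mul (inv_le_of_inv_le₀ two_pos half_le) (hC w hw) (norm_nonneg _) two_pos.le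
  have area : volume.real (closedBall (0 : ℂ) 1) = Real.pi := by
    simp [Measure.real, Complex.volume_closedBall]
  rw [cauchyDisc, norm_mul, norm_inv, norm_real, Real.norm_of_nonneg Real.pi_pos.le,
    inv_mul_le_iff₀ Real.pi_pos]
  linarith [area ▸ norm_integral_le]

theorem norm_cauchyTail_le (n : ℕ) (hC : ∀ w ∈ closedBall (0 : ℂ) 1, ‖h w‖ ≤ C)
    (hζ : 3 / 2 ≤ ‖ζ‖) : ‖cauchyTail n h ζ‖ ≤ (2 / 3) ^ n * (2 * C) := by
  have norm_pow_mul_le (w : ℂ) (hw : w ∈ closedBall (0 : ℂ) 1) : ‖w ^ n * h w‖ ≤ C := by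
    rw [norm_mul, norm_pow]
    exact (mul_le_of_le_one_left (norm_nonneg _)
      (pow_le_one₀ (norm_nonneg _) (mem_closedBall_zero_iff.1 hw))).trans (hC w hw)
  have norm_inv_le : ‖ζ‖⁻¹ ≤ 2 / 3 := inv_le_of_inv_le₀ (by norm_num) (by linarith)
  rw [cauchyTail, norm_mul, norm_inv, norm_pow, ← inv_pow]
  exact mul_le_mul (pow_le_pow_left₀ (by positivity) norm_inv_le n)
    (norm_cauchyDisc_le norm_pow_mul_le hζ) (norm_nonneg _) (by positivity)

theorem integrableOn_pow_mul (hh : Continuous h) (m : ℕ) :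
    IntegrableOn (fun w : ℂ => w ^ m * h w) (closedBall 0 1) :=
  (Continuous.continuousOn (by fun_prop)).integrableOn_compact (isCompact_closedBall 0 1)

theorem cauchyDisc_pow_mul (n : ℕ) (hh : Continuous h) (hζ : 1 < ‖ζ‖) :
    cauchyDisc (fun w => w ^ n * h w) ζ =
      ζ⁻¹ * discMoment h n + ζ⁻¹ * cauchyDisc (fun w => w ^ (n + 1) * h w) ζ := by
  have hζ₀ : ζ ≠ 0 := norm_pos_iff.1 (zero_lt_one.trans hζ)
  have integral_eq : ∫ w in closedBall (0 : ℂ) 1, (ζ - w)⁻¹ * (w ^ n * h w) =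
      ∫ w in closedBall (0 : ℂ) 1,
        (ζ⁻¹ * (w ^ n * h w) + ζ⁻¹ * ((ζ - w)⁻¹ * (w ^ (n + 1) * h w))) := by
    refine setIntegral_congr_fun measurableSet_closedBall fun w hw => ?_
    have := sub_ne_zero_of_mem_closedBall hζ hw
    field_simp
    ring
  have hkernel : IntegrableOn (fun w => (ζ - w)⁻¹ * (w ^ (n + 1) * h w)) (closedBall 0 1) :=
    integrableOn_cauchyKernel (by fun_prop) hζ
  simp only [cauchyDisc, discMoment]
  rw [integral_eq, integral_add ((integrableOn_pow_mul hh n).const_mul _) (hkernel.const_mul _),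
    integral_const_mul, integral_const_mul]
  ring

theorem cauchyDisc_eq_sum_add_cauchyTail (n : ℕ) (hh : Continuous h) (hζ : 1 < ‖ζ‖) :
    cauchyDisc h ζ = ∑ m ∈ Finset.range n, (ζ ^ (m + 1))⁻¹ * discMoment h m + cauchyTail n h ζ := by
  have hζ₀ : ζ ≠ 0 := norm_pos_iff.1 (zero_lt_one.trans hζ)
  induction n with
  | zero => simp [cauchyTail]
  | succ n ih =>
    rw [ih, Finset.sum_range_succ, add_assoc, cauchyTail, cauchyTail, cauchyDisc_pow_mul n hh hζ]
    field_simp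
    ring

theorem cauchyDisc_add (hh : Continuous h) (hk : Continuous k) (hζ : 1 < ‖ζ‖) :
    cauchyDisc (fun w => h w + k w) ζ = cauchyDisc h ζ + cauchyDisc k ζ := by
  simp only [cauchyDisc, mul_add]
  rw [integral_add (integrableOn_cauchyKernel hh hζ) (integrableOn_cauchyKernel hk hζ), mul_add]

theorem cauchyDisc_const_mul (c : ℂ) (h : ℂ → ℂ) (ζ : ℂ) :
    cauchyDisc (fun w => c * h w) ζ = c * cauchyDisc h ζ := by
  simp only [cauchyDisc, mul_left_comm _ c, integral_const_mul]

theorem cauchyTail_add (n : ℕ) (hh : Continuous h) (hk : Continuous k) (hζ : 1 < ‖ζ‖) :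
    cauchyTail n (fun w => h w + k w) ζ = cauchyTail n h ζ + cauchyTail n k ζ := by
  simp only [cauchyTail, mul_add]
  rw [cauchyDisc_add (h := fun w => w ^ n * h w) (by fun_prop) (by fun_prop) hζ, mul_add]

theorem cauchyTail_const_mul (n : ℕ) (c : ℂ) (h : ℂ → ℂ) (ζ : ℂ) :
    cauchyTail n (fun w => c * h w) ζ = c * cauchyTail n h ζ := by
  simp only [cauchyTail, mul_left_comm _ c, cauchyDisc_const_mul]

theorem discMoment_add (hh : Continuous h) (hk : Continuous k) (m : ℕ) :
    discMoment (fun w => h w + k w) m = discMoment h m + discMoment k m := by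
  simp only [discMoment, mul_add]
  rw [integral_add (integrableOn_pow_mul hh m) (integrableOn_pow_mul hk m), mul_add]

theorem discMoment_const_mul (c : ℂ) (h : ℂ → ℂ) (m : ℕ) :
    discMoment (fun w => c * h w) m = c * discMoment h m := by
  simp only [discMoment, mul_left_comm _ c, integral_const_mul]

end CauchyDisc

/-! ### Integral equations with holomorphic transfer -/

theorem exists_add_apply_eq_linearCombination {𝕜 E V ι : Type*} [NontriviallyNormedField 𝕜]
    [NormedAddCommGroup E] [NormedSpace 𝕜 E] [CompleteSpace E] [AddCommGroup V] [Module 𝕜 V]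
    [FiniteDimensional 𝕜 V] [Infinite ι] {G : E →L[𝕜] E} (hG : ‖G‖ < 1) (μ : E →ₗ[𝕜] V)
    (Y : ι → E) :
    ∃ (c : ι →₀ 𝕜) (x : E),
      c ≠ 0 ∧ μ x = 0 ∧ x + G x = Finsupp.linearCombination 𝕜 Y c := by
  have isUnit_one_add : IsUnit (1 + G) := by
    simpa using isUnit_one_sub_of_norm_lt_one (x := -G) (by rwa [norm_neg])
  obtain ⟨S, hS⟩ := isUnit_one_add.exists_right_inv
  have not_linearIndependent : ¬ LinearIndependent 𝕜 fun k => μ (S (Y k)) := fun h =>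
    have := h.finite
    not_finite ι
  rw [linearIndependent_iff] at not_linearIndependent
  push Not at not_linearIndependent
  obtain ⟨c, hc, c_ne⟩ := not_linearIndependent
  refine ⟨c, S (Finsupp.linearCombination 𝕜 Y c), c_ne, ?_, DFunLike.congr_fun hS _⟩
  rwa [← ContinuousLinearMap.coe_coe, Finsupp.apply_linearCombination,
    Finsupp.apply_linearCombination]

/-- The data of a system of integral equations
`h j + ∑ i, A j i * (cauchyTransform (h i) ∘ Z j i) = φ j` on the unit disc: the maps `Z j i`
send the supports of the coefficients `A j i` into a region where the Laurent expansion of the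
Cauchy transform converges geometrically. -/
structure IsTransfer {I : Type*} (A Z : I → I → ℂ → ℂ) : Prop where
  contDiff_mul_comp : ∀ j i (Φ : ℂ → ℂ), DifferentiableOn ℂ Φ {ζ | 1 < ‖ζ‖} →
    ContDiff ℝ 1 fun z => A j i z * Φ (Z j i z)
  three_halves_le_norm : ∀ j i z, A j i z ≠ 0 → 3 / 2 ≤ ‖Z j i z‖
  support_subset : ∀ j i, Function.support (A j i) ⊆ closedBall 0 1

theorem hasCompactSupport_of_support_subset_closedBall {f : ℂ → ℂ}
    (hf : Function.support f ⊆ closedBall 0 1) : HasCompactSupport f :=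
  .of_support_subset_isCompact (isCompact_closedBall 0 1) hf

namespace IsTransfer

open scoped BoundedContinuousFunction

variable {I : Type*} {A Z : I → I → ℂ → ℂ} {C : ℝ}

/-- The linear map `h ↦ (moments of order < n of the components of h)`. -/
def momentMap (I : Type*) (n : ℕ) : (I → ℂ →ᵇ ℂ) →ₗ[ℂ] (I × Fin n → ℂ) where
  toFun h p := discMoment (h p.1) p.2
  map_add' h k := funext fun p => discMoment_add (h p.1).continuous (k p.1).continuous _
  map_smul' c h := funext fun p => discMoment_const_mul c (h p.1) _

theorem cauchyTail_eq_cauchyDisc_of_momentMap_eq_zero {n : ℕ} {h : I → ℂ →ᵇ ℂ}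
    (hm : momentMap I n h = 0) (i : I) {ζ : ℂ} (hζ : 1 < ‖ζ‖) :
    cauchyTail n (h i) ζ = cauchyDisc (h i) ζ := by
  rw [cauchyDisc_eq_sum_add_cauchyTail n (h i).continuous hζ, Finset.sum_eq_zero, zero_add]
  intro m hmn
  have moment_eq : discMoment (h i) m = 0 := congrFun hm (i, ⟨m, Finset.mem_range.1 hmn⟩)
  rw [moment_eq, mul_zero]

theorem one_lt_norm (hA : IsTransfer A Z) {j i : I} {z : ℂ} (hz : A j i z ≠ 0) :
    1 < ‖Z j i z‖ :=
  lt_of_lt_of_le (by norm_num) (hA.three_halves_le_norm j i z hz)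

theorem exists_norm_le [Finite I] (hA : IsTransfer A Z) :
    ∃ C : ℝ, 0 ≤ C ∧ ∀ j i z, ‖A j i z‖ ≤ C := by
  have norm_le (p : I × I) : ∃ C : ℝ, ∀ z, ‖A p.1 p.2 z‖ ≤ C := by
    have contDiff : ContDiff ℝ 1 (A p.1 p.2) := by
      simpa using hA.contDiff_mul_comp p.1 p.2 (fun _ => 1) (differentiableOn_const 1)
    exact contDiff.continuous.bounded_above_of_compact_support
      (hasCompactSupport_of_support_subset_closedBall (hA.support_subset p.1 p.2))
  choose C hC using norm_le
  obtain ⟨M, hM⟩ := Finite.exists_le C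
  exact ⟨max M 0, le_max_right _ _, fun j i z =>
    (hC (j, i) z).trans ((hM (j, i)).trans (le_max_left _ _))⟩

variable [Fintype I]

theorem norm_sum_mul_cauchyTail_le (hA : IsTransfer A Z) (hC : ∀ j i z, ‖A j i z‖ ≤ C) (n : ℕ)
    (h : I → ℂ →ᵇ ℂ) (j : I) (z : ℂ) :
    ‖∑ i, A j i z * cauchyTail n (h i) (Z j i z)‖ ≤
      (Fintype.card I * C * ((2 / 3) ^ n * 2)) * ‖h‖ := by
  have norm_term_le (i : I) :
      ‖A j i z * cauchyTail n (h i) (Z j i z)‖ ≤ C * ((2 / 3) ^ n * (2 * ‖h‖)) := by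
    have hC₀ : 0 ≤ C := (norm_nonneg _).trans (hC j i z)
    by_cases hz : A j i z = 0
    · rw [hz, zero_mul, norm_zero]
      positivity
    · rw [norm_mul]
      exact mul_le_mul (hC j i z)
        (norm_cauchyTail_le n
          (fun w _ => ((h i).norm_coe_le_norm w).trans (norm_le_pi_norm h i))
          (hA.three_halves_le_norm j i z hz)) (norm_nonneg _) hC₀
  refine (norm_sum_le _ _).trans ((Finset.sum_le_sum fun i _ => norm_term_le i).trans_eq ?_)
  rw [Finset.sum_const, Finset.card_univ, nsmul_eq_mul]
  ring

/-- The part `h ↦ (∑ i, A j i * (cauchyTail n (h i) ∘ Z j i))ⱼ` of the integral operator left over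
after `n` terms of the Laurent expansion. -/
def tailOperator (hA : IsTransfer A Z) (hC : ∀ j i z, ‖A j i z‖ ≤ C) (n : ℕ) :
    (I → ℂ →ᵇ ℂ) →ₗ[ℂ] (I → ℂ →ᵇ ℂ) where
  toFun h j := .ofNormedAddCommGroup (fun z => ∑ i, A j i z * cauchyTail n (h i) (Z j i z))
    (continuous_finsetSum _ fun i _ =>
      (hA.contDiff_mul_comp j i _ (differentiableOn_cauchyTail n (h i).continuous)).continuous)
    _ (hA.norm_sum_mul_cauchyTail_le hC n h j)
  map_add' h k := by
    ext j z
    simp only [BoundedContinuousFunction.coe_ofNormedAddCommGroup, Pi.add_apply,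
      BoundedContinuousFunction.coe_add, ← Finset.sum_add_distrib, ← mul_add]
    refine Finset.sum_congr rfl fun i _ => ?_
    by_cases hz : A j i z = 0
    · rw [hz, zero_mul, zero_mul]
    · exact congrArg _
        (cauchyTail_add n (h i).continuous (k i).continuous (hA.one_lt_norm hz))
  map_smul' c h := by
    ext j z
    simp only [BoundedContinuousFunction.coe_ofNormedAddCommGroup, Pi.smul_apply,
      BoundedContinuousFunction.coe_smul, RingHom.id_apply, smul_eq_mul, Finset.mul_sum,
      cauchyTail_const_mul, mul_left_comm _ c]

theorem norm_tailOperator_le (hA : IsTransfer A Z) (hC₀ : 0 ≤ C) (hC : ∀ j i z, ‖A j i z‖ ≤ C)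
    (n : ℕ) (h : I → ℂ →ᵇ ℂ) :
    ‖hA.tailOperator hC n h‖ ≤ (Fintype.card I * C * ((2 / 3) ^ n * 2)) * ‖h‖ :=
  (pi_norm_le_iff_of_nonneg (by positivity)).2 fun j =>
    (BoundedContinuousFunction.norm_le (by positivity)).2
      (hA.norm_sum_mul_cauchyTail_le hC n h j)

theorem exists_norm_lt_one_apply_eq_sum_cauchyTail (hA : IsTransfer A Z) :
    ∃ (n : ℕ) (G : (I → ℂ →ᵇ ℂ) →L[ℂ] (I → ℂ →ᵇ ℂ)), ‖G‖ < 1 ∧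
      ∀ h j z, G h j z = ∑ i, A j i z * cauchyTail n (h i) (Z j i z) := by
  obtain ⟨C, hC₀, hC⟩ := hA.exists_norm_le
  have tendsto_bound : Filter.Tendsto
      (fun n : ℕ => Fintype.card I * C * ((2 / 3 : ℝ) ^ n * 2)) Filter.atTop (𝓝 0) := by
    simpa using ((tendsto_pow_atTop_nhds_zero_of_lt_one (r := (2 / 3 : ℝ)) (by norm_num)
      (by norm_num)).mul_const 2).const_mul (Fintype.card I * C)
  obtain ⟨n, hn⟩ := (tendsto_bound.eventually_lt_const zero_lt_one).exists
  exact ⟨n, (hA.tailOperator hC n).mkContinuous _ (hA.norm_tailOperator_le hC₀ hC n),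
    (LinearMap.mkContinuous_norm_le _ (by positivity) _).trans_lt hn, fun h j z => rfl⟩

theorem exists_cauchyDisc_solution (hA : IsTransfer A Z) (φ : ℕ → I → ℂ →ᵇ ℂ) :
    ∃ (c : ℕ →₀ ℂ) (h : I → ℂ →ᵇ ℂ), c ≠ 0 ∧
      ∀ j z, h j z + ∑ i, A j i z * cauchyDisc (h i) (Z j i z) =
        c.sum fun k a => a * φ k j z := by
  obtain ⟨n, G, hG, G_apply⟩ := hA.exists_norm_lt_one_apply_eq_sum_cauchyTail
  obtain ⟨c, h, c_ne, moments_eq, h_add⟩ :=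
    exists_add_apply_eq_linearCombination hG (momentMap I n) φ
  refine ⟨c, h, c_ne, fun j z => ?_⟩
  have tail_eq : G h j z = ∑ i, A j i z * cauchyDisc (h i) (Z j i z) := by
    rw [G_apply]
    refine Finset.sum_congr rfl fun i _ => ?_
    by_cases hz : A j i z = 0
    · rw [hz, zero_mul, zero_mul]
    · rw [cauchyTail_eq_cauchyDisc_of_momentMap_eq_zero moments_eq i (hA.one_lt_norm hz)]
  have h_add_apply : h j z + G h j z = Finsupp.linearCombination ℂ φ c j z :=
    congrArg (fun x : I → ℂ →ᵇ ℂ => x j z) h_add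
  rw [← tail_eq, h_add_apply, Finsupp.linearCombination_apply, Finsupp.sum, Finsupp.sum,
    Finset.sum_apply, BoundedContinuousFunction.coe_sum, Finset.sum_apply]
  rfl

theorem exists_solution (hA : IsTransfer A Z) (φ : ℕ → I → ℂ → ℂ)
    (hφ : ∀ k i, ContDiff ℝ 1 (φ k i))
    (hφs : ∀ k i, Function.support (φ k i) ⊆ closedBall 0 1) :
    ∃ (c : ℕ →₀ ℂ) (h : I → ℂ → ℂ), c ≠ 0 ∧ (∀ i, ContDiff ℝ 1 (h i)) ∧
      (∀ i, Function.support (h i) ⊆ closedBall 0 1) ∧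
      ∀ j z, h j z + ∑ i, A j i z * cauchyTransform (h i) (Z j i z) =
        c.sum fun k a => a * φ k j z := by
  choose C hC using fun k i => (hφ k i).continuous.bounded_above_of_compact_support
    (hasCompactSupport_of_support_subset_closedBall (hφs k i))
  obtain ⟨c, h, c_ne, h_add⟩ := hA.exists_cauchyDisc_solution fun k i =>
    .ofNormedAddCommGroup (φ k i) (hφ k i).continuous (C k i) (hC k i)
  simp only [BoundedContinuousFunction.coe_ofNormedAddCommGroup] at h_add
  have h_eq (i : I) : (h i : ℂ → ℂ) = fun z => (c.sum fun k a => a * φ k i z) -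
      ∑ l, A i l z * cauchyDisc (h l) (Z i l z) :=
    funext fun z => eq_sub_of_add_eq (h_add i z)
  have support_subset (i : I) : Function.support (h i) ⊆ closedBall 0 1 := by
    refine Function.support_subset_iff'.2 fun z hz => ?_
    have φ_eq (k : ℕ) : φ k i z = 0 := Function.support_subset_iff'.1 (hφs k i) z hz
    have A_eq (l : I) : A i l z = 0 := Function.support_subset_iff'.1 (hA.support_subset i l) z hz
    rw [h_eq i]
    simp [φ_eq, A_eq]
  refine ⟨c, fun i => h i, c_ne, fun i => ?_, support_subset, fun j z => ?_⟩
  · simp only [h_eq i]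
    exact (ContDiff.sum fun k _ => contDiff_const.mul (hφ k i)).sub
      (ContDiff.sum fun l _ => hA.contDiff_mul_comp i l _
        (differentiableOn_cauchyDisc (h l).continuous))
  · simp only [cauchyTransform_eq_cauchyDisc (support_subset _), h_add]

end IsTransfer

/-! ### Cutoff functions -/

/-- A smooth bump function, as a complex valued function. -/
def cutoff {c : ℂ} (b : ContDiffBump c) (z : ℂ) : ℂ := (b z : ℝ)

section Cutoff

variable {c z : ℂ} (b : ContDiffBump c) {Φ : ℂ → ℂ} {s : Set ℂ}

theorem contDiff_cutoff {n : ℕ∞} : ContDiff ℝ n (cutoff b) :=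
  ofRealCLM.contDiff.comp b.contDiff

theorem differentiable_cutoff : Differentiable ℝ (cutoff b) :=
  (contDiff_cutoff b (n := 1)).differentiable one_ne_zero

theorem cutoff_eq_one (hz : z ∈ closedBall c b.rIn) : cutoff b z = 1 := by
  rw [cutoff, b.one_of_mem_closedBall hz, ofReal_one]

theorem support_cutoff_subset : Function.support (cutoff b) ⊆ ball c b.rOut := by
  rw [← b.support_eq]
  exact fun z hz => ofReal_ne_zero.1 hz

theorem support_dbar_cutoff_subset :
    Function.support (dbar (cutoff b)) ⊆ closedBall c b.rOut \ ball c b.rIn := by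
  refine Function.support_subset_iff'.2 fun z hz => ?_
  rw [Set.mem_sdiff, not_and_or, not_not] at hz
  rcases hz with hz | hz
  · refine dbar_eq_zero_of_eventuallyEq_const (c := 0) ?_
    filter_upwards [isClosed_closedBall.isOpen_compl.mem_nhds hz] with w hw
    exact Function.notMem_support.1 fun hw' =>
      hw (ball_subset_closedBall (support_cutoff_subset b hw'))
  · refine dbar_eq_zero_of_eventuallyEq_const (c := 1) ?_
    filter_upwards [isOpen_ball.mem_nhds hz] with w hw
    exact cutoff_eq_one b (ball_subset_closedBall hw)

theorem contDiff_dbar_cutoff : ContDiff ℝ 1 (dbar (cutoff b)) :=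
  contDiff_iff_contDiffAt.2 fun _ => contDiffAt_dbar (contDiff_cutoff b (n := 2)).contDiffAt

theorem contDiff_dbar_cutoff_mul (hs : IsOpen s) (hΦ : DifferentiableOn ℂ Φ s)
    (hbs : closedBall c b.rOut \ ball c b.rIn ⊆ s) :
    ContDiff ℝ 1 fun z => dbar (cutoff b) z * Φ z := by
  refine contDiff_iff_contDiffAt.2 fun z => ?_
  by_cases hz : z ∈ closedBall c b.rOut \ ball c b.rIn
  · exact (contDiff_dbar_cutoff b).contDiffAt.mul
      ((hΦ.analyticAt (hs.mem_nhds (hbs hz))).contDiffAt.restrict_scalars ℝ)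
  · refine (contDiffAt_const (c := (0 : ℂ))).congr_of_eventuallyEq ?_
    filter_upwards [(isClosed_closedBall.sdiff isOpen_ball).isOpen_compl.mem_nhds hz] with w hw
    rw [Function.notMem_support.1 fun hw' => hw (support_dbar_cutoff_subset b hw'), zero_mul]

theorem cutoff_mul_eventuallyEq_zero (hz : z ∉ closedBall c b.rOut) :
    (fun w => cutoff b w * Φ w) =ᶠ[𝓝 z] fun _ => 0 := by
  filter_upwards [isClosed_closedBall.isOpen_compl.mem_nhds hz] with w hw
  rw [Function.notMem_support.1 fun hw' =>
    hw (ball_subset_closedBall (support_cutoff_subset b hw')), zero_mul]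

theorem differentiableAt_cutoff_mul (hΦ : z ∈ closedBall c b.rOut → DifferentiableAt ℂ Φ z) :
    DifferentiableAt ℝ (fun w => cutoff b w * Φ w) z := by
  by_cases hz : z ∈ closedBall c b.rOut
  · exact (differentiable_cutoff b z).mul ((hΦ hz).restrictScalars ℝ)
  · exact (differentiableAt_const _).congr_of_eventuallyEq (cutoff_mul_eventuallyEq_zero b hz)

theorem dbar_cutoff_mul (hΦ : z ∈ closedBall c b.rOut → DifferentiableAt ℂ Φ z) :
    dbar (fun w => cutoff b w * Φ w) z = dbar (cutoff b) z * Φ z := by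
  by_cases hz : z ∈ closedBall c b.rOut
  · rw [dbar_mul (differentiable_cutoff b z) ((hΦ hz).restrictScalars ℝ), dbar_eq_zero (hΦ hz),
      mul_zero, add_zero]
  · rw [dbar_eq_zero_of_eventuallyEq_const (cutoff_mul_eventuallyEq_zero b hz),
      Function.notMem_support.1 fun hz' => hz (support_dbar_cutoff_subset b hz').1, zero_mul]

end Cutoff

/-! ### Sections over an atlas by discs -/

/-- An atlas by discs of radius `3` with holomorphic transition maps such that the discs of
radius `1` already cover the space. -/
structure DiscAtlas (C : Type*) [TopologicalSpace C] (I : Type*) where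
  chart : I → OpenPartialHomeomorph C ℂ
  target_eq : ∀ i, (chart i).target = ball 0 3
  cover : ∀ x, ∃ i, x ∈ (chart i).source ∧ ‖chart i x‖ < 1
  differentiableAt_transition : ∀ i j x, x ∈ (chart i).source → x ∈ (chart j).source →
    DifferentiableAt ℂ (fun z => chart i ((chart j).symm z)) (chart j x)

namespace DiscAtlas

variable {C : Type*} [TopologicalSpace C] {I : Type*} (D : DiscAtlas C I)

/-- A line bundle trivialized over the charts of `D`: its transition functions are written as the
quotients `τ i / τ j` of nowhere vanishing functions, which need not be continuous. A section is
then a single function `v` on `C`, with the coefficient `τ i * v` over the `i`-th chart. -/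
structure IsFrame (τ : I → C → ℂ) : Prop where
  ne_zero : ∀ i x, τ i x ≠ 0
  differentiableAt_div : ∀ i j x, x ∈ (D.chart i).source → x ∈ (D.chart j).source →
    DifferentiableAt ℂ (fun z => τ i ((D.chart j).symm z) / τ j ((D.chart j).symm z))
      (D.chart j x)

/-- The coefficient of the section `v` over the `j`-th chart, in the coordinate of this chart. -/
def localExpr (τ : I → C → ℂ) (j : I) (v : C → ℂ) (z : ℂ) : ℂ :=
  τ j ((D.chart j).symm z) * v ((D.chart j).symm z)

open Classical in
/-- The function `G` of the `i`-th coordinate, extended by zero to the whole space. -/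
def ext (i : I) (G : ℂ → ℂ) (x : C) : ℂ := if x ∈ (D.chart i).source then G (D.chart i x) else 0

/-- The section with coefficient `G` over the `i`-th chart, extended by zero. -/
def extSection (τ : I → C → ℂ) (i : I) (G : ℂ → ℂ) (x : C) : ℂ := (τ i x)⁻¹ * D.ext i G x

/-- The derivative of the transition map from the chart `j` to the chart `i`. -/
def jac (i j : I) (x : C) : ℂ := deriv (fun z => D.chart i ((D.chart j).symm z)) (D.chart j x)

/-- The coefficient over the `j`-th chart of the bundle valued form `G dz̄ᵢ`, where `G` is a
coefficient over the `i`-th chart, extended by zero. -/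
def formCoeff (τ : I → C → ℂ) (j i : I) (G : ℂ → ℂ) (x : C) : ℂ :=
  τ j x / τ i x * conj (D.jac i j x) * D.ext i G x

variable {D} {τ : I → C → ℂ} {i j l : I} {x : C} {G : ℂ → ℂ}

theorem ext_of_mem (hx : x ∈ (D.chart i).source) (G : ℂ → ℂ) : D.ext i G x = G (D.chart i x) :=
  if_pos hx

theorem ext_of_notMem (hx : x ∉ (D.chart i).source) (G : ℂ → ℂ) : D.ext i G x = 0 :=
  if_neg hx

theorem eventually_mem_source (hx : x ∈ (D.chart i).source) : ∀ᶠ y in 𝓝 x, y ∈ (D.chart i).source :=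
  (D.chart i).open_source.mem_nhds hx

theorem analyticAt_transition (hi : x ∈ (D.chart i).source) (hj : x ∈ (D.chart j).source) :
    AnalyticAt ℂ (fun z => D.chart i ((D.chart j).symm z)) (D.chart j x) := by
  rw [analyticAt_iff_eventually_differentiableAt, (D.chart j).eventually_nhds _ hj]
  filter_upwards [eventually_mem_source hi, eventually_mem_source hj] with y hyi hyj
  exact D.differentiableAt_transition i j y hyi hyj

theorem IsFrame.analyticAt_div (hτ : D.IsFrame τ) (hi : x ∈ (D.chart i).source)
    (hj : x ∈ (D.chart j).source) :
    AnalyticAt ℂ (fun z => τ j ((D.chart j).symm z) / τ i ((D.chart j).symm z))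
      (D.chart j x) := by
  rw [analyticAt_iff_eventually_differentiableAt, (D.chart j).eventually_nhds _ hj]
  filter_upwards [eventually_mem_source hi, eventually_mem_source hj] with y hyi hyj
  simpa only [inv_div] using (hτ.differentiableAt_div i j y hyi hyj).fun_inv
    (div_ne_zero (hτ.ne_zero _ _) (hτ.ne_zero _ _))

theorem jac_comp (hi : x ∈ (D.chart i).source) (hj : x ∈ (D.chart j).source)
    (hl : x ∈ (D.chart l).source) : D.jac l j x = D.jac l i x * D.jac i j x := by
  have hasDerivAt_li : HasDerivAt (fun z => D.chart l ((D.chart i).symm z)) (D.jac l i x)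
      (D.chart i ((D.chart j).symm (D.chart j x))) := by
    rw [(D.chart j).left_inv hj]
    exact (D.differentiableAt_transition l i x hl hi).hasDerivAt
  have hasDerivAt_comp := hasDerivAt_li.comp (D.chart j x)
    (D.differentiableAt_transition i j x hi hj).hasDerivAt
  refine (hasDerivAt_comp.congr_of_eventuallyEq ?_).deriv
  refine ((D.chart j).eventually_nhds'
    (fun y => D.chart l y = D.chart l ((D.chart i).symm (D.chart i y))) hj).2 ?_
  filter_upwards [eventually_mem_source hi] with y hy
  rw [(D.chart i).left_inv hy]

theorem localExpr_sub (u v : C → ℂ) :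
    D.localExpr τ j (fun x => u x - v x) = fun z => D.localExpr τ j u z - D.localExpr τ j v z :=
  funext fun _ => mul_sub _ _ _

theorem localExpr_sum {ι : Type*} (s : Finset ι) (v : ι → C → ℂ) :
    D.localExpr τ j (fun x => ∑ k ∈ s, v k x) = fun z => ∑ k ∈ s, D.localExpr τ j (v k) z :=
  funext fun _ => Finset.mul_sum _ _ _

theorem localExpr_extSection_eventuallyEq_mul (hj : x ∈ (D.chart j).source)
    (hi : x ∈ (D.chart i).source) :
    D.localExpr τ j (D.extSection τ i G) =ᶠ[𝓝 (D.chart j x)] fun z =>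
      τ j ((D.chart j).symm z) / τ i ((D.chart j).symm z) *
        G (D.chart i ((D.chart j).symm z)) := by
  refine ((D.chart j).eventually_nhds' (fun y => τ j y * ((τ i y)⁻¹ * D.ext i G y) =
    τ j y / τ i y * G (D.chart i y)) hj).2 ?_
  filter_upwards [eventually_mem_source hi] with y hy
  rw [ext_of_mem hy, div_eq_mul_inv, mul_assoc]

theorem formCoeff_add_sum {ι : Type*} (s : Finset ι) (h : ℂ → ℂ) (K : ι → ℂ → ℂ) :
    D.formCoeff τ j i (fun z => h z + ∑ k ∈ s, K k z) x =
      D.formCoeff τ j i h x + ∑ k ∈ s, D.formCoeff τ j i (K k) x := by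
  by_cases hi : x ∈ (D.chart i).source
  · simp only [formCoeff, ext_of_mem hi, mul_add, Finset.mul_sum]
  · simp [formCoeff, ext_of_notMem hi]

section T2Space

variable [T2Space C]

theorem eventually_ext_eq_zero (hG : Function.support G ⊆ closedBall 0 2)
    (hx : x ∉ (D.chart i).source) : ∀ᶠ y in 𝓝 x, D.ext i G y = 0 := by
  have closedBall_subset : closedBall (0 : ℂ) 2 ⊆ (D.chart i).target := by
    rw [D.target_eq]
    exact closedBall_subset_ball (by norm_num)
  have isCompact_image : IsCompact ((D.chart i).symm '' closedBall (0 : ℂ) 2) :=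
    (isCompact_closedBall 0 2).image_of_continuousOn
      ((D.chart i).continuousOn_symm.mono closedBall_subset)
  have notMem_image : x ∉ (D.chart i).symm '' closedBall (0 : ℂ) 2 := by
    rintro ⟨z, hz, rfl⟩
    exact hx ((D.chart i).map_target (closedBall_subset hz))
  filter_upwards [isCompact_image.isClosed.isOpen_compl.mem_nhds notMem_image] with y hy
  by_cases hyi : y ∈ (D.chart i).source
  · rw [ext_of_mem hyi]
    exact Function.notMem_support.1 fun h =>
      hy ⟨D.chart i y, hG h, (D.chart i).left_inv hyi⟩
  · exact ext_of_notMem hyi G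

theorem contDiffAt_ext {n : ℕ∞} (hG : Function.support G ⊆ closedBall 0 2)
    (hj : x ∈ (D.chart j).source) (hGd : ContDiff ℝ n G) :
    ContDiffAt ℝ n (fun z => D.ext i G ((D.chart j).symm z)) (D.chart j x) := by
  by_cases hi : x ∈ (D.chart i).source
  · refine (hGd.contDiffAt.comp (D.chart j x)
      ((analyticAt_transition hi hj).contDiffAt.restrict_scalars ℝ)).congr_of_eventuallyEq ?_
    refine ((D.chart j).eventually_nhds' (fun y => D.ext i G y = G (D.chart i y)) hj).2 ?_
    filter_upwards [eventually_mem_source hi] with y hy using ext_of_mem hy G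
  · exact (contDiffAt_const (c := (0 : ℂ))).congr_of_eventuallyEq
      (((D.chart j).eventually_nhds' _ hj).2 (eventually_ext_eq_zero hG hi))

theorem localExpr_extSection_eventuallyEq_zero (hG : Function.support G ⊆ closedBall 0 2)
    (hj : x ∈ (D.chart j).source) (hi : x ∉ (D.chart i).source) :
    D.localExpr τ j (D.extSection τ i G) =ᶠ[𝓝 (D.chart j x)] fun _ => 0 := by
  refine ((D.chart j).eventually_nhds'
    (fun y => τ j y * ((τ i y)⁻¹ * D.ext i G y) = 0) hj).2 ?_
  filter_upwards [eventually_ext_eq_zero hG hi] with y hy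
  rw [hy, mul_zero, mul_zero]

theorem differentiableAt_dbar_localExpr_extSection (hτ : D.IsFrame τ)
    (hG : Function.support G ⊆ closedBall 0 2) (hj : x ∈ (D.chart j).source)
    (hGd : x ∈ (D.chart i).source → DifferentiableAt ℝ G (D.chart i x)) :
    DifferentiableAt ℝ (D.localExpr τ j (D.extSection τ i G)) (D.chart j x) ∧
      dbar (D.localExpr τ j (D.extSection τ i G)) (D.chart j x) =
        D.formCoeff τ j i (dbar G) x := by
  by_cases hi : x ∈ (D.chart i).source
  · have div_differentiableAt := (hτ.analyticAt_div hi hj).differentiableAt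
    have transition_differentiableAt := D.differentiableAt_transition i j x hi hj
    have G_differentiableAt :
        DifferentiableAt ℝ G (D.chart i ((D.chart j).symm (D.chart j x))) := by
      rw [(D.chart j).left_inv hj]
      exact hGd hi
    have G_comp_differentiableAt :
        DifferentiableAt ℝ (fun z => G (D.chart i ((D.chart j).symm z))) (D.chart j x) :=
      G_differentiableAt.comp (D.chart j x) (transition_differentiableAt.restrictScalars ℝ)
    have eventuallyEq_mul := localExpr_extSection_eventuallyEq_mul (τ := τ) (G := G) hj hi
    refine ⟨((div_differentiableAt.restrictScalars ℝ).mul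
      G_comp_differentiableAt).congr_of_eventuallyEq eventuallyEq_mul, ?_⟩
    rw [dbar_congr eventuallyEq_mul,
      dbar_mul (div_differentiableAt.restrictScalars ℝ) G_comp_differentiableAt,
      dbar_eq_zero div_differentiableAt, dbar_comp G_differentiableAt transition_differentiableAt,
      (D.chart j).left_inv hj, formCoeff, ext_of_mem hi, jac]
    ring
  · have eventuallyEq_zero := localExpr_extSection_eventuallyEq_zero (τ := τ) hG hj hi
    refine ⟨(differentiableAt_const _).congr_of_eventuallyEq eventuallyEq_zero, ?_⟩
    rw [dbar_eq_zero_of_eventuallyEq_const eventuallyEq_zero, formCoeff, ext_of_notMem hi, mul_zero]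

theorem contDiffAt_formCoeff (hτ : D.IsFrame τ) (hG : ContDiff ℝ 1 G)
    (hGs : Function.support G ⊆ closedBall 0 2) (hj : x ∈ (D.chart j).source) :
    ContDiffAt ℝ 1 (fun z => D.formCoeff τ j i G ((D.chart j).symm z)) (D.chart j x) := by
  by_cases hi : x ∈ (D.chart i).source
  · have contDiffAt_div : ContDiffAt ℝ 1 (fun z => τ j ((D.chart j).symm z) /
        τ i ((D.chart j).symm z)) (D.chart j x) :=
      (hτ.analyticAt_div hi hj).contDiffAt.restrict_scalars ℝ
    have contDiffAt_conj_deriv : ContDiffAt ℝ 1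
        (fun w => conj (deriv (fun z => D.chart i ((D.chart j).symm z)) w)) (D.chart j x) :=
      conjCLE.contDiff.contDiffAt.comp (D.chart j x)
        ((analyticAt_transition hi hj).deriv.contDiffAt.restrict_scalars ℝ)
    refine ((contDiffAt_div.mul contDiffAt_conj_deriv).mul
      (contDiffAt_ext (n := 1) hGs hj (i := i) hG)).congr_of_eventuallyEq ?_
    refine ((D.chart j).eventually_nhds _ hj).2 ?_
    filter_upwards [eventually_mem_source hj] with y hy
    rw [(D.chart j).left_inv hy, formCoeff, jac]
  · refine (contDiffAt_const (c := (0 : ℂ))).congr_of_eventuallyEq ?_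
    refine ((D.chart j).eventually_nhds' (fun y => D.formCoeff τ j i G y = 0) hj).2 ?_
    filter_upwards [eventually_ext_eq_zero hGs hi] with y hy
    rw [formCoeff, hy, mul_zero]

end T2Space

/-! ### The `∂̄`-equation over a finite disc atlas -/

/-- The bump function whose translates to the charts give the partition of unity. -/
def unitBump : ContDiffBump (0 : ℂ) := ⟨1 / 2, 1, by norm_num, by norm_num⟩

/-- The bump function that cuts off Cauchy transforms; it is constant outside the annulus
`3/2 ≤ ‖z‖ ≤ 2`. -/
def collarBump : ContDiffBump (0 : ℂ) := ⟨3 / 2, 2, by norm_num, by norm_num⟩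

theorem support_cutoff_unitBump_subset : Function.support (cutoff unitBump) ⊆ closedBall 0 2 :=
  (support_cutoff_subset unitBump).trans
    (ball_subset_closedBall.trans (closedBall_subset_closedBall one_le_two))

theorem support_dbar_cutoff_collarBump_subset :
    Function.support (dbar (cutoff collarBump)) ⊆ closedBall 0 2 :=
  (support_dbar_cutoff_subset collarBump).trans Set.sdiff_subset

theorem three_halves_le_norm_of_dbar_cutoff_ne_zero {z : ℂ}
    (hz : dbar (cutoff collarBump) z ≠ 0) : 3 / 2 ≤ ‖z‖ :=
  not_lt.1 fun h => (support_dbar_cutoff_subset collarBump hz).2 (mem_ball_zero_iff.2 h)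

section Fintype

variable [Fintype I]

open scoped ComplexOrder in
theorem sum_ext_unitBump_ne_zero (x : C) : ∑ i, D.ext i (cutoff unitBump) x ≠ 0 := by
  have nonneg (i : I) : 0 ≤ D.ext i (cutoff unitBump) x := by
    by_cases hi : x ∈ (D.chart i).source
    · rw [ext_of_mem hi]
      exact zero_le_real.2 unitBump.nonneg
    · rw [ext_of_notMem hi]
  obtain ⟨i, hi, norm_lt⟩ := D.cover x
  have pos : 0 < D.ext i (cutoff unitBump) x := by
    rw [ext_of_mem hi]
    exact zero_lt_real.2 (unitBump.pos_of_mem_ball (mem_ball_zero_iff.2 norm_lt))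
  exact (Finset.sum_pos' (fun i _ => nonneg i) ⟨i, Finset.mem_univ i, pos⟩).ne'

variable (D) in
/-- The partition of unity subordinate to the discs of radius `1` of a disc atlas. -/
def part (j : I) (x : C) : ℂ :=
  D.ext j (cutoff unitBump) x / ∑ i, D.ext i (cutoff unitBump) x

theorem sum_part (x : C) : ∑ j, D.part j x = 1 := by
  simp only [part, ← Finset.sum_div]
  exact div_self (sum_ext_unitBump_ne_zero x)

theorem part_of_notMem (hx : x ∉ (D.chart j).source) : D.part j x = 0 := by
  rw [part, ext_of_notMem hx, zero_div]

theorem norm_chart_lt_one_of_part_ne_zero (hx : D.part j x ≠ 0) : ‖D.chart j x‖ < 1 := by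
  have hj : x ∈ (D.chart j).source := by
    by_contra hj
    exact hx (part_of_notMem hj)
  rw [part, ext_of_mem hj, div_ne_zero_iff] at hx
  exact mem_ball_zero_iff.1 (support_cutoff_subset unitBump hx.1)

open Classical in
variable (D) in
/-- The `j`-th part of the form `G dz̄ᵢ` in the partition of unity, as a function on the target of
the `j`-th chart. -/
def transfer (τ : I → C → ℂ) (j i : I) (G : ℂ → ℂ) (z : ℂ) : ℂ :=
  if z ∈ (D.chart j).target then
    D.part j ((D.chart j).symm z) * D.formCoeff τ j i G ((D.chart j).symm z)
  else 0

theorem transfer_chart (hj : x ∈ (D.chart j).source) :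
    D.transfer τ j i G (D.chart j x) = D.part j x * D.formCoeff τ j i G x := by
  rw [transfer, if_pos ((D.chart j).map_source hj), (D.chart j).left_inv hj]

theorem exists_of_transfer_ne_zero {z : ℂ} (h : D.transfer τ j i G z ≠ 0) :
    ∃ x ∈ (D.chart j).source, D.chart j x = z ∧ D.part j x ≠ 0 ∧ x ∈ (D.chart i).source ∧
      G (D.chart i x) ≠ 0 := by
  classical
  rw [transfer, formCoeff] at h
  obtain ⟨hz, ne_zero⟩ := ite_ne_right_iff.1 h
  have ext_ne := right_ne_zero_of_mul (right_ne_zero_of_mul ne_zero)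
  have hi : (D.chart j).symm z ∈ (D.chart i).source := by
    by_contra hi
    exact ext_ne (ext_of_notMem hi G)
  exact ⟨_, (D.chart j).map_target hz, (D.chart j).right_inv hz, left_ne_zero_of_mul ne_zero, hi,
    ext_of_mem hi G ▸ ext_ne⟩

theorem support_transfer_subset : Function.support (D.transfer τ j i G) ⊆ closedBall 0 1 := by
  intro z hz
  obtain ⟨x, -, rfl, part_ne, -, -⟩ := exists_of_transfer_ne_zero hz
  exact mem_closedBall_zero_iff.2 (norm_chart_lt_one_of_part_ne_zero part_ne).le

theorem transfer_mul (j i : I) (G Φ : ℂ → ℂ) (z : ℂ) :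
    D.transfer τ j i G z * Φ (D.chart i ((D.chart j).symm z)) =
      D.transfer τ j i (fun w => G w * Φ w) z := by
  rw [transfer, transfer, formCoeff, formCoeff]
  split_ifs with hz
  · by_cases hi : (D.chart j).symm z ∈ (D.chart i).source
    · rw [ext_of_mem hi, ext_of_mem hi]
      ring
    · rw [ext_of_notMem hi, ext_of_notMem hi]
      ring
  · rw [zero_mul]

theorem formCoeff_transfer (hτ : D.IsFrame τ) (hj : x ∈ (D.chart j).source) :
    D.formCoeff τ j i (D.transfer τ i l G) x = D.part i x * D.formCoeff τ j l G x := by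
  by_cases hi : x ∈ (D.chart i).source
  · rw [formCoeff, ext_of_mem hi, transfer_chart hi, formCoeff, formCoeff]
    by_cases hl : x ∈ (D.chart l).source
    · rw [jac_comp hi hj hl, map_mul]
      have := hτ.ne_zero i x
      have := hτ.ne_zero l x
      field_simp
    · rw [ext_of_notMem hl]
      ring
  · rw [formCoeff, ext_of_notMem hi, part_of_notMem hi]
    ring

theorem sum_formCoeff_add_eq_sum_formCoeff_add_transfer (hτ : D.IsFrame τ)
    (hj : x ∈ (D.chart j).source) (h K : I → ℂ → ℂ) :
    ∑ i, D.formCoeff τ j i (fun z => h i z + K i z) x =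
      ∑ i, D.formCoeff τ j i (fun z => h i z + ∑ l, D.transfer τ i l (K l) z) x := by
  have formCoeff_add (i : I) : D.formCoeff τ j i (fun z => h i z + K i z) x =
      D.formCoeff τ j i (h i) x + D.formCoeff τ j i (K i) x := by
    simpa using formCoeff_add_sum {()} (h i) fun _ => K i
  simp only [formCoeff_add, formCoeff_add_sum, formCoeff_transfer hτ hj, Finset.sum_add_distrib]
  rw [Finset.sum_comm (γ := I)]
  simp only [← Finset.sum_mul, sum_part, one_mul]

variable [T2Space C]

theorem contDiffAt_part (hj : x ∈ (D.chart j).source) :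
    ContDiffAt ℝ 1 (fun z => D.part i ((D.chart j).symm z)) (D.chart j x) := by
  have contDiffAt_ext_unitBump (l : I) :
      ContDiffAt ℝ 1 (fun z => D.ext l (cutoff unitBump) ((D.chart j).symm z)) (D.chart j x) :=
    contDiffAt_ext (n := 1) support_cutoff_unitBump_subset hj (contDiff_cutoff _)
  simp only [part, div_eq_mul_inv]
  exact (contDiffAt_ext_unitBump i).mul
    ((ContDiffAt.sum fun l _ => contDiffAt_ext_unitBump l).inv (sum_ext_unitBump_ne_zero _))

theorem contDiff_transfer (hτ : D.IsFrame τ) (j i : I) (hG : ContDiff ℝ 1 G)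
    (hGs : Function.support G ⊆ closedBall 0 2) : ContDiff ℝ 1 (D.transfer τ j i G) := by
  refine contDiff_iff_contDiffAt.2 fun z => ?_
  by_cases hz : z ∈ (D.chart j).target
  · have hj := (D.chart j).map_target hz
    rw [← (D.chart j).right_inv hz]
    refine ((contDiffAt_part (i := j) hj).mul
      (contDiffAt_formCoeff (i := i) hτ hG hGs hj)).congr_of_eventuallyEq ?_
    refine ((D.chart j).eventually_nhds _ hj).2 ?_
    filter_upwards [eventually_mem_source hj] with y hy
    rw [transfer_chart hy, (D.chart j).left_inv hy]
  · have notMem_closedBall : z ∉ closedBall (0 : ℂ) 1 := fun h =>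
      hz (D.target_eq j ▸ closedBall_subset_ball (by norm_num) h)
    refine (contDiffAt_const (c := (0 : ℂ))).congr_of_eventuallyEq ?_
    filter_upwards [isClosed_closedBall.isOpen_compl.mem_nhds notMem_closedBall] with w hw
    exact Function.notMem_support.1 fun h => hw (support_transfer_subset h)

theorem isTransfer (hτ : D.IsFrame τ) :
    IsTransfer (fun j i => D.transfer τ j i (dbar (cutoff collarBump)))
      (fun j i z => D.chart i ((D.chart j).symm z)) where
  contDiff_mul_comp j i Φ hΦ := by
    simp only [transfer_mul]
    refine contDiff_transfer hτ j i (contDiff_dbar_cutoff_mul _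
      (isOpen_lt continuous_const continuous_norm) hΦ fun z hz => ?_)
      ((Function.support_mul_subset_left _ _).trans support_dbar_cutoff_collarBump_subset)
    exact lt_of_lt_of_le (by norm_num [collarBump])
      (not_lt.1 fun h => hz.2 (mem_ball_zero_iff.2 h))
  three_halves_le_norm j i z hz := by
    obtain ⟨x, hj, rfl, -, -, dbar_ne⟩ := exists_of_transfer_ne_zero hz
    rw [(D.chart j).left_inv hj]
    exact three_halves_le_norm_of_dbar_cutoff_ne_zero dbar_ne
  support_subset _ _ := support_transfer_subset

end Fintype

theorem dbar_cutoff_collarBump_mul_cauchyTransform {h : ℂ → ℂ} (hh : ContDiff ℝ 1 h)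
    (hs : Function.support h ⊆ closedBall 0 1) (z : ℂ) :
    DifferentiableAt ℝ (fun z => cutoff collarBump z * cauchyTransform h z) z ∧
      dbar (fun z => cutoff collarBump z * cauchyTransform h z) z =
        h z + dbar (cutoff collarBump) z * cauchyTransform h z := by
  have hc := hasCompactSupport_of_support_subset_closedBall hs
  have transform_differentiableAt :=
    (contDiff_cauchyTransform hh hc).differentiable one_ne_zero z
  refine ⟨(differentiable_cutoff _ z).mul transform_differentiableAt, ?_⟩
  have cutoff_mul : cutoff collarBump z * h z = h z := by
    by_cases hz : h z = 0
    · rw [hz, mul_zero]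
    · rw [cutoff_eq_one _ (closedBall_subset_closedBall (by norm_num [collarBump]) (hs hz)),
        one_mul]
  rw [dbar_mul (differentiable_cutoff _ z) transform_differentiableAt, dbar_cauchyTransform hh hc,
    cutoff_mul, add_comm]

theorem exists_dbar_solution [Fintype I] [T2Space C] (hτ : D.IsFrame τ) (φ : ℕ → I → ℂ → ℂ)
    (hφ : ∀ k i, ContDiff ℝ 1 (φ k i))
    (hφs : ∀ k i, Function.support (φ k i) ⊆ closedBall 0 1) :
    ∃ (c : ℕ →₀ ℂ) (v : C → ℂ), c ≠ 0 ∧ ∀ j, ∀ x ∈ (D.chart j).source,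
      DifferentiableAt ℝ (D.localExpr τ j v) (D.chart j x) ∧
      dbar (D.localExpr τ j v) (D.chart j x) =
        ∑ i, D.formCoeff τ j i (fun z => c.sum fun k a => a * φ k i z) x := by
  obtain ⟨c, h, c_ne, hh, hs, h_add⟩ := (isTransfer hτ).exists_solution φ hφ hφs
  refine ⟨c, fun x => ∑ i, D.extSection τ i
    (fun z => cutoff collarBump z * cauchyTransform (h i) z) x, c_ne, fun j x hj => ?_⟩
  have localExpr_term (i : I) := differentiableAt_dbar_localExpr_extSection hτ (i := i)
    ((Function.support_mul_subset_left _ _).trans ((support_cutoff_subset _).trans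
      ball_subset_closedBall)) hj
    fun _ => (dbar_cutoff_collarBump_mul_cauchyTransform (hh i) (hs i) _).1
  rw [localExpr_sum]
  refine ⟨DifferentiableAt.fun_sum fun i _ => (localExpr_term i).1, ?_⟩
  have dbar_eq (i : I) := funext fun z =>
    (dbar_cutoff_collarBump_mul_cauchyTransform (hh i) (hs i) z).2
  rw [dbar_sum _ fun i _ => (localExpr_term i).1]
  simp only [fun i => (localExpr_term i).2, dbar_eq]
  simp only [sum_formCoeff_add_eq_sum_formCoeff_add_transfer hτ hj h, ← transfer_mul, h_add]

theorem exists_dbar_solution_single [Finite I] [T2Space C] (hτ : D.IsFrame τ) (i₀ : I)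
    (φ : ℕ → ℂ → ℂ) (hφ : ∀ k, ContDiff ℝ 1 (φ k))
    (hφs : ∀ k, Function.support (φ k) ⊆ closedBall 0 1) :
    ∃ (c : ℕ →₀ ℂ) (v : C → ℂ), c ≠ 0 ∧ ∀ j, ∀ x ∈ (D.chart j).source,
      DifferentiableAt ℝ (D.localExpr τ j v) (D.chart j x) ∧
      dbar (D.localExpr τ j v) (D.chart j x) =
        D.formCoeff τ j i₀ (fun z => c.sum fun k a => a * φ k z) x := by
  classical
  have := Fintype.ofFinite I
  obtain ⟨c, v, c_ne, hv⟩ := exists_dbar_solution hτ (fun k => Pi.single i₀ (φ k))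
    (fun k i => by
      obtain rfl | hi := eq_or_ne i i₀
      · simpa using hφ k
      · rw [Pi.single_eq_of_ne hi]
        exact contDiff_zero_fun)
    (fun k i => by
      obtain rfl | hi := eq_or_ne i i₀
      · simpa using hφs k
      · simp [hi])
  refine ⟨c, v, c_ne, fun j x hj => ⟨(hv j x hj).1, (hv j x hj).2.trans ?_⟩⟩
  rw [Finset.sum_eq_single i₀]
  · simp only [Pi.single_eq_same]
  · intro i _ hi
    simp [formCoeff, ext, Pi.single_eq_of_ne hi]
  · simp

/-! ### Sections with prescribed principal parts -/

theorem exists_contDiffBump_rOut_lt {ε : ℝ} (hε : 0 < ε) :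
    ∃ b : ContDiffBump (0 : ℂ), b.rOut < ε :=
  ⟨⟨ε / 4, ε / 2, by positivity, by linarith⟩, half_lt_self hε⟩

theorem differentiableAt_finsupp_sum_mul {ι : Type*} {q : ι → ℂ → ℂ} {z : ℂ} (c : ι →₀ ℂ)
    (hq : ∀ k, DifferentiableAt ℂ (q k) z) :
    DifferentiableAt ℂ (fun z => c.sum fun k a => a * q k z) z := by
  simp only [Finsupp.sum]
  exact DifferentiableAt.fun_sum fun k _ => (hq k).const_mul _

theorem differentiableAt_localExpr_extSection_sub [T2Space C] (hτ : D.IsFrame τ)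
    (b : ContDiffBump (0 : ℂ)) (hb : b.rOut ≤ 2) {v : C → ℂ} {Q : ℂ → ℂ}
    (hQ : ∀ z ∈ closedBall 0 b.rOut, z ≠ 0 → DifferentiableAt ℂ Q z)
    (hj : x ∈ (D.chart j).source) (hx : x ≠ (D.chart i).symm 0)
    (hv : DifferentiableAt ℝ (D.localExpr τ j v) (D.chart j x))
    (dbar_v : dbar (D.localExpr τ j v) (D.chart j x) =
      D.formCoeff τ j i (fun z => dbar (cutoff b) z * Q z) x) :
    DifferentiableAt ℂ
      (D.localExpr τ j fun x => D.extSection τ i (fun z => cutoff b z * Q z) x - v x)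
      (D.chart j x) := by
  have differentiableAt_Q (hi : x ∈ (D.chart i).source)
      (hz : D.chart i x ∈ closedBall 0 b.rOut) : DifferentiableAt ℂ Q (D.chart i x) :=
    hQ _ hz fun h => hx (by rw [← h, (D.chart i).left_inv hi])
  have support_subset : Function.support (fun z => cutoff b z * Q z) ⊆ closedBall 0 2 :=
    (Function.support_mul_subset_left _ _).trans ((support_cutoff_subset b).trans
      (ball_subset_closedBall.trans (closedBall_subset_closedBall hb)))
  obtain ⟨differentiableAt_ext, dbar_ext⟩ := differentiableAt_dbar_localExpr_extSection hτ
    support_subset hj fun hi => differentiableAt_cutoff_mul b (differentiableAt_Q hi)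
  rw [localExpr_sub]
  refine differentiableAt_of_dbar_eq_zero (differentiableAt_ext.sub hv) ?_
  rw [dbar_sub differentiableAt_ext hv, dbar_ext, dbar_v, formCoeff, formCoeff]
  by_cases hi : x ∈ (D.chart i).source
  · rw [ext_of_mem hi, ext_of_mem hi, dbar_cutoff_mul b (differentiableAt_Q hi), sub_self]
  · rw [ext_of_notMem hi, ext_of_notMem hi, sub_self]

theorem eventually_mem_target (i : I) : ∀ᶠ z in 𝓝 (0 : ℂ), z ∈ (D.chart i).target := by
  rw [D.target_eq]
  exact ball_mem_nhds 0 three_pos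

theorem localExpr_extSection_cutoff_mul_eventuallyEq (hτ : D.IsFrame τ)
    (b : ContDiffBump (0 : ℂ)) (Q : ℂ → ℂ) :
    D.localExpr τ i (D.extSection τ i fun z => cutoff b z * Q z) =ᶠ[𝓝 0] Q := by
  filter_upwards [eventually_mem_target (D := D) i, ball_mem_nhds 0 b.rIn_pos] with z hzt hzb
  rw [localExpr, extSection, ext_of_mem ((D.chart i).map_target hzt), (D.chart i).right_inv hzt,
    mul_inv_cancel_left₀ (hτ.ne_zero _ _), cutoff_eq_one b (ball_subset_closedBall hzb), one_mul]

theorem analyticAt_localExpr_of_dbar_eq (b : ContDiffBump (0 : ℂ)) {v : C → ℂ} {Q : ℂ → ℂ}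
    (hv : ∀ x ∈ (D.chart i).source, DifferentiableAt ℝ (D.localExpr τ i v) (D.chart i x) ∧
      dbar (D.localExpr τ i v) (D.chart i x) =
        D.formCoeff τ i i (fun z => dbar (cutoff b) z * Q z) x) :
    AnalyticAt ℂ (D.localExpr τ i v) 0 := by
  rw [analyticAt_iff_eventually_differentiableAt]
  filter_upwards [eventually_mem_target (D := D) i, ball_mem_nhds 0 b.rIn_pos] with z hzt hzb
  have mem_source := (D.chart i).map_target hzt
  obtain ⟨differentiableAt_v, dbar_v⟩ := hv _ mem_source
  rw [formCoeff, ext_of_mem mem_source, (D.chart i).right_inv hzt,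
    Function.notMem_support.1 fun hz => (support_dbar_cutoff_subset b hz).2 hzb, zero_mul,
    mul_zero] at dbar_v
  rw [(D.chart i).right_inv hzt] at differentiableAt_v
  exact differentiableAt_of_dbar_eq_zero differentiableAt_v dbar_v

theorem exists_section_eq_principalPart_add [Finite I] [T2Space C] (hτ : D.IsFrame τ) (i₀ : I)
    (q : ℕ → ℂ → ℂ) {ε : ℝ} (hε : 0 < ε) (hq : ∀ k, DifferentiableOn ℂ (q k) (ball 0 ε \ {0})) :
    ∃ (c : ℕ →₀ ℂ) (w : C → ℂ) (H : ℂ → ℂ), c ≠ 0 ∧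
      (∀ j, ∀ x ∈ (D.chart j).source, x ≠ (D.chart i₀).symm 0 →
        DifferentiableAt ℂ (D.localExpr τ j w) (D.chart j x)) ∧
      AnalyticAt ℂ H 0 ∧
      ∀ᶠ z in 𝓝[≠] 0, D.localExpr τ i₀ w z = (c.sum fun k a => a * q k z) + H z := by
  obtain ⟨b, hb⟩ := exists_contDiffBump_rOut_lt (lt_min hε one_pos)
  have rOut_lt_one : b.rOut < 1 := hb.trans_le (min_le_right _ _)
  have closedBall_subset : closedBall 0 b.rOut ⊆ ball (0 : ℂ) ε :=
    closedBall_subset_ball (hb.trans_le (min_le_left _ _))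
  have isOpen_punctured : IsOpen (ball (0 : ℂ) ε \ {0}) := isOpen_ball.sdiff isClosed_singleton
  obtain ⟨c, v, c_ne, hv⟩ := exists_dbar_solution_single hτ i₀
    (fun k z => dbar (cutoff b) z * q k z)
    (fun k => contDiff_dbar_cutoff_mul b isOpen_punctured (hq k) fun z hz =>
      ⟨closedBall_subset hz.1, fun h => hz.2 (by
        rw [Set.mem_singleton_iff.1 h]
        exact mem_ball_self b.rIn_pos)⟩)
    (fun k => (Function.support_mul_subset_left _ _).trans
      ((support_dbar_cutoff_subset b).trans
        (Set.sdiff_subset.trans (closedBall_subset_closedBall rOut_lt_one.le))))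
  let Q : ℂ → ℂ := fun z => c.sum fun k a => a * q k z
  have sum_eq : (fun z => c.sum fun k a => a * (dbar (cutoff b) z * q k z)) =
      fun z => dbar (cutoff b) z * Q z := by
    funext z
    simp only [Q, Finsupp.mul_sum, mul_left_comm]
  rw [sum_eq] at hv
  refine ⟨c, fun x => D.extSection τ i₀ (fun z => cutoff b z * Q z) x - v x,
    fun z => -D.localExpr τ i₀ v z, c_ne, fun j x hj hx => ?_,
    (analyticAt_localExpr_of_dbar_eq b (hv i₀)).neg, ?_⟩
  · refine differentiableAt_localExpr_extSection_sub hτ b (by linarith) (fun z hz hz0 => ?_) hj hx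
      (hv j x hj).1 (hv j x hj).2
    exact differentiableAt_finsupp_sum_mul c fun k =>
      (hq k).differentiableAt (isOpen_punctured.mem_nhds ⟨closedBall_subset hz, hz0⟩)
  · filter_upwards [nhdsWithin_le_nhds
      (localExpr_extSection_cutoff_mul_eventuallyEq hτ (i := i₀) b Q)] with z hz
    rw [localExpr_sub]
    exact (congrArg (· - _) hz).trans (sub_eq_add_neg _ _)

end DiscAtlas

/-! ### Paths in simply connected subsets -/

section Paths

variable {C : Type*} [TopologicalSpace C]

theorem mk_eq_mk_of_simplyConnected {U : Set C} (hU : SimplyConnectedSpace U) {x y : C}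
    (γ δ : Path x y) (hγ : ∀ t, γ t ∈ U) (hδ : ∀ t, δ t ∈ U) :
    Path.Homotopic.Quotient.mk γ = Path.Homotopic.Quotient.mk δ := by
  have hx : x ∈ U := γ.source ▸ hγ 0
  have hy : y ∈ U := γ.target ▸ hγ 1
  let lift (ε : Path x y) (hε : ∀ t, ε t ∈ U) : Path (⟨x, hx⟩ : U) ⟨y, hy⟩ :=
    { toFun := fun t => ⟨ε t, hε t⟩
      continuous_toFun := ε.continuous.subtype_mk _
      source' := Subtype.ext ε.source
      target' := Subtype.ext ε.target }
  exact Path.Homotopic.Quotient.eq.2 ((SimplyConnectedSpace.paths_homotopic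
    (lift γ hγ) (lift δ hδ)).map ⟨Subtype.val, continuous_subtype_val⟩)

theorem exists_path_of_simplyConnected {U : Set C} (hU : SimplyConnectedSpace U) {x y : C}
    (hx : x ∈ U) (hy : y ∈ U) : ∃ γ : Path x y, ∀ t, γ t ∈ U := by
  obtain ⟨γ⟩ := PathConnectedSpace.joined (⟨x, hx⟩ : U) ⟨y, hy⟩
  exact ⟨γ.map continuous_subtype_val, fun t => (γ t).2⟩

theorem trans_mem {U : Set C} {x y z : C} {γ : Path x y} {δ : Path y z} (hγ : ∀ t, γ t ∈ U)
    (hδ : ∀ t, δ t ∈ U) (t : unitInterval) : γ.trans δ t ∈ U := by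
  have range_subset : Set.range (γ.trans δ) ⊆ U := by
    rw [Path.trans_range]
    exact Set.union_subset (Set.range_subset_iff.2 hγ) (Set.range_subset_iff.2 hδ)
  exact range_subset (Set.mem_range_self t)

theorem exists_path_classes_of_simplyConnected [PathConnectedSpace C] {U : Set C}
    (hU : SimplyConnectedSpace U) (x₀ : C) : ∃ A : (x : C) → Path.Homotopic.Quotient x₀ x,
      ∀ (x y : C) (δ : Path x y), (∀ t, δ t ∈ U) →
        A y = (A x).trans (Path.Homotopic.Quotient.mk δ) := by
  obtain ⟨u⟩ : Nonempty U := inferInstance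
  have exists_path (x : C) : ∃ γ : Path (u : C) x, x ∈ U → ∀ t, γ t ∈ U := by
    by_cases hx : x ∈ U
    · obtain ⟨γ, hγ⟩ := exists_path_of_simplyConnected hU u.2 hx
      exact ⟨γ, fun _ => hγ⟩
    · exact ⟨(PathConnectedSpace.joined (u : C) x).somePath, fun h => absurd h hx⟩
  choose p hp using exists_path
  let β := (PathConnectedSpace.joined x₀ (u : C)).somePath
  refine ⟨fun x => Path.Homotopic.Quotient.mk (β.trans (p x)), fun x y δ hδ => ?_⟩
  have hx : x ∈ U := δ.source ▸ hδ 0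
  have hy : y ∈ U := δ.target ▸ hδ 1
  have mk_eq : Path.Homotopic.Quotient.mk (p y) = Path.Homotopic.Quotient.mk ((p x).trans δ) :=
    mk_eq_mk_of_simplyConnected hU _ _ (hp y hy) (trans_mem (hp x hx) hδ)
  simp only [Path.Homotopic.Quotient.mk_trans, Path.Homotopic.Quotient.trans_assoc, mk_eq]

theorem eventually_joined [LocallyPathConnectedSpace C] {U : Set C} (hU : IsOpen U) {x : C}
    (hx : x ∈ U) : ∀ᶠ y in 𝓝 x, ∃ δ : Path x y, ∀ t, δ t ∈ U :=
  pathComponentIn_mem_nhds (hU.mem_nhds hx)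

theorem quotient_symm_trans {x y w : C} (A : Path.Homotopic.Quotient x y)
    (B : Path.Homotopic.Quotient y w) : (A.trans B).symm = B.symm.trans A.symm := by
  induction A using Path.Homotopic.Quotient.ind with | mk γ =>
  induction B using Path.Homotopic.Quotient.ind with | mk δ =>
  exact congrArg Path.Homotopic.Quotient.mk (Path.trans_symm γ δ)

end Paths

/-! ### The character and its holonomies -/

section Character

variable {C : Type*} [TopologicalSpace C] {x₀ x y : C} {g : ℕ}
  (b : Module.Basis (Fin g ⊕ Fin g) ℤ (H1 C x₀)) (e : Fin g → ℂ)

theorem homologyClass_trans (c d : Path.Homotopic.Quotient x₀ x₀) :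
    homologyClass (c.trans d) = homologyClass c + homologyClass d := by
  have fromPath_trans : FundamentalGroup.fromPath (c.trans d) =
      FundamentalGroup.fromPath d * FundamentalGroup.fromPath c := rfl
  rw [homologyClass, fromPath_trans, map_mul, ofMul_mul, add_comm]
  rfl

theorem character_trans (c d : Path.Homotopic.Quotient x₀ x₀) :
    character b e (c.trans d) = character b e c * character b e d := by
  simp only [character, ← Complex.exp_add, homologyClass_trans, map_add, Finsupp.add_apply,
    Int.cast_add, add_mul, ← mul_add, ← Finset.sum_add_distrib]

theorem character_ne_zero (c : Path.Homotopic.Quotient x₀ x₀) : character b e c ≠ 0 :=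
  Complex.exp_ne_zero _

/-- The value of the character on the loop `A B⁻¹`, by which continuations of a section of `L_e`
along `A` and `B` differ. -/
def holonomy (A B : Path.Homotopic.Quotient x₀ x) : ℂ := character b e (A.trans B.symm)

theorem holonomy_ne_zero (A B : Path.Homotopic.Quotient x₀ x) : holonomy b e A B ≠ 0 :=
  character_ne_zero b e _

theorem holonomy_mul (A B E : Path.Homotopic.Quotient x₀ x) :
    holonomy b e A B * holonomy b e B E = holonomy b e A E := by
  rw [holonomy, holonomy, ← character_trans, Path.Homotopic.Quotient.trans_assoc,
    ← Path.Homotopic.Quotient.trans_assoc B.symm, Path.Homotopic.Quotient.symm_trans,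
    Path.Homotopic.Quotient.refl_trans, holonomy]

theorem holonomy_loop_trans (c : Path.Homotopic.Quotient x₀ x₀)
    (A B : Path.Homotopic.Quotient x₀ x) :
    holonomy b e (c.trans A) B = character b e c * holonomy b e A B := by
  rw [holonomy, holonomy, ← character_trans, Path.Homotopic.Quotient.trans_assoc]

theorem holonomy_trans (A B : Path.Homotopic.Quotient x₀ x) (δ : Path.Homotopic.Quotient x y) :
    holonomy b e (A.trans δ) (B.trans δ) = holonomy b e A B := by
  rw [holonomy, quotient_symm_trans, Path.Homotopic.Quotient.trans_assoc,
    ← Path.Homotopic.Quotient.trans_assoc δ, Path.Homotopic.Quotient.trans_symm,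
    Path.Homotopic.Quotient.refl_trans, holonomy]

end Character

/-! ### Disc atlases adapted to a finite set -/

section DiscChart

variable {C : Type*} [TopologicalSpace C] [ChartedSpace ℂ C] (x₀ : C) {r : ℂ} (hr : r ≠ 0)

/-- The preferred chart at `x₀`, translated to take the value `0` at `x₀`, divided by `r` and
restricted to the preimage of the disc of radius `3`. -/
def discChart : OpenPartialHomeomorph C ℂ :=
  (((chartAt ℂ x₀).transHomeomorph
    (affineHomeomorph r (chartAt ℂ x₀ x₀) hr).symm).symm.restrOpen (ball 0 3) isOpen_ball).symm

theorem discChart_apply (x : C) :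
    discChart x₀ hr x = (chartAt ℂ x₀ x - chartAt ℂ x₀ x₀) / r :=
  rfl

theorem discChart_symm_apply (z : ℂ) :
    (discChart x₀ hr).symm z = (chartAt ℂ x₀).symm (r * z + chartAt ℂ x₀ x₀) :=
  rfl

theorem discChart_target :
    (discChart x₀ hr).target =
      {z | r * z + chartAt ℂ x₀ x₀ ∈ (chartAt ℂ x₀).target} ∩ ball 0 3 :=
  rfl

theorem discChart_source_subset : (discChart x₀ hr).source ⊆ (chartAt ℂ x₀).source := by
  intro x hx
  rw [← (discChart x₀ hr).left_inv hx, discChart_symm_apply]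
  exact (chartAt ℂ x₀).map_target ((discChart x₀ hr).map_source hx).1

theorem mdifferentiableAt_discChart [IsManifold 𝓘(ℂ, ℂ) ω C] {x : C}
    (hx : x ∈ (discChart x₀ hr).source) :
    MDiffAt (discChart x₀ hr) x := by
  have differentiableAt : DifferentiableAt ℂ (fun w : ℂ => (w - chartAt ℂ x₀ x₀) / r)
      (chartAt ℂ x₀ x) := by
    fun_prop
  exact differentiableAt.mdifferentiableAt.comp x
    (mdifferentiableAt_atlas (chart_mem_atlas ℂ x₀) (discChart_source_subset x₀ hr hx))

theorem mdifferentiableAt_discChart_symm [IsManifold 𝓘(ℂ, ℂ) ω C] {z : ℂ}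
    (hz : z ∈ (discChart x₀ hr).target) :
    MDiffAt (discChart x₀ hr).symm z := by
  have differentiableAt : DifferentiableAt ℂ (fun w : ℂ => r * w + chartAt ℂ x₀ x₀) z := by
    fun_prop
  exact MDifferentiableAt.comp (f := fun w : ℂ => r * w + chartAt ℂ x₀ x₀) z
    (mdifferentiableAt_atlas_symm (chart_mem_atlas ℂ x₀) hz.1) differentiableAt.mdifferentiableAt

theorem exists_discChart_target_eq {V : Set C} (hV : IsOpen V) (hx₀ : x₀ ∈ V) :
    ∃ (r : ℂ) (hr : r ≠ 0), (discChart x₀ hr).target = ball 0 3 ∧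
      (discChart x₀ hr).source ⊆ V := by
  set e := chartAt ℂ x₀
  have mem_source : x₀ ∈ e.source := mem_chart_source ℂ x₀
  have mem_preimage : e x₀ ∈ e.target ∩ e.symm ⁻¹' V :=
    ⟨e.map_source mem_source, by rwa [Set.mem_preimage, e.left_inv mem_source]⟩
  obtain ⟨ε, hε, ball_subset⟩ :=
    Metric.isOpen_iff.1 (e.isOpen_inter_preimage_symm hV) _ mem_preimage
  have hr : ((ε / 3 : ℝ) : ℂ) ≠ 0 := Complex.ofReal_ne_zero.2 (by positivity)
  have mem_of_mem_ball {z : ℂ} (hz : z ∈ ball (0 : ℂ) 3) :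
      ((ε / 3 : ℝ) : ℂ) * z + e x₀ ∈ e.target ∩ e.symm ⁻¹' V := by
    apply ball_subset
    rw [mem_ball_zero_iff] at hz
    rw [mem_ball, dist_eq_norm, add_sub_cancel_right, norm_mul, Complex.norm_real,
      Real.norm_of_nonneg (by positivity)]
    nlinarith
  refine ⟨_, hr, ?_, fun x hx => ?_⟩
  · rw [discChart_target, Set.inter_eq_right]
    exact fun z hz => (mem_of_mem_ball hz).1
  · rw [← (discChart x₀ hr).left_inv hx]
    exact (mem_of_mem_ball ((discChart x₀ hr).map_source hx).2).2

end DiscChart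

/-- A disc atlas of preferred charts, indexed by the centres of its discs, such that the points of
a finite set `T` are centres and lie in no other disc. -/
structure AdaptedAtlas (C : Type*) [TopologicalSpace C] [ChartedSpace ℂ C] (T : Finset C)
    (S : Finset C) extends DiscAtlas C S where
  subset : T ⊆ S
  exists_eq_discChart : ∀ i : S, ∃ (r : ℂ) (hr : r ≠ 0), chart i = discChart (i : C) hr
  eq_of_mem : ∀ (i : S) (t : C), t ∈ T → t ∈ (chart i).source → t = i

theorem exists_adaptedAtlas {C : Type*} [TopologicalSpace C] [ChartedSpace ℂ C]
    [IsManifold 𝓘(ℂ, ℂ) ω C] [T2Space C] [CompactSpace C] (T : Finset C) :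
    ∃ S : Finset C, Nonempty (AdaptedAtlas C T S) := by
  classical
  have isOpen_compl (x : C) : IsOpen ((T.erase x : Set C)ᶜ) :=
    (Finset.finite_toSet _).isClosed.isOpen_compl
  choose r hr target_eq source_subset using fun x : C =>
    exists_discChart_target_eq x (isOpen_compl x) (by simp)
  have mem_nhds (x : C) :
      {y | y ∈ (discChart x (hr x)).source ∧ ‖discChart x (hr x) y‖ < 1} ∈ 𝓝 x := by
    have apply_self : discChart x (hr x) x = 0 := by rw [discChart_apply, sub_self, zero_div]
    have mem_source : x ∈ (discChart x (hr x)).source := by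
      have map_target := (discChart x (hr x)).map_target
        (show (0 : ℂ) ∈ (discChart x (hr x)).target by simp [target_eq])
      rwa [discChart_symm_apply, mul_zero, zero_add,
        (chartAt ℂ x).left_inv (mem_chart_source ℂ x)] at map_target
    refine Filter.inter_mem ((discChart x (hr x)).open_source.mem_nhds mem_source)
      (((discChart x (hr x)).continuousAt mem_source).norm.eventually_lt_const ?_)
    simp only [apply_self, norm_zero, one_pos]
  obtain ⟨S, hS⟩ := CompactSpace.elim_nhds_subcover _ mem_nhds
  refine ⟨S ∪ T, ⟨{
    chart := fun i => discChart i (hr i)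
    target_eq := fun i => target_eq i
    cover := fun x => ?_
    differentiableAt_transition := fun i j x hi hj => ?_
    subset := Finset.subset_union_right
    exists_eq_discChart := fun i => ⟨r i, hr i, rfl⟩
    eq_of_mem := fun i t ht hti => ?_ }⟩⟩
  · obtain ⟨y, hy, hxy⟩ := Set.mem_iUnion₂.1 (hS.ge (Set.mem_univ x))
    exact ⟨⟨y, Finset.mem_union_left _ hy⟩, hxy⟩
  · exact ((mdifferentiableAt_discChart (i : C) _ hi).comp_of_eq _
      (mdifferentiableAt_discChart_symm (j : C) _ ((discChart (j : C) _).map_source hj))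
      ((discChart (j : C) _).left_inv hj)).differentiableAt
  · by_contra hne
    exact source_subset i hti (by simp [hne, ht])

namespace AdaptedAtlas

variable {C : Type*} [TopologicalSpace C] [ChartedSpace ℂ C] {T S : Finset C}
  (D : AdaptedAtlas C T S) (i : S)

theorem source_subset : (D.chart i).source ⊆ (chartAt ℂ (i : C)).source := by
  obtain ⟨r, hr, chart_eq⟩ := D.exists_eq_discChart i
  rw [chart_eq]
  exact discChart_source_subset _ hr

theorem zero_mem_target : 0 ∈ (D.chart i).target := by
  simp [D.target_eq]

theorem symm_zero : (D.chart i).symm 0 = (i : C) := by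
  obtain ⟨r, hr, chart_eq⟩ := D.exists_eq_discChart i
  rw [chart_eq, discChart_symm_apply, mul_zero, zero_add,
    (chartAt ℂ (i : C)).left_inv (mem_chart_source ℂ _)]

theorem center_mem : (i : C) ∈ (D.chart i).source := by
  rw [← D.symm_zero i]
  exact (D.chart i).map_target (D.zero_mem_target i)

variable {i} {x : C}

theorem chart_eq_zero_iff (hx : x ∈ (D.chart i).source) : D.chart i x = 0 ↔ x = i := by
  rw [← D.symm_zero i, (D.chart i).eq_symm_apply hx (D.zero_mem_target i)]

theorem chart_center (i : S) : D.chart i i = 0 :=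
  (D.chart_eq_zero_iff (D.center_mem i)).2 rfl

theorem simplyConnected_source (i : S) : SimplyConnectedSpace (D.chart i).source := by
  have : ContractibleSpace (D.chart i).target := by
    rw [D.target_eq]
    exact contractibleSpace_ball three_pos
  have := (D.chart i).toHomeomorphSourceTarget.contractibleSpace
  infer_instance

theorem tendsto_chart_center (i : S) :
    Filter.Tendsto (D.chart i) (𝓝 (i : C)) (𝓝 0) := by
  simpa only [ContinuousAt, D.chart_center] using (D.chart i).continuousAt (D.center_mem i)

variable [IsManifold 𝓘(ℂ, ℂ) ω C]

theorem mdifferentiableAt_chart (hx : x ∈ (D.chart i).source) :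
    MDiffAt (D.chart i) x := by
  obtain ⟨r, hr, chart_eq⟩ := D.exists_eq_discChart i
  rw [chart_eq] at hx ⊢
  exact mdifferentiableAt_discChart _ hr hx

theorem mdifferentiableAt_chart_symm {z : ℂ} (hz : z ∈ (D.chart i).target) :
    MDiffAt (D.chart i).symm z := by
  obtain ⟨r, hr, chart_eq⟩ := D.exists_eq_discChart i
  rw [chart_eq] at hz ⊢
  exact mdifferentiableAt_discChart_symm _ hr hz

theorem mdifferentiableAt_iff (hx : x ∈ (D.chart i).source) (F : C → ℂ) :
    MDiffAt F x ↔
      DifferentiableAt ℂ (fun z => F ((D.chart i).symm z)) (D.chart i x) := by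
  refine ⟨fun h => ?_, fun h => ?_⟩
  · exact (h.comp_of_eq _ (D.mdifferentiableAt_chart_symm ((D.chart i).map_source hx))
      ((D.chart i).left_inv hx)).differentiableAt
  · refine (h.mdifferentiableAt.comp x (D.mdifferentiableAt_chart hx)).congr_of_eventuallyEq ?_
    filter_upwards [(D.chart i).open_source.mem_nhds hx] with y hy
    rw [Function.comp_apply, (D.chart i).left_inv hy]

end AdaptedAtlas

/-! ### Functions with a pole only at the marked point -/

section CenteredChart

variable {C : Type*} [TopologicalSpace C] [ChartedSpace ℂ C] {x₀ y : C}

/-- The preferred chart at `x₀`, translated to vanish at `x₀`: the local parameter in terms of which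
orders of sections and functions are measured. -/
def centeredChart (x₀ y : C) : ℂ := chartAt ℂ x₀ y - chartAt ℂ x₀ x₀

theorem centeredChart_self (x₀ : C) : centeredChart x₀ x₀ = 0 := sub_self _

theorem centeredChart_ne_zero (hy : y ∈ (chartAt ℂ x₀).source) (hne : y ≠ x₀) :
    centeredChart x₀ y ≠ 0 :=
  sub_ne_zero.2 fun h => hne ((chartAt ℂ x₀).injOn hy (mem_chart_source ℂ x₀) h)

theorem mdifferentiableAt_centeredChart [IsManifold 𝓘(ℂ, ℂ) ω C]
    (hy : y ∈ (chartAt ℂ x₀).source) : MDiffAt (centeredChart x₀) y :=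
  (mdifferentiableAt_atlas (chart_mem_atlas ℂ x₀) hy).sub mdifferentiableAt_const

theorem eventually_mdifferentiableAt_centeredChart [IsManifold 𝓘(ℂ, ℂ) ω C] (x₀ : C) :
    ∀ᶠ y in 𝓝 x₀, MDiffAt (centeredChart x₀) y := by
  filter_upwards [chart_source_mem_nhds ℂ x₀] with y hy
  exact mdifferentiableAt_centeredChart hy

theorem eventually_centeredChart_ne_zero (x₀ : C) : ∀ᶠ y in 𝓝[≠] x₀, centeredChart x₀ y ≠ 0 := by
  filter_upwards [mem_nhdsWithin_of_mem_nhds (chart_source_mem_nhds ℂ x₀),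
    self_mem_nhdsWithin] with y hy hne
  exact centeredChart_ne_zero hy hne

end CenteredChart

section FunctionRing

variable {C : Type*} {pinf x : C}

open Classical in
/-- Extension of a function on `C ∖ {pinf}` to `C` by zero, so that the calculus of functions on `C`
applies to it. -/
def zeroExtend (f : {x : C // x ≠ pinf} → ℂ) (x : C) : ℂ := if h : x ≠ pinf then f ⟨x, h⟩ else 0

theorem zeroExtend_of_ne (f : {x : C // x ≠ pinf} → ℂ) (h : x ≠ pinf) :
    zeroExtend f x = f ⟨x, h⟩ := dif_pos h

variable [TopologicalSpace C]

theorem mulSection_apply (f : {x : C // x ≠ pinf} → ℂ) {Δ : C →₀ ℤ}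
    (u : MultiFun pinf Δ) (x : GoodPoint pinf Δ) (γ : Path.Homotopic.Quotient pinf (x : C)) :
    mulSection f u x γ = zeroExtend f x * u x γ := by
  rw [zeroExtend_of_ne f x.2.1]
  rfl

variable [ChartedSpace ℂ C] {f : {x : C // x ≠ pinf} → ℂ}

theorem mdifferentiableAt_zeroExtend [T2Space C] (hf : f ∈ functionRing pinf) (hx : x ≠ pinf) :
    MDiffAt (zeroExtend f) x := by
  obtain ⟨n, hn, U, hU, hxU, -, F, hF, hfF⟩ := hf x
  refine ((hF x hxU).mdifferentiableAt (hU.mem_nhds hxU)).congr_of_eventuallyEq ?_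
  filter_upwards [hU.mem_nhds hxU, isOpen_ne.mem_nhds hx] with y hy hne
  rw [zeroExtend_of_ne f hne, hfF ⟨y, hne⟩ hy, hn hx, zpow_zero, one_mul]

theorem exists_zeroExtend_eq_zpow_mul [IsManifold 𝓘(ℂ, ℂ) ω C] (hf : f ∈ functionRing pinf) :
    ∃ (N : ℕ) (F : C → ℂ), (∀ᶠ y in 𝓝 pinf, MDiffAt F y) ∧
      ∀ᶠ y in 𝓝[≠] pinf, zeroExtend f y = centeredChart pinf y ^ (-(N : ℤ)) * F y := by
  obtain ⟨n, -, U, hU, hpU, -, F, hF, hfF⟩ := hf pinf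
  refine ⟨n.natAbs, fun y => centeredChart pinf y ^ (n + n.natAbs).toNat * F y, ?_, ?_⟩
  · filter_upwards [eventually_mdifferentiableAt_centeredChart pinf, hU.mem_nhds hpU] with y hc hy
    exact (hc.pow _).mul ((hF y hy).mdifferentiableAt (hU.mem_nhds hy))
  · filter_upwards [eventually_centeredChart_ne_zero pinf, mem_nhdsWithin_of_mem_nhds
      (hU.mem_nhds hpU), self_mem_nhdsWithin] with y ne_zero hy hne
    rw [zeroExtend_of_ne f hne, hfF ⟨y, hne⟩ hy, ← mul_assoc, ← zpow_natCast,
      Int.toNat_of_nonneg (by lia), ← zpow_add₀ ne_zero, neg_add_cancel_comm_assoc]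
    rfl

end FunctionRing

/-! ### Local expressions of sections -/

section Sections

variable {C : Type*} [TopologicalSpace C] [ChartedSpace ℂ C] {pinf : C} {Δ : C →₀ ℤ}

/-- Near `x₀`, the branch of `u` along `γ₀` is the `n`-th power of the centered chart at `x₀` times
the holomorphic function `F`. -/
def HasLocalExpr (u : MultiFun pinf Δ) (x₀ : C) (γ₀ : Path pinf x₀) (n : ℤ) (F : C → ℂ) : Prop :=
  (∀ᶠ y in 𝓝 x₀, MDiffAt F y) ∧
    ∃ U ∈ 𝓝 x₀, ∀ (y : GoodPoint pinf Δ) (δ : Path x₀ (y : C)), (∀ t, δ t ∈ U) →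
      u y (Path.Homotopic.Quotient.mk (γ₀.trans δ)) = centeredChart x₀ y ^ n * F y

theorem mem_sections_iff {g : ℕ} {b : Module.Basis (Fin g ⊕ Fin g) ℤ (H1 C pinf)} {e : Fin g → ℂ}
    {u : MultiFun pinf Δ} : u ∈ sections b Δ e ↔
      (∀ (c : Path.Homotopic.Quotient pinf pinf) (x : GoodPoint pinf Δ)
        (γ : Path.Homotopic.Quotient pinf (x : C)), u x (c.trans γ) = character b e c * u x γ) ∧
      ∀ (x₀ : C) (γ₀ : Path pinf x₀), ∃ n : ℤ, (x₀ ≠ pinf → n = -Δ x₀) ∧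
        ∃ F, HasLocalExpr u x₀ γ₀ n F := by
  refine and_congr_right fun _ => forall₂_congr fun x₀ γ₀ => exists_congr fun n =>
    and_congr_right fun _ => ?_
  constructor
  · rintro ⟨U, hU, hxU, -, F, hF, hu⟩
    refine ⟨F, ?_, U, hU.mem_nhds hxU, hu⟩
    filter_upwards [hU.mem_nhds hxU] with y hy
    exact (hF y hy).mdifferentiableAt (hU.mem_nhds hy)
  · rintro ⟨F, hF, U, hU, hu⟩
    obtain ⟨V, hVU, hV, hxV⟩ := mem_nhds_iff.1
      (Filter.inter_mem (Filter.inter_mem hU hF) (chart_source_mem_nhds ℂ x₀))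
    exact ⟨V, hV, hxV, fun y hy => (hVU hy).2, F,
      fun y hy => (hVU hy).1.2.mdifferentiableWithinAt,
      fun y δ hδ => hu y δ fun t => (hVU (hδ t)).1.1⟩

namespace HasLocalExpr

variable {u v : MultiFun pinf Δ} {x₀ : C} {γ₀ : Path pinf x₀} {n : ℤ} {F G : C → ℂ}

theorem add (hu : HasLocalExpr u x₀ γ₀ n F) (hv : HasLocalExpr v x₀ γ₀ n G) :
    HasLocalExpr (u + v) x₀ γ₀ n fun y => F y + G y := by
  obtain ⟨hF, U, hU, hu⟩ := hu
  obtain ⟨hG, V, hV, hv⟩ := hv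
  refine ⟨?_, U ∩ V, Filter.inter_mem hU hV, fun y δ hδ => ?_⟩
  · filter_upwards [hF, hG] with y hFy hGy
    exact hFy.add hGy
  · rw [mul_add, ← hu y δ fun t => (hδ t).1, ← hv y δ fun t => (hδ t).2]
    rfl

theorem smul (c : ℂ) (hu : HasLocalExpr u x₀ γ₀ n F) :
    HasLocalExpr (c • u) x₀ γ₀ n fun y => c * F y := by
  obtain ⟨hF, U, hU, hu⟩ := hu
  refine ⟨hF.mono fun y hFy => mdifferentiableAt_const.mul hFy, U, hU, fun y δ hδ => ?_⟩
  rw [mul_left_comm, ← hu y δ hδ]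
  rfl

theorem shift [IsManifold 𝓘(ℂ, ℂ) ω C] (hu : HasLocalExpr u x₀ γ₀ n F) (k : ℕ)
    (hnk : x₀ ≠ pinf → Δ x₀ = 0 → n = k) :
    HasLocalExpr u x₀ γ₀ (n - k) fun y => centeredChart x₀ y ^ k * F y := by
  obtain ⟨hF, U, hU, hu⟩ := hu
  refine ⟨?_, U ∩ (chartAt ℂ x₀).source, Filter.inter_mem hU (chart_source_mem_nhds ℂ x₀),
    fun y δ hδ => ?_⟩
  · filter_upwards [hF, eventually_mdifferentiableAt_centeredChart x₀] with y hFy hc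
    exact (hc.pow k).mul hFy
  · rw [hu y δ fun t => (hδ t).1, ← mul_assoc, ← zpow_natCast]
    by_cases hy : (y : C) = x₀
    · rw [hnk (hy ▸ y.2.1) (hy ▸ y.2.2), sub_self, zpow_zero, one_mul]
    · have mem_source : (y : C) ∈ (chartAt ℂ x₀).source := (δ.target ▸ hδ 1).2
      rw [← zpow_add₀ (centeredChart_ne_zero mem_source hy), sub_add_cancel]

end HasLocalExpr

variable {g : ℕ} {b : Module.Basis (Fin g ⊕ Fin g) ℤ (H1 C pinf)} {e : Fin g → ℂ}
  {u v : MultiFun pinf Δ}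

theorem add_mem_sections [IsManifold 𝓘(ℂ, ℂ) ω C] (hu : u ∈ sections b Δ e)
    (hv : v ∈ sections b Δ e) : u + v ∈ sections b Δ e := by
  rw [mem_sections_iff] at hu hv ⊢
  refine ⟨fun c x γ => ?_, fun x₀ γ₀ => ?_⟩
  · simp only [Pi.add_apply, hu.1, hv.1, mul_add]
  · obtain ⟨n, hn, F, hF⟩ := hu.2 x₀ γ₀
    obtain ⟨m, hm, G, hG⟩ := hv.2 x₀ γ₀
    by_cases hx : x₀ = pinf
    · subst hx
      have exprF := hF.shift (n - min n m).toNat fun h => absurd rfl h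
      have exprG := hG.shift (m - min n m).toNat fun h => absurd rfl h
      rw [Int.toNat_of_nonneg (by lia), sub_sub_cancel] at exprF exprG
      exact ⟨min n m, fun h => absurd rfl h, _, exprF.add exprG⟩
    · rw [hm hx, ← hn hx] at hG
      exact ⟨n, hn, _, hF.add hG⟩

theorem smul_mem_sections (c : ℂ) (hu : u ∈ sections b Δ e) : c • u ∈ sections b Δ e := by
  rw [mem_sections_iff] at hu ⊢
  refine ⟨fun d x γ => ?_, fun x₀ γ₀ => ?_⟩
  · simp only [Pi.smul_apply, smul_eq_mul, hu.1, mul_left_comm]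
  · obtain ⟨n, hn, F, hF⟩ := hu.2 x₀ γ₀
    exact ⟨n, hn, _, hF.smul c⟩

theorem sum_mem_sections [IsManifold 𝓘(ℂ, ℂ) ω C] {ι : Type*} {s : Finset ι}
    (hs : s.Nonempty) {u : ι → MultiFun pinf Δ} (hu : ∀ i ∈ s, u i ∈ sections b Δ e) :
    ∑ i ∈ s, u i ∈ sections b Δ e :=
  Finset.sum_induction_nonempty u (· ∈ sections b Δ e) (fun _ _ => add_mem_sections) hs hu

theorem mulSection_mem_sections [T2Space C] [IsManifold 𝓘(ℂ, ℂ) ω C]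
    {f : {x : C // x ≠ pinf} → ℂ} (hf : f ∈ functionRing pinf) (hu : u ∈ sections b Δ e) :
    mulSection f u ∈ sections b Δ e := by
  rw [mem_sections_iff] at hu ⊢
  refine ⟨fun c x γ => ?_, fun x₀ γ₀ => ?_⟩
  · rw [mulSection_apply, mulSection_apply, hu.1, mul_left_comm]
  · obtain ⟨n, hn, F, hF, U, hU, hu⟩ := hu.2 x₀ γ₀
    by_cases hx : x₀ = pinf
    · subst hx
      obtain ⟨N, G, hG, hfG⟩ := exists_zeroExtend_eq_zpow_mul hf
      refine ⟨n - N, fun h => absurd rfl h, fun y => G y * F y, ?_, _,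
        Filter.inter_mem hU (Filter.inter_mem (eventually_nhdsWithin_iff.1 hfG)
          (eventually_nhdsWithin_iff.1 (eventually_centeredChart_ne_zero x₀))), fun y δ hδ => ?_⟩
      · filter_upwards [hF, hG] with y hFy hGy
        exact hGy.mul hFy
      · obtain ⟨-, hfy, ne_zero⟩ := δ.target ▸ hδ 1
        rw [mulSection_apply, hu y δ fun t => (hδ t).1, hfy y.2.1, sub_eq_add_neg,
          zpow_add₀ (ne_zero y.2.1)]
        ring
    · refine ⟨n, hn, fun y => zeroExtend f y * F y, ?_, U, hU, fun y δ hδ => ?_⟩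
      · filter_upwards [hF, isOpen_ne.mem_nhds hx] with y hFy hy
        exact (mdifferentiableAt_zeroExtend hf hy).mul hFy
      · rw [mulSection_apply, hu y δ hδ, mul_left_comm]

end Sections

/-! ### The frame of a twisted flat bundle -/

namespace AdaptedAtlas

variable {C : Type*} [TopologicalSpace C] [ChartedSpace ℂ C] {T S : Finset C}
  (D : AdaptedAtlas C T S)

open Classical in
/-- A nowhere vanishing function which, on the `i`-th disc with its centre removed, is the power of
the chart whose divisor is the restriction of `k` to the centre. -/
def chartPow (k : C →₀ ℤ) (i : S) (x : C) : ℂ :=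
  if x ∈ (D.chart i).source ∧ x ≠ i then D.chart i x ^ k i else 1

theorem chartPow_ne_zero (k : C →₀ ℤ) (i : S) (x : C) : D.chartPow k i x ≠ 0 := by
  rw [chartPow]
  split_ifs with h
  · exact zpow_ne_zero _ fun h0 => h.2 ((D.chart_eq_zero_iff h.1).1 h0)
  · exact one_ne_zero

variable {k : C →₀ ℤ} {i j : S} {x : C}

theorem chartPow_eq (hx : x ∈ (D.chart i).source) (h : x ≠ i ∨ k i = 0) :
    D.chartPow k i x = D.chart i x ^ k i := by
  by_cases hxi : x = i
  · rw [chartPow, if_neg fun h' => h'.2 hxi, h.resolve_left (not_not_intro hxi), zpow_zero]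
  · rw [chartPow, if_pos ⟨hx, hxi⟩]

theorem chartPow_eventuallyEq [T1Space C] (hx : x ∈ (D.chart i).source) (h : x ≠ i ∨ k i = 0) :
    ∀ᶠ y in 𝓝 x, D.chartPow k i y = D.chart i y ^ k i := by
  rcases h with hxi | hki
  · filter_upwards [DiscAtlas.eventually_mem_source hx, isOpen_ne.mem_nhds hxi] with y hy hyi
    exact D.chartPow_eq hy (Or.inl hyi)
  · filter_upwards [DiscAtlas.eventually_mem_source hx] with y hy
    exact D.chartPow_eq hy (Or.inr hki)

theorem ne_center_or_eq_zero (hk : k.support ⊆ T) (hij : i ≠ j) (hx : x ∈ (D.chart j).source) :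
    x ≠ i ∨ k i = 0 := by
  by_contra! h
  obtain ⟨rfl, hki⟩ := h
  exact hij (Subtype.ext (D.eq_of_mem j i (hk (Finsupp.mem_support_iff.2 hki)) hx))

theorem differentiableAt_chart_zpow (hi : x ∈ (D.chart i).source) (hj : x ∈ (D.chart j).source)
    {n : ℤ} (h : x ≠ i ∨ n = 0) :
    DifferentiableAt ℂ (fun z => D.chart i ((D.chart j).symm z) ^ n) (D.chart j x) := by
  refine (D.differentiableAt_transition i j x hi hj).zpow ?_
  rw [(D.chart j).left_inv hj]
  exact h.imp (mt (D.chart_eq_zero_iff hi).1) ge_of_eq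

end AdaptedAtlas

/-- A choice over each disc of path classes from `x₀` that is compatible with continuation inside
the disc; it singles out a branch over the disc of each multivalued function. -/
def DiscAtlas.IsBranch {C I : Type*} [TopologicalSpace C] (D : DiscAtlas C I) {x₀ : C}
    (A : I → (x : C) → Path.Homotopic.Quotient x₀ x) : Prop :=
  ∀ (i : I) (x y : C) (δ : Path x y), (∀ t, δ t ∈ (D.chart i).source) →
    A i y = (A i x).trans (Path.Homotopic.Quotient.mk δ)

theorem DiscAtlas.IsBranch.holonomy_eventuallyEq {C I : Type*} [TopologicalSpace C]
    [LocallyPathConnectedSpace C] {D : DiscAtlas C I} {x₀ : C}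
    {A : I → (x : C) → Path.Homotopic.Quotient x₀ x} (hA : D.IsBranch A) {g : ℕ}
    (b : Module.Basis (Fin g ⊕ Fin g) ℤ (H1 C x₀)) (e : Fin g → ℂ) {i j : I} {x : C}
    (hi : x ∈ (D.chart i).source) (hj : x ∈ (D.chart j).source) :
    ∀ᶠ y in 𝓝 x, holonomy b e (A i y) (A j y) = holonomy b e (A i x) (A j x) := by
  filter_upwards [eventually_joined
    ((D.chart i).open_source.inter (D.chart j).open_source) ⟨hi, hj⟩] with y ⟨δ, hδ⟩
  rw [hA i x y δ fun t => (hδ t).1, hA j x y δ fun t => (hδ t).2, holonomy_trans]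

namespace AdaptedAtlas

variable {C : Type*} [TopologicalSpace C] [ChartedSpace ℂ C] {T S : Finset C}
  (D : AdaptedAtlas C T S) {x₀ : C} {g : ℕ} (b : Module.Basis (Fin g ⊕ Fin g) ℤ (H1 C x₀))
  (e : Fin g → ℂ) (A : S → (x : C) → Path.Homotopic.Quotient x₀ x)
  (a : (x : C) → Path.Homotopic.Quotient x₀ x)

/-- The frame of the flat bundle `L_e` twisted by the divisor `k`, relative to the reference path
classes `a`. -/
def frame (k : C →₀ ℤ) (i : S) (x : C) : ℂ := holonomy b e (A i x) (a x) * D.chartPow k i x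

theorem frame_ne_zero (k : C →₀ ℤ) (i : S) (x : C) : D.frame b e A a k i x ≠ 0 :=
  mul_ne_zero (holonomy_ne_zero _ _ _ _) (D.chartPow_ne_zero k i x)

variable {A}

theorem isFrame [T1Space C] [LocallyPathConnectedSpace C] {k : C →₀ ℤ} (hk : k.support ⊆ T)
    (hA : D.IsBranch A) : D.IsFrame (D.frame b e A a k) where
  ne_zero := D.frame_ne_zero b e A a k
  differentiableAt_div i j x hi hj := by
    by_cases hij : i = j
    · subst hij
      simp only [div_self (D.frame_ne_zero b e A a k i _)]
      exact differentiableAt_const _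
    have hki : x ≠ i ∨ k i = 0 := D.ne_center_or_eq_zero hk hij hj
    have hkj : x ≠ j ∨ k j = 0 := D.ne_center_or_eq_zero hk (Ne.symm hij) hi
    have frame_div_eventuallyEq : ∀ᶠ y in 𝓝 x,
        D.frame b e A a k i y / D.frame b e A a k j y =
          holonomy b e (A i x) (A j x) * (D.chart i y ^ k i * D.chart j y ^ (-k j)) := by
      filter_upwards [D.chartPow_eventuallyEq hi hki, D.chartPow_eventuallyEq hj hkj,
        hA.holonomy_eventuallyEq b e hi hj] with y powi powj hol
      have := holonomy_ne_zero b e (A j y) (a y)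
      rw [frame, frame, ← holonomy_mul b e (A i y) (A j y) (a y), hol, powi, powj, zpow_neg]
      field_simp
    exact (((D.differentiableAt_chart_zpow hi hj hki).mul
      (D.differentiableAt_chart_zpow hj hj (hkj.imp_right neg_eq_zero.2))).const_mul _)
      |>.congr_of_eventuallyEq (((D.chart j).eventually_nhds' _ hj).2 frame_div_eventuallyEq)

end AdaptedAtlas

/-! ### Multivalued sections from sections of the twisted bundle -/

/-- The section whose value at `y` is `τ j y * w y` relative to the trivialization over the `j`-th
disc is holomorphic near `x`. -/
def DiscAtlas.IsHolomorphicNear {C I : Type*} [TopologicalSpace C] [ChartedSpace ℂ C]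
    (D : DiscAtlas C I) (τ : I → C → ℂ) (w : C → ℂ) (x : C) : Prop :=
  ∀ j, x ∈ (D.chart j).source → ∀ᶠ y in 𝓝 x, MDiffAt (fun y => τ j y * w y) y

namespace AdaptedAtlas

variable {C : Type*} [TopologicalSpace C] [ChartedSpace ℂ C] {T S : Finset C}
  {D : AdaptedAtlas C T S} {pinf : C} {g : ℕ} {b : Module.Basis (Fin g ⊕ Fin g) ℤ (H1 C pinf)}
  {e : Fin g → ℂ} {A : S → (x : C) → Path.Homotopic.Quotient pinf x}
  {a : (x : C) → Path.Homotopic.Quotient pinf x} {k Δ : C →₀ ℤ} {w : C → ℂ}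

variable (b e a k w) in
/-- The multivalued function with the character of `L_e` and the values `w` along the reference path
classes `a`, set to zero on the support of `k`. -/
def multiSection (Δ : C →₀ ℤ) : MultiFun pinf Δ :=
  fun x γ => holonomy b e γ (a x) * if k x = 0 then w x else 0

theorem multiSection_eq (hk : k.support ⊆ T) (hA : D.IsBranch A) (i : S) {x : C} (γ : Path pinf x)
    (y : GoodPoint pinf Δ) (δ : Path x (y : C)) (hδ : ∀ t, δ t ∈ (D.chart i).source) :
    multiSection b e a k w Δ y (Path.Homotopic.Quotient.mk (γ.trans δ)) =
      holonomy b e (Path.Homotopic.Quotient.mk γ) (A i x) * D.chart i y ^ (-k i) *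
        (D.frame b e A a k i y * w y) := by
  have hy : (y : C) ∈ (D.chart i).source := δ.target ▸ hδ 1
  have holonomy_eq : holonomy b e (Path.Homotopic.Quotient.mk (γ.trans δ)) (a y) =
      holonomy b e (Path.Homotopic.Quotient.mk γ) (A i x) * holonomy b e (A i y) (a y) := by
    rw [← holonomy_mul b e _ (A i y) (a y), hA i x y δ hδ, Path.Homotopic.Quotient.mk_trans,
      holonomy_trans]
  rw [multiSection, holonomy_eq, frame]
  by_cases hky : k y = 0
  · have h : (y : C) ≠ i ∨ k i = 0 :=
      (ne_or_eq (y : C) i).imp_right fun hyi : (y : C) = i => hyi ▸ hky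
    have := D.chartPow_ne_zero k i y
    rw [if_pos hky, zpow_neg, ← D.chartPow_eq hy h]
    field_simp
  · have hyi : (y : C) = i := D.eq_of_mem i y (hk (Finsupp.mem_support_iff.2 hky)) hy
    rw [if_neg hky, (D.chart_eq_zero_iff hy).2 hyi, zero_zpow _ (neg_ne_zero.2 (hyi ▸ hky))]
    ring

theorem exists_chart_eq_div (D : AdaptedAtlas C T S) (i : S) :
    ∃ r : ℂ, r ≠ 0 ∧ ∀ y, D.chart i y = centeredChart (i : C) y / r := by
  obtain ⟨r, hr, chart_eq⟩ := D.exists_eq_discChart i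
  exact ⟨r, hr, fun y => by rw [chart_eq, discChart_apply, centeredChart]⟩

theorem exists_hasLocalExpr_center (hk : k.support ⊆ T) (hA : D.IsBranch A) (i : S)
    (γ : Path pinf (i : C)) {m : ℤ} (hm : (i : C) ≠ pinf → m = 0) {F : C → ℂ}
    (hF : ∀ᶠ y in 𝓝 (i : C), MDiffAt F y)
    (hw : ∀ᶠ y in 𝓝 (i : C), y ≠ pinf →
      D.frame b e A a k i y * w y = centeredChart (i : C) y ^ m * F y) :
    ∃ c : ℂ, c ≠ 0 ∧
      HasLocalExpr (multiSection b e a k w Δ) i γ (-k i + m) fun y => c * F y := by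
  obtain ⟨r, hr, chart_eq⟩ := D.exists_chart_eq_div i
  refine ⟨holonomy b e (Path.Homotopic.Quotient.mk γ) (A i i) / r ^ (-k i),
    div_ne_zero (holonomy_ne_zero _ _ _ _) (zpow_ne_zero _ hr),
    hF.mono fun y hFy => mdifferentiableAt_const.mul hFy, _,
    Filter.inter_mem hw (DiscAtlas.eventually_mem_source (D.center_mem i)), fun y δ hδ => ?_⟩
  obtain ⟨hwy, hy⟩ := δ.target ▸ hδ 1
  have zpow_add : centeredChart (i : C) y ^ (-k i + m) =
      centeredChart (i : C) y ^ (-k i) * centeredChart (i : C) y ^ m := by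
    by_cases hyi : (y : C) = i
    · rw [hm (hyi ▸ y.2.1), add_zero, zpow_zero, mul_one]
    · exact zpow_add₀ (centeredChart_ne_zero (D.source_subset i hy) hyi) _ _
  rw [multiSection_eq hk hA i γ y δ fun t => (hδ t).2, hwy y.2.1, chart_eq, zpow_add, div_zpow]
  ring

variable [IsManifold 𝓘(ℂ, ℂ) ω C]

theorem exists_hasLocalExpr_center_of_mdifferentiableAt (hk : k.support ⊆ T) (hA : D.IsBranch A)
    {i : S} {n : ℕ} (hn : k i = Δ i - n)
    (hw : ∀ᶠ y in 𝓝 (i : C), MDiffAt (fun y => D.frame b e A a k i y * w y) y)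
    (γ : Path pinf (i : C)) :
    ∃ c : ℂ, c ≠ 0 ∧ HasLocalExpr (multiSection b e a k w Δ) i γ (-Δ i)
      fun y => centeredChart (i : C) y ^ n * (c * (D.frame b e A a k i y * w y)) := by
  obtain ⟨c, hc, expr⟩ := exists_hasLocalExpr_center (Δ := Δ) hk hA i γ (m := 0) (fun _ => rfl) hw
    (.of_forall fun y _ => by rw [zpow_zero, one_mul])
  have shifted := expr.shift n fun _ hΔ => by lia
  rw [show -k i + 0 - n = -Δ i by lia] at shifted
  exact ⟨c, hc, shifted⟩

theorem hasLocalExpr_of_ne_center (hk : k.support ⊆ T) (hA : D.IsBranch A) {i : S} {x : C}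
    (hx : x ∈ (D.chart i).source) (hxi : x ≠ i) [T1Space C]
    (hw : ∀ᶠ y in 𝓝 x, MDiffAt (fun y => D.frame b e A a k i y * w y) y) (γ : Path pinf x) :
    HasLocalExpr (multiSection b e a k w Δ) x γ 0 fun y =>
      holonomy b e (Path.Homotopic.Quotient.mk γ) (A i x) * D.chart i y ^ (-k i) *
        (D.frame b e A a k i y * w y) := by
  refine ⟨?_, _, (D.chart i).open_source.mem_nhds hx, fun y δ hδ => ?_⟩
  · filter_upwards [hw, DiscAtlas.eventually_mem_source hx, isOpen_ne.mem_nhds hxi]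
      with y hwy hy hyi
    have zpow : DifferentiableAt ℂ (· ^ (-k i)) (D.chart i y) :=
      differentiableAt_zpow.2 (Or.inl fun h => hyi ((D.chart_eq_zero_iff hy).1 h))
    exact (mdifferentiableAt_const.mul
      (zpow.comp_mdifferentiableAt (D.mdifferentiableAt_chart hy))).mul hwy
  · rw [multiSection_eq hk hA i γ y δ hδ, zpow_zero, one_mul]

theorem multiSection_mem_sections [T1Space C] (hk : k.support ⊆ T) (hA : D.IsBranch A) {n : C → ℕ}
    (hn : ∀ x, k x = Δ x - n x) (hΔ : Δ.support ⊆ T) (hp : pinf ∈ T)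
    (hw : ∀ x, x ≠ pinf → D.IsHolomorphicNear (D.frame b e A a k) w x)
    (hwp : ∀ i : S, (i : C) = pinf → ∃ (m : ℤ) (F : C → ℂ), (∀ᶠ y in 𝓝 pinf, MDiffAt F y) ∧
      ∀ᶠ y in 𝓝[≠] pinf, D.frame b e A a k i y * w y = centeredChart pinf y ^ m * F y) :
    multiSection b e a k w Δ ∈ sections b Δ e := by
  rw [mem_sections_iff]
  refine ⟨fun c x γ => ?_, fun x₀ γ₀ => ?_⟩
  · rw [multiSection, holonomy_loop_trans, mul_assoc]
    rfl
  obtain ⟨i, hi, -⟩ := D.cover x₀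
  by_cases hxi : x₀ = i
  · subst hxi
    by_cases hip : (i : C) = pinf
    · obtain ⟨m, F, hF, hwF⟩ := hwp i hip
      subst hip
      obtain ⟨c, -, expr⟩ := exists_hasLocalExpr_center (Δ := Δ) hk hA i γ₀ (absurd rfl) hF
        (eventually_nhdsWithin_iff.1 hwF)
      exact ⟨_, absurd rfl, _, expr⟩
    · obtain ⟨c, -, expr⟩ := exists_hasLocalExpr_center_of_mdifferentiableAt hk hA (hn i)
        (hw i hip i hi) γ₀
      exact ⟨_, fun _ => rfl, _, expr⟩
  · have notMem : x₀ ∉ T := fun h => hxi (D.eq_of_mem i x₀ h hi)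
    have apply_eq_zero : Δ x₀ = 0 := Finsupp.notMem_support_iff.1 fun h => notMem (hΔ h)
    have ne_pinf : x₀ ≠ pinf := fun h => notMem (h ▸ hp)
    exact ⟨0, fun _ => by rw [apply_eq_zero, neg_zero], _,
      hasLocalExpr_of_ne_center hk hA hi hxi (hw x₀ ne_pinf i hi) γ₀⟩

end AdaptedAtlas

/-! ### Interpolation by sections -/

theorem exists_pow_mul_sum_inv_pow_eq_eval {K : Type*} [Field K] {c : ℕ →₀ K} (hc : c ≠ 0) :
    ∃ (m : ℕ) (p : Polynomial K), p.eval 0 ≠ 0 ∧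
      ∀ x ≠ 0, x ^ (m + 1) * (c.sum fun k a => a * (x ^ (k + 1))⁻¹) = p.eval x := by
  have support_nonempty := Finsupp.support_nonempty_iff.2 hc
  set m := c.support.max' support_nonempty
  have le_m : ∀ k ∈ c.support, k ≤ m := fun k => Finset.le_max' _ k
  refine ⟨m, ∑ k ∈ c.support, Polynomial.C (c k) * Polynomial.X ^ (m - k), ?_, fun x hx => ?_⟩
  · have m_mem : m ∈ c.support := Finset.max'_mem _ _
    rw [Polynomial.eval_finsetSum, Finset.sum_eq_single_of_mem m m_mem fun k hk hkm => ?_]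
    · simpa using m_mem
    · have : m - k ≠ 0 := by have := le_m k hk; lia
      simp [this]
  · simp only [Finsupp.sum, Finset.mul_sum, Polynomial.eval_finsetSum, Polynomial.eval_C_mul,
      Polynomial.eval_pow, Polynomial.eval_X]
    refine Finset.sum_congr rfl fun k hk => ?_
    rw [mul_left_comm, ← pow_sub₀ _ hx (Nat.add_le_add_right (le_m k hk) 1),
      Nat.add_sub_add_right]

theorem analyticAt_comp_symm {C : Type*} [TopologicalSpace C] [ChartedSpace ℂ C]
    {φ : OpenPartialHomeomorph C ℂ} (hφ : ∀ z ∈ φ.target, MDiffAt φ.symm z) {F : C → ℂ} {z : ℂ}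
    (hz : z ∈ φ.target) (hF : ∀ᶠ y in 𝓝 (φ.symm z), MDiffAt F y) :
    AnalyticAt ℂ (fun z => F (φ.symm z)) z := by
  rw [Complex.analyticAt_iff_eventually_differentiableAt]
  filter_upwards [(φ.continuousAt_symm hz).eventually hF, φ.open_target.mem_nhds hz] with y hFy hy
  exact (hFy.comp y (hφ y hy)).differentiableAt

theorem DiscAtlas.exists_section_pow_mul_eq {C I : Type*} [TopologicalSpace C] [Finite I]
    [T2Space C] {D : DiscAtlas C I} {τ : I → C → ℂ} (hτ : D.IsFrame τ) (i₀ : I) {h : ℂ → ℂ}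
    (hh : AnalyticAt ℂ h 0) (h_zero : h 0 = 0) (h_ne : ∀ᶠ z in 𝓝[≠] 0, h z ≠ 0) :
    ∃ (m : ℕ) (w : C → ℂ) (P : ℂ → ℂ),
      (∀ j, ∀ x ∈ (D.chart j).source, x ≠ (D.chart i₀).symm 0 →
        DifferentiableAt ℂ (D.localExpr τ j w) (D.chart j x)) ∧
      AnalyticAt ℂ P 0 ∧ P 0 ≠ 0 ∧ ∀ᶠ z in 𝓝[≠] 0, h z ^ m * D.localExpr τ i₀ w z = P z := by
  have eventually_regular : ∀ᶠ z in 𝓝[≠] 0, DifferentiableAt ℂ h z ∧ h z ≠ 0 :=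
    (hh.eventually_analyticAt.filter_mono nhdsWithin_le_nhds |>.mono
      fun z hz => hz.differentiableAt).and h_ne
  obtain ⟨ε, hε, regular⟩ := Metric.mem_nhdsWithin_iff.1 eventually_regular
  obtain ⟨c, w, H, hc, hw, hH, hwH⟩ := exists_section_eq_principalPart_add hτ i₀
    (fun k z => (h z ^ (k + 1))⁻¹) hε fun k z hz =>
      (((regular hz).1.pow _).inv (pow_ne_zero _ (regular hz).2)).differentiableWithinAt
  obtain ⟨m, p, hp, hcp⟩ := exists_pow_mul_sum_inv_pow_eq_eval hc
  have analyticAt_eval : AnalyticAt ℂ (fun z => p.eval (h z)) 0 := by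
    simpa only [Polynomial.coe_aeval_eq_eval] using hh.aeval_polynomial p
  refine ⟨m + 1, w, fun z => p.eval (h z) + h z ^ (m + 1) * H z, hw,
    analyticAt_eval.add ((hh.pow _).mul hH), ?_, ?_⟩
  · simpa [h_zero] using hp
  · filter_upwards [hwH, h_ne] with z hwz hz
    rw [hwz, mul_add, hcp _ hz]

namespace DiscAtlas

variable {C I : Type*} [TopologicalSpace C] {D : DiscAtlas C I} {τ : I → C → ℂ} {w : C → ℂ}

theorem localExpr_update_eventuallyEq [DecidableEq C] (hτ : D.IsFrame τ) {i : I} {P : ℂ → ℂ}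
    (hwP : ∀ᶠ z in 𝓝[≠] 0, D.localExpr τ i w z = P z) :
    D.localExpr τ i (Function.update w ((D.chart i).symm 0) (P 0 / τ i ((D.chart i).symm 0)))
      =ᶠ[𝓝 0] P := by
  rw [Filter.EventuallyEq, ← nhdsNE_sup_pure, Filter.eventually_sup, Filter.eventually_pure]
  constructor
  · filter_upwards [hwP, nhdsWithin_le_nhds (eventually_mem_target (D := D) i),
      self_mem_nhdsWithin] with z hwz hz hz_ne
    have symm_ne : (D.chart i).symm z ≠ (D.chart i).symm 0 := fun h =>
      hz_ne ((D.chart i).symm.injOn hz (eventually_mem_target (D := D) i).self_of_nhds h)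
    rw [localExpr, Function.update_of_ne symm_ne, ← hwz, localExpr]
  · rw [localExpr, Function.update_self, mul_div_cancel₀ _ (hτ.ne_zero i _)]

variable [ChartedSpace ℂ C] {x : C}

theorem IsHolomorphicNear.mul_left (hw : D.IsHolomorphicNear τ w x) {F : C → ℂ}
    (hF : ∀ᶠ y in 𝓝 x, MDiffAt F y) : D.IsHolomorphicNear τ (fun y => F y * w y) x := by
  intro j hx
  filter_upwards [hF, hw j hx] with y hFy hwy
  simpa only [Pi.mul_def, mul_left_comm] using hFy.mul hwy

theorem IsHolomorphicNear.congr (hw : D.IsHolomorphicNear τ w x) {w' : C → ℂ} (h : w' =ᶠ[𝓝 x] w) :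
    D.IsHolomorphicNear τ w' x := by
  intro j hx
  filter_upwards [h.eventuallyEq_nhds, hw j hx] with y hy hwy
  exact hwy.congr_of_eventuallyEq (Filter.EventuallyEq.rfl.mul hy)

end DiscAtlas

section Interpolation

variable {C : Type*} [TopologicalSpace C] [ChartedSpace ℂ C] [IsManifold 𝓘(ℂ, ℂ) ω C]
  {T S : Finset C} {D : AdaptedAtlas C T S} {τ : S → C → ℂ} {w : C → ℂ}

theorem AdaptedAtlas.isHolomorphicNear_of_differentiableAt {x : C} {V : Set C} (hV : V ∈ 𝓝 x)
    (hw : ∀ j, ∀ y ∈ (D.chart j).source, y ∈ V →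
      DifferentiableAt ℂ (D.localExpr τ j w) (D.chart j y)) :
    D.IsHolomorphicNear τ w x := by
  intro j hx
  filter_upwards [hV, DiscAtlas.eventually_mem_source hx] with y hyV hy
  exact (D.mdifferentiableAt_iff hy _).2 (hw j y hy hyV)

theorem AdaptedAtlas.exists_section_pow_mul_eq [T2Space C] (hτ : D.IsFrame τ) (i : S)
    (hi : (i : C) ∈ T) {F : C → ℂ} (hF : ∀ᶠ y in 𝓝 (i : C), MDiffAt F y) (hFi : F i = 0)
    (hF_ne : ¬ ∀ᶠ y in 𝓝 (i : C), F y = 0) :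
    ∃ (m : ℕ) (w w' : C → ℂ), (∀ x : C, x ≠ i → D.IsHolomorphicNear τ w x) ∧
      D.IsHolomorphicNear τ w' i ∧ w' i ≠ 0 ∧ ∀ y : C, y ≠ i → w' y = F y ^ m * w y := by
  classical
  have symm_zero := D.symm_zero i
  have analyticAt_F : AnalyticAt ℂ (fun z => F ((D.chart i).symm z)) 0 :=
    analyticAt_comp_symm (fun z hz => D.mdifferentiableAt_chart_symm hz) (D.zero_mem_target i)
      (by rwa [symm_zero])
  have F_ne_zero : ∀ᶠ z in 𝓝[≠] 0, F ((D.chart i).symm z) ≠ 0 := by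
    refine analyticAt_F.eventually_eq_zero_or_eventually_ne_zero.resolve_left fun h => hF_ne ?_
    filter_upwards [(D.tendsto_chart_center i).eventually h,
      DiscAtlas.eventually_mem_source (D.center_mem i)] with y hFy hy
    rwa [(D.chart i).left_inv hy] at hFy
  obtain ⟨m, w, P, hw, hP, hP_ne, hwP⟩ :=
    DiscAtlas.exists_section_pow_mul_eq hτ i analyticAt_F (by rw [symm_zero, hFi]) F_ne_zero
  rw [symm_zero] at hw
  refine ⟨m, w, Function.update (fun y => F y ^ m * w y) i (P 0 / τ i i), fun x hx =>
    D.isHolomorphicNear_of_differentiableAt (isOpen_ne.mem_nhds hx) hw, fun j hj => ?_, ?_,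
    fun y hy => Function.update_of_ne hy _ _⟩
  · obtain rfl : j = i := Subtype.ext (D.eq_of_mem j i hi hj).symm
    have localExpr_eq := DiscAtlas.localExpr_update_eventuallyEq hτ (i := j) (P := P)
      (w := fun y => F y ^ m * w y) (hwP.mono fun z hz => by
        rw [← hz, DiscAtlas.localExpr, DiscAtlas.localExpr, mul_left_comm])
    rw [symm_zero] at localExpr_eq
    filter_upwards [(D.tendsto_chart_center j).eventually localExpr_eq.eventuallyEq_nhds,
      (D.tendsto_chart_center j).eventually hP.eventually_analyticAt,
      DiscAtlas.eventually_mem_source (D.center_mem j)] with y hwy hPy hy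
    exact (D.mdifferentiableAt_iff hy _).2 (hPy.differentiableAt.congr_of_eventuallyEq hwy)
  · rw [Function.update_self]
    exact div_ne_zero hP_ne (hτ.ne_zero i i)

variable {pinf : C}

theorem exists_pow_zeroExtend_sub_mul_eq_zpow_mul {f : {x : C // x ≠ pinf} → ℂ}
    (hf : f ∈ functionRing pinf) (c : ℂ) (m : ℕ) {G : C → ℂ} (hG : ∀ᶠ y in 𝓝 pinf, MDiffAt G y) :
    ∃ (n : ℤ) (F : C → ℂ), (∀ᶠ y in 𝓝 pinf, MDiffAt F y) ∧ ∀ᶠ y in 𝓝[≠] pinf,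
      (zeroExtend f y - c) ^ m * G y = centeredChart pinf y ^ n * F y := by
  obtain ⟨N, F, hF, hfF⟩ := exists_zeroExtend_eq_zpow_mul hf
  refine ⟨-((N * m : ℕ) : ℤ), fun y => (F y - c * centeredChart pinf y ^ N) ^ m * G y, ?_, ?_⟩
  · filter_upwards [hF, hG, eventually_mdifferentiableAt_centeredChart pinf] with y hFy hGy hy
    exact ((hFy.sub (mdifferentiableAt_const.mul (hy.pow N))).pow m).mul hGy
  · filter_upwards [hfF, eventually_centeredChart_ne_zero pinf] with y hfy hy
    rw [hfy, zpow_neg, zpow_neg, zpow_natCast, zpow_natCast, pow_mul, ← inv_pow _ m, ← mul_assoc,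
      ← mul_pow, mul_sub, mul_left_comm, inv_mul_cancel₀ (pow_ne_zero _ hy), mul_one]

theorem AdaptedAtlas.exists_section_apply_ne_zero [T2Space C] (hτ : D.IsFrame τ) (i : S)
    (hi : (i : C) ∈ T) (hip : (i : C) ≠ pinf) {f : {x : C // x ≠ pinf} → ℂ}
    (hf : f ∈ functionRing pinf) (hfi : ¬ ∀ᶠ y in 𝓝 (i : C), zeroExtend f y = zeroExtend f i) :
    ∃ w : C → ℂ, w i ≠ 0 ∧ (∀ x, x ≠ pinf → D.IsHolomorphicNear τ w x) ∧
      ∀ j : S, (j : C) = pinf → ∃ (n : ℤ) (F : C → ℂ), (∀ᶠ y in 𝓝 pinf, MDiffAt F y) ∧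
        ∀ᶠ y in 𝓝[≠] pinf, τ j y * w y = centeredChart pinf y ^ n * F y := by
  have hF {x : C} (hx : x ≠ pinf) :
      ∀ᶠ y in 𝓝 x, MDiffAt (fun y => zeroExtend f y - zeroExtend f i) y :=
    (isOpen_ne.eventually_mem hx).mono fun y hy =>
      (mdifferentiableAt_zeroExtend hf hy).sub mdifferentiableAt_const
  obtain ⟨m, w, w', hw, hwi, hwi_ne, w'_eq⟩ :=
    D.exists_section_pow_mul_eq hτ i hi (hF hip) (sub_self _)
      (by simpa only [sub_eq_zero] using hfi)
  refine ⟨w', hwi_ne, fun x hx => ?_, fun j hj => ?_⟩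
  · by_cases hxi : x = i
    · rwa [hxi]
    · refine ((hw x hxi).mul_left ((hF hx).mono fun y hy => hy.pow m)).congr ?_
      filter_upwards [isOpen_ne.mem_nhds hxi] with y hy using w'_eq y hy
  · obtain ⟨n, F, hF, hwF⟩ := exists_pow_zeroExtend_sub_mul_eq_zpow_mul hf (zeroExtend f i) m
      (hw pinf hip.symm j (hj ▸ D.center_mem j))
    refine ⟨n, F, hF, ?_⟩
    filter_upwards [hwF, mem_nhdsWithin_of_mem_nhds (isOpen_ne.mem_nhds hip.symm)] with y hy hyi
    rw [w'_eq y hyi, ← hy, mul_left_comm]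

theorem exists_interpolating_section [T2Space C] [CompactSpace C] [ConnectedSpace C] {g : ℕ}
    (b : Module.Basis (Fin g ⊕ Fin g) ℤ (H1 C pinf)) (Δ : C →₀ ℤ) (e : Fin g → ℂ)
    {f : {x : C // x ≠ pinf} → ℂ} (hf : f ∈ functionRing pinf) {s : C} (hs : s ≠ pinf)
    {S' : Finset C} (hsS : s ∉ S') (hpS : pinf ∉ S')
    (hfs : ¬ ∀ᶠ x in 𝓝 s, zeroExtend f x = zeroExtend f s) :
    ∃ u ∈ sections b Δ e,
      (∀ γ : Path pinf s, ∃ F, HasLocalExpr u s γ (-Δ s) F ∧ F s ≠ 0) ∧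
      ∀ s' ∈ S', ∀ γ : Path pinf s', ∃ F, HasLocalExpr u s' γ (-Δ s') F ∧ F s' = 0 := by
  classical
  have : LocallyPathConnectedSpace C := ChartedSpace.locallyPathConnectedSpace ℂ C
  have : PathConnectedSpace C := pathConnectedSpace_iff_connectedSpace.2 inferInstance
  -- `O(k)` consists of the sections of `O(Δ)` vanishing on `S'`
  set n : C → ℕ := fun x => if x ∈ S' then 1 else 0
  set k : C →₀ ℤ := Δ - Finsupp.indicator S' fun _ _ => 1
  have k_apply (x : C) : k x = Δ x - n x := by
    simp only [k, n, Finsupp.sub_apply, Finsupp.indicator_apply, dite_eq_ite, Nat.cast_ite,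
      Nat.cast_one, Nat.cast_zero]
  set T : Finset C := Δ.support ∪ (S' ∪ {s, pinf}) with hT
  have support_Δ_subset : Δ.support ⊆ T := Finset.subset_union_left
  have subset_T : S' ⊆ T := fun x hx => by simp [hT, hx]
  have support_k_subset : k.support ⊆ T :=
    Finsupp.support_sub.trans (Finset.union_subset support_Δ_subset
      ((Finsupp.support_indicator_subset _ _).trans subset_T))
  obtain ⟨S, ⟨D⟩⟩ := exists_adaptedAtlas T
  choose A hA using fun i : S =>
    exists_path_classes_of_simplyConnected (D.simplyConnected_source i) pinf
  set a : (x : C) → Path.Homotopic.Quotient pinf x := fun x =>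
    Path.Homotopic.Quotient.mk (PathConnectedSpace.joined pinf x).somePath
  have isFrame := D.isFrame b e a support_k_subset hA
  obtain ⟨w, hws, hw, hwp⟩ := D.exists_section_apply_ne_zero isFrame
    ⟨s, D.subset (by simp [hT])⟩ (by simp [hT]) hs hf hfs
  have hasLocalExpr (i : S) (hi : (i : C) ≠ pinf) (γ : Path pinf (i : C)) :=
    D.exists_hasLocalExpr_center_of_mdifferentiableAt support_k_subset hA (k_apply i)
      (hw i hi i (D.center_mem i)) γ
  refine ⟨AdaptedAtlas.multiSection b e a k w Δ, AdaptedAtlas.multiSection_mem_sections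
    support_k_subset hA k_apply support_Δ_subset (by simp [hT]) hw hwp, fun γ => ?_,
    fun s' hs' γ => ?_⟩
  · obtain ⟨c, hc, expr⟩ := hasLocalExpr ⟨s, D.subset (by simp [hT])⟩ hs γ
    refine ⟨_, expr, ?_⟩
    simpa [n, hsS, hc, hws] using isFrame.ne_zero _ s
  · obtain ⟨c, -, expr⟩ := hasLocalExpr ⟨s', D.subset (subset_T hs')⟩ (fun h => hpS (h ▸ hs')) γ
    exact ⟨_, expr, by simp [n, hs', centeredChart_self]⟩

end Interpolation

/-! ### The identity theorem -/

section Identity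

theorem map_nhdsNE {X Y : Type*} [TopologicalSpace X] [TopologicalSpace Y]
    (φ : OpenPartialHomeomorph X Y) {x : X} (hx : x ∈ φ.source) :
    Filter.map φ (𝓝[≠] x) = 𝓝[≠] (φ x) := by
  rw [← φ.map_nhdsWithin_preimage_eq hx]
  refine congrArg _ (nhdsWithin_eq_nhdsWithin hx φ.open_source ?_)
  ext y
  simp only [Set.mem_inter_iff, Set.mem_compl_iff, Set.mem_singleton_iff, Set.mem_preimage]
  exact and_congr_left fun hy => not_congr (φ.injOn.eq_iff hy hx).symm

variable {C : Type*} [TopologicalSpace C] [ChartedSpace ℂ C]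

theorem neBot_nhdsNE (x : C) : (𝓝[≠] x).NeBot := by
  rw [← Filter.map_neBot_iff (chartAt ℂ x), map_nhdsNE _ (mem_chart_source ℂ x)]
  infer_instance

theorem meromorphicAt_zeroExtend_symm [IsManifold 𝓘(ℂ, ℂ) ω C] [T2Space C] {pinf : C}
    {f : {x : C // x ≠ pinf} → ℂ} (hf : f ∈ functionRing pinf) (x : C) :
    MeromorphicAt (fun w => zeroExtend f ((chartAt ℂ x).symm w)) (chartAt ℂ x x) := by
  have hx := mem_chart_source ℂ x
  have analyticAt_symm {F : C → ℂ} (hF : ∀ᶠ y in 𝓝 x, MDiffAt F y) :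
      AnalyticAt ℂ (fun w => F ((chartAt ℂ x).symm w)) (chartAt ℂ x x) :=
    analyticAt_comp_symm (fun w hw => mdifferentiableAt_atlas_symm (chart_mem_atlas ℂ x) hw)
      (mem_chart_target ℂ x) ((chartAt ℂ x).left_inv hx |>.symm ▸ hF)
  obtain rfl | hxp := eq_or_ne x pinf
  · obtain ⟨N, F, hF, hfF⟩ := exists_zeroExtend_eq_zpow_mul hf
    refine (((analyticAt_symm (eventually_mdifferentiableAt_centeredChart x)).meromorphicAt.zpow
      (-(N : ℤ))).mul (analyticAt_symm hF).meromorphicAt).congr ?_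
    rw [Filter.EventuallyEq, ← map_nhdsNE _ hx, Filter.eventually_map]
    filter_upwards [hfF, mem_nhdsWithin_of_mem_nhds (chart_source_mem_nhds ℂ x)] with y hfy hy
    simp only [Pi.mul_apply, Pi.pow_apply, (chartAt ℂ x).left_inv hy, hfy]
  · exact (analyticAt_symm ((isOpen_ne.eventually_mem hxp).mono fun y hy =>
      mdifferentiableAt_zeroExtend hf hy)).meromorphicAt

variable [IsManifold 𝓘(ℂ, ℂ) ω C] [T2Space C] {pinf : C} {f : {x : C // x ≠ pinf} → ℂ}

theorem eventually_eq_or_eventually_ne (hf : f ∈ functionRing pinf) (c : ℂ) (x : C) :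
    (∀ᶠ y in 𝓝[≠] x, zeroExtend f y = c) ∨ ∀ᶠ y in 𝓝[≠] x, zeroExtend f y ≠ c := by
  have hx := mem_chart_source ℂ x
  have eventually_left_inv : ∀ᶠ y in 𝓝[≠] x, (chartAt ℂ x).symm (chartAt ℂ x y) = y :=
    ((chartAt ℂ x).eventually_left_inverse hx).filter_mono nhdsWithin_le_nhds
  have hfc := ((meromorphicAt_zeroExtend_symm hf x).sub
    (MeromorphicAt.const c _)).eventually_eq_zero_or_eventually_ne_zero
  simp only [← map_nhdsNE _ hx, Filter.eventually_map, Pi.sub_apply, sub_eq_zero, sub_ne_zero]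
    at hfc
  exact hfc.imp (fun h => (h.and eventually_left_inv).mono fun y hy => hy.2 ▸ hy.1)
    fun h => (h.and eventually_left_inv).mono fun y hy => hy.2 ▸ hy.1

theorem zeroExtend_eq_of_eventually_eq [ConnectedSpace C] (hf : f ∈ functionRing pinf) {c : ℂ}
    {s : C} (hs : ∀ᶠ y in 𝓝 s, zeroExtend f y = c) {x : C} (hx : x ≠ pinf) :
    zeroExtend f x = c := by
  have compl_eq : {x | ∀ᶠ y in 𝓝[≠] x, zeroExtend f y = c}ᶜ =
      {x | ∀ᶠ y in 𝓝[≠] x, zeroExtend f y ≠ c} := by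
    ext y
    have := neBot_nhdsNE y
    refine ⟨(eventually_eq_or_eventually_ne hf c y).resolve_left, fun hne heq => ?_⟩
    rw [Set.mem_ofPred_eq] at hne heq
    obtain ⟨y', hne', heq'⟩ := (hne.and heq).exists
    exact hne' heq'
  have isClopen : IsClopen {x | ∀ᶠ y in 𝓝[≠] x, zeroExtend f y = c} :=
    ⟨⟨compl_eq ▸ isOpen_setOfPred_eventually_nhdsWithin⟩, isOpen_setOfPred_eventually_nhdsWithin⟩
  have hfx : ∀ᶠ y in 𝓝[≠] x, zeroExtend f y = c :=
    (isClopen.eq_univ ⟨s, hs.filter_mono nhdsWithin_le_nhds⟩).ge (Set.mem_univ x)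
  have := neBot_nhdsNE x
  exact tendsto_nhds_unique_of_eventuallyEq
    ((mdifferentiableAt_zeroExtend hf hx).continuousAt.tendsto.mono_left nhdsWithin_le_nhds)
    tendsto_const_nhds hfx

end Identity

/-! ### The square root of the differential in the coordinate -/

section CoordDivisor

variable {C : Type*} [TopologicalSpace C]

/-- The function `σ` of the coordinate `z` is meromorphic, in normal form, with divisor `Δ` on the
domain of `z`. -/
def HasCoordDivisor (Δ : C →₀ ℤ) (z : OpenPartialHomeomorph C ℂ) (σ : ℂ → ℂ) : Prop :=
  ∀ x ∈ z.source, MeromorphicNFAt σ (z x) ∧ meromorphicOrderAt σ (z x) = ((Δ x : ℤ) : WithTop ℤ)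

variable [ChartedSpace ℂ C] {Δ : C →₀ ℤ} {z : OpenPartialHomeomorph C ℂ} {σ : ℂ → ℂ}

theorem IsSqrtCoeff.hasCoordDivisor {η : OneForm C} (hσ : IsSqrtCoeff η z σ)
    (hz : z ∈ IsManifold.maximalAtlas 𝓘(ℂ, ℂ) ω C) (hη : HasDivisor η (2 • Δ)) :
    HasCoordDivisor Δ z σ := by
  intro x hx
  have hσx : MeromorphicNFAt σ (z x) := hσ.1 (z.map_source hx)
  have coeff_eq : coeff η z =ᶠ[𝓝[≠] (z x)] σ * σ := by
    filter_upwards [mem_nhdsWithin_of_mem_nhds (z.open_target.mem_nhds (z.map_source hx))]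
      with w hw using (hσ.2 w hw).symm.trans (sq _)
  have order_eq := (hη z hz x hx).2
  rw [meromorphicOrderAt_congr coeff_eq,
    meromorphicOrderAt_mul hσx.meromorphicAt hσx.meromorphicAt] at order_eq
  refine ⟨hσx, ?_⟩
  cases h : meromorphicOrderAt σ (z x) with
  | top =>
    rw [h, WithTop.top_add] at order_eq
    exact absurd order_eq WithTop.top_ne_coe
  | coe n =>
    have add_self_eq : n + n = 2 * Δ x := by
      rw [h] at order_eq
      exact_mod_cast order_eq
    rw [show n = Δ x by lia]

theorem mdifferentiableAt_coord (hz : z ∈ IsManifold.maximalAtlas 𝓘(ℂ, ℂ) ω C) {x : C}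
    (hx : x ∈ z.source) : MDiffAt z x :=
  mdifferentiableAt_of_mem_maximalAtlas (IsManifold.maximalAtlas_subset_of_le (by simp) hz) hx

theorem mdifferentiableAt_coord_symm (hz : z ∈ IsManifold.maximalAtlas 𝓘(ℂ, ℂ) ω C) {w : ℂ}
    (hw : w ∈ z.target) : MDiffAt z.symm w :=
  mdifferentiableAt_symm_of_mem_maximalAtlas
    (IsManifold.maximalAtlas_subset_of_le (by simp) hz) hw

variable [IsManifold 𝓘(ℂ, ℂ) ω C]

theorem analyticAt_centeredChart_symm (hz : z ∈ IsManifold.maximalAtlas 𝓘(ℂ, ℂ) ω C) {x₀ : C}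
    (hx₀ : x₀ ∈ z.source) : AnalyticAt ℂ (fun w => centeredChart x₀ (z.symm w)) (z x₀) := by
  refine analyticAt_comp_symm (fun w hw => mdifferentiableAt_coord_symm hz hw) (z.map_source hx₀) ?_
  rw [z.left_inv hx₀]
  exact eventually_mdifferentiableAt_centeredChart x₀

theorem deriv_centeredChart_symm_ne_zero (hz : z ∈ IsManifold.maximalAtlas 𝓘(ℂ, ℂ) ω C) {x₀ : C}
    (hx₀ : x₀ ∈ z.source) : deriv (fun w => centeredChart x₀ (z.symm w)) (z x₀) ≠ 0 := by
  set φ := chartAt ℂ x₀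
  have hφ : φ.symm (φ x₀) = x₀ := φ.left_inv (mem_chart_source ℂ x₀)
  have hz_symm : DifferentiableAt ℂ (fun v => z (φ.symm v)) (φ x₀) :=
    (MDifferentiableAt.comp (φ x₀) (hφ.symm ▸ mdifferentiableAt_coord hz hx₀)
      (mdifferentiableAt_atlas_symm (chart_mem_atlas ℂ x₀)
        (mem_chart_target ℂ x₀))).differentiableAt
  have comp_eq : (fun v => centeredChart x₀ (z.symm (z (φ.symm v)))) =ᶠ[𝓝 (φ x₀)]
      fun v => v - φ x₀ := by
    filter_upwards [chart_target_mem_nhds ℂ x₀, (φ.continuousAt_symm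
      (mem_chart_target ℂ x₀)).preimage_mem_nhds (z.open_source.mem_nhds (hφ.symm ▸ hx₀))]
      with v hv hvz
    rw [z.left_inv hvz, centeredChart, φ.right_inv hv]
  have hasDerivAt_comp := HasDerivAt.comp (h₂ := fun w => centeredChart x₀ (z.symm w)) (φ x₀)
    (by simpa only [hφ] using (analyticAt_centeredChart_symm hz hx₀).differentiableAt.hasDerivAt)
    hz_symm.hasDerivAt
  intro deriv_eq
  have zero_eq_one := (hasDerivAt_comp.congr_of_eventuallyEq comp_eq.symm).unique
    ((hasDerivAt_id _).sub_const _)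
  rw [deriv_eq, zero_mul] at zero_eq_one
  exact zero_ne_one zero_eq_one

theorem exists_centeredChart_symm_eq_mul (hz : z ∈ IsManifold.maximalAtlas 𝓘(ℂ, ℂ) ω C) {x₀ : C}
    (hx₀ : x₀ ∈ z.source) : ∃ k : ℂ → ℂ, AnalyticAt ℂ k (z x₀) ∧ k (z x₀) ≠ 0 ∧
      ∀ w, centeredChart x₀ (z.symm w) = (w - z x₀) * k w := by
  refine ⟨dslope (fun w => centeredChart x₀ (z.symm w)) (z x₀), ?_, ?_, fun w => ?_⟩
  · obtain ⟨p, hp⟩ := analyticAt_centeredChart_symm hz hx₀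
    exact hp.has_fpower_series_dslope_fslope.analyticAt
  · rw [dslope_same]
    exact deriv_centeredChart_symm_ne_zero hz hx₀
  · rw [← smul_eq_mul, sub_smul_dslope, z.left_inv hx₀, centeredChart_self, sub_zero]

theorem HasCoordDivisor.exists_zpow_mul_eq (hσ : HasCoordDivisor Δ z σ)
    (hz : z ∈ IsManifold.maximalAtlas 𝓘(ℂ, ℂ) ω C) {x₀ : C} (hx₀ : x₀ ∈ z.source) :
    ∃ l : ℂ → ℂ, AnalyticAt ℂ l (z x₀) ∧ l (z x₀) ≠ 0 ∧ ∀ᶠ w in 𝓝 (z x₀),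
      Δ (z.symm w) = 0 → centeredChart x₀ (z.symm w) ^ (-Δ x₀) * σ w = l w := by
  obtain ⟨k, hk, hk0, chart_eq⟩ := exists_centeredChart_symm_eq_mul hz hx₀
  obtain ⟨hσx, order_eq⟩ := hσ x₀ hx₀
  rcases id hσx with σ_eq_zero | ⟨n, g, hg, hg0, σ_eq⟩
  · rw [meromorphicOrderAt_eq_top_iff.2 (σ_eq_zero.filter_mono nhdsWithin_le_nhds)] at order_eq
    exact absurd order_eq WithTop.top_ne_coe
  obtain rfl : n = Δ x₀ := by
    rw [(meromorphicOrderAt_eq_int_iff hσx.meromorphicAt).2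
      ⟨g, hg, hg0, σ_eq.filter_mono nhdsWithin_le_nhds⟩] at order_eq
    exact_mod_cast order_eq
  refine ⟨fun w => k w ^ (-Δ x₀) * g w, (hk.zpow hk0).mul hg,
    mul_ne_zero (zpow_ne_zero _ hk0) hg0, ?_⟩
  filter_upwards [σ_eq] with w hσw hΔw
  have zpow_cancel : (w - z x₀) ^ (-Δ x₀) * (w - z x₀) ^ Δ x₀ = 1 := by
    obtain rfl | hne := eq_or_ne w (z x₀)
    · rw [z.left_inv hx₀] at hΔw
      simp [hΔw]
    · rw [← zpow_add₀ (sub_ne_zero.2 hne), neg_add_cancel, zpow_zero]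
  rw [hσw, chart_eq, mul_zpow]
  simp only [Pi.smul_apply', Pi.pow_apply, smul_eq_mul]
  linear_combination k w ^ (-Δ x₀) * g w * zpow_cancel

end CoordDivisor

/-! ### Coordinate expressions of sections -/

section Branch

variable {C : Type*} [TopologicalSpace C] {pinf : C} {Δ : C →₀ ℤ}
  {z : OpenPartialHomeomorph C ℂ} {σ : ℂ → ℂ} {u : MultiFun pinf Δ} {f : ℂ → ℂ}

theorem eventually_symm_ne_and_apply_eq_zero [T1Space C] (pinf : C) (Δ : C →₀ ℤ) {x : C}
    (hx : x ∈ z.source) : ∀ᶠ w in 𝓝[≠] (z x), z.symm w ≠ pinf ∧ Δ (z.symm w) = 0 := by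
  rw [← map_nhdsNE z hx, Filter.eventually_map]
  filter_upwards [nhdsNE_le_cofinite x (Filter.eventually_cofinite_ne pinf),
    nhdsNE_le_cofinite x Δ.support.eventually_cofinite_notMem,
    mem_nhdsWithin_of_mem_nhds (z.open_source.mem_nhds hx)] with y hyp hΔy hy
  rw [z.left_inv hy]
  exact ⟨hyp, Finsupp.notMem_support_iff.1 hΔy⟩

open Classical in
/-- The value at `x` of the branch of `u` obtained along paths inside `V`, set to zero where there
is none. It does not depend on the path if `V` is simply connected. -/
def branch (V : Set C) (u : MultiFun pinf Δ) (x : C) : ℂ :=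
  if h : ∃ (_ : x ≠ pinf ∧ Δ x = 0) (γ : Path pinf x), ∀ t, γ t ∈ V then
    u ⟨x, h.choose⟩ (Path.Homotopic.Quotient.mk h.choose_spec.choose)
  else 0

theorem branch_eq {V : Set C} (hV : SimplyConnectedSpace V) (u : MultiFun pinf Δ)
    (x : GoodPoint pinf Δ) {γ : Path pinf (x : C)} (hγ : ∀ t, γ t ∈ V) :
    branch V u x = u x (Path.Homotopic.Quotient.mk γ) := by
  have h : ∃ (_ : (x : C) ≠ pinf ∧ Δ x = 0) (γ : Path pinf (x : C)), ∀ t, γ t ∈ V := ⟨x.2, γ, hγ⟩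
  rw [branch, dif_pos h, mk_eq_mk_of_simplyConnected hV _ γ h.choose_spec.choose_spec hγ]

theorem isCoordExpr_iff (hz_mem : pinf ∈ z.source) (hz_sc : SimplyConnectedSpace z.source) :
    IsCoordExpr z σ u f ↔ AnalyticOnNhd ℂ f (z.target \ {0}) ∧
      ∀ x ∈ z.source, x ≠ pinf → Δ x = 0 → f (z x) = branch z.source u x * σ (z x) := by
  refine and_congr_right fun _ => ⟨fun h x hx hxp hΔx => ?_, fun h x γ hγ => ?_⟩
  · obtain ⟨γ, hγ⟩ := exists_path_of_simplyConnected hz_sc hz_mem hx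
    rw [branch_eq hz_sc u ⟨x, hxp, hΔx⟩ hγ]
    exact h ⟨x, hxp, hΔx⟩ γ hγ
  · rw [← branch_eq hz_sc u x hγ]
    exact h x (γ.target ▸ hγ 1) x.2.1 x.2.2

theorem eventually_branch_eq [ChartedSpace ℂ C] {V : Set C} (hV_open : IsOpen V)
    (hV : SimplyConnectedSpace V) {x₀ : C} {γ₀ : Path pinf x₀} (hγ₀ : ∀ t, γ₀ t ∈ V) {n : ℤ}
    {F : C → ℂ} (hF : HasLocalExpr u x₀ γ₀ n F) :
    ∀ᶠ y in 𝓝 x₀, y ≠ pinf → Δ y = 0 → branch V u y = centeredChart x₀ y ^ n * F y := by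
  have : LocallyPathConnectedSpace C := ChartedSpace.locallyPathConnectedSpace ℂ C
  obtain ⟨-, U, hU, huF⟩ := hF
  filter_upwards [pathComponentIn_mem_nhds
    (Filter.inter_mem hU (hV_open.mem_nhds (γ₀.target ▸ hγ₀ 1)))] with y ⟨δ, hδ⟩ hyp hΔy
  rw [← huF ⟨y, hyp, hΔy⟩ δ fun t => (hδ t).1]
  exact branch_eq hV u ⟨y, hyp, hΔy⟩ (trans_mem hγ₀ fun t => (hδ t).2)

theorem coord_mem (hz_mem : pinf ∈ z.source) (hz_zero : z pinf = 0) {x : C} (hx : x ∈ z.source)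
    (hxp : x ≠ pinf) : z x ∈ z.target \ {0} :=
  ⟨z.map_source hx, fun h => hxp (z.injOn hx hz_mem (h.trans hz_zero.symm))⟩

theorem symm_ne (hz_zero : z pinf = 0) {w : ℂ} (hw : w ∈ z.target \ {0}) : z.symm w ≠ pinf := by
  intro h
  exact hw.2 (by rw [Set.mem_singleton_iff, ← z.right_inv hw.1, h, hz_zero])

end Branch

namespace IsCoordExpr

variable {C : Type*} [TopologicalSpace C] {pinf : C} {Δ : C →₀ ℤ}
  {z : OpenPartialHomeomorph C ℂ} {σ : ℂ → ℂ} {u v : MultiFun pinf Δ} {f f' : ℂ → ℂ}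

theorem add (hf : IsCoordExpr z σ u f) (hf' : IsCoordExpr z σ v f') :
    IsCoordExpr z σ (u + v) fun w => f w + f' w := by
  refine ⟨fun w hw => (hf.1 w hw).add (hf'.1 w hw), fun x γ hγ => ?_⟩
  simp only [hf.2 x γ hγ, hf'.2 x γ hγ, ← add_mul]
  rfl

theorem smul (c : ℂ) (hf : IsCoordExpr z σ u f) : IsCoordExpr z σ (c • u) fun w => c * f w := by
  refine ⟨fun w hw => analyticAt_const.mul (hf.1 w hw), fun x γ hγ => ?_⟩
  simp only [hf.2 x γ hγ, ← mul_assoc]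
  rfl

theorem sum {ι : Type*} {s : Finset ι} (hs : s.Nonempty) {u : ι → MultiFun pinf Δ}
    {f : ι → ℂ → ℂ} (hf : ∀ i ∈ s, IsCoordExpr z σ (u i) (f i)) :
    IsCoordExpr z σ (∑ i ∈ s, u i) fun w => ∑ i ∈ s, f i w := by
  induction hs using Finset.Nonempty.cons_induction with
  | singleton i => simpa using hf i
  | cons i s hi _ ih =>
    simp only [Finset.sum_cons]
    exact (hf i (by simp)).add (ih fun j hj => hf j (by simp [hj]))

theorem mulSection [ChartedSpace ℂ C] [T2Space C] (hf : IsCoordExpr z σ u f)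
    (hz : z ∈ IsManifold.maximalAtlas 𝓘(ℂ, ℂ) ω C) (hz_zero : z pinf = 0)
    {h : {x : C // x ≠ pinf} → ℂ} (hh : h ∈ functionRing pinf) :
    IsCoordExpr z σ (mulSection h u) fun w => zeroExtend h (z.symm w) * f w := by
  refine ⟨fun w hw => ?_, fun x γ hγ => ?_⟩
  · have hh_symm : AnalyticAt ℂ (fun w => zeroExtend h (z.symm w)) w :=
      analyticAt_comp_symm (fun w hw => mdifferentiableAt_coord_symm hz hw) hw.1
        ((isOpen_ne.eventually_mem (symm_ne hz_zero hw)).mono fun y hy =>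
          mdifferentiableAt_zeroExtend hh hy)
    exact hh_symm.mul (hf.1 w hw)
  · simp only [z.left_inv (γ.target ▸ hγ 1), hf.2 x γ hγ, mulSection_apply, mul_assoc]

theorem eventually_eq_branch_mul [T1Space C] (hf : IsCoordExpr z σ u f)
    (hz_mem : pinf ∈ z.source) (hz_sc : SimplyConnectedSpace z.source) {x : C}
    (hx : x ∈ z.source) :
    ∀ᶠ w in 𝓝[≠] (z x), f w = branch z.source u (z.symm w) * σ w := by
  filter_upwards [eventually_symm_ne_and_apply_eq_zero pinf Δ hx,
    mem_nhdsWithin_of_mem_nhds (z.open_target.mem_nhds (z.map_source hx))] with w ⟨hwp, hΔw⟩ hw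
  have f_eq := ((isCoordExpr_iff hz_mem hz_sc).1 hf).2 _ (z.map_target hw) hwp hΔw
  rwa [z.right_inv hw] at f_eq

theorem apply_eq_of_eventually_branch_mul_eq [T1Space C] (hf : IsCoordExpr z σ u f)
    (hz_mem : pinf ∈ z.source) (hz_zero : z pinf = 0) (hz_sc : SimplyConnectedSpace z.source)
    {x : C} (hx : x ∈ z.source) (hxp : x ≠ pinf) {G : ℂ → ℂ} (hG : ContinuousAt G (z x))
    (hGx : ∀ᶠ w in 𝓝[≠] (z x), branch z.source u (z.symm w) * σ w = G w) :
    f (z x) = G (z x) := by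
  have f_eq : f =ᶠ[𝓝[≠] (z x)] G :=
    ((hf.eventually_eq_branch_mul hz_mem hz_sc hx).and hGx).mono fun w hw => hw.1.trans hw.2
  have hfx := (hf.1 _ (coord_mem hz_mem hz_zero hx hxp)).continuousAt
  exact ((hfx.eventuallyEq_nhds_iff_eventuallyEq_nhdsNE hG).1 f_eq).self_of_nhds

theorem apply_eq_apply [T1Space C] (hf : IsCoordExpr z σ u f) (hf' : IsCoordExpr z σ u f')
    (hz_mem : pinf ∈ z.source) (hz_zero : z pinf = 0) (hz_sc : SimplyConnectedSpace z.source)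
    {x : C} (hx : x ∈ z.source) (hxp : x ≠ pinf) : f (z x) = f' (z x) :=
  hf.apply_eq_of_eventually_branch_mul_eq hz_mem hz_zero hz_sc hx hxp
    (hf'.1 _ (coord_mem hz_mem hz_zero hx hxp)).continuousAt
    ((hf'.eventually_eq_branch_mul hz_mem hz_sc hx).mono fun _ hw => hw.symm)

end IsCoordExpr

section Existence

theorem exists_analyticOnNhd_eventuallyEq_nhdsNE {𝕜 E : Type*} [NontriviallyNormedField 𝕜]
    [NormedAddCommGroup E] [NormedSpace 𝕜 E] {U : Set 𝕜} {v : 𝕜 → E}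
    (hv : ∀ w ∈ U, ∃ G : 𝕜 → E, AnalyticAt 𝕜 G w ∧ v =ᶠ[𝓝[≠] w] G) :
    ∃ f : 𝕜 → E, AnalyticOnNhd 𝕜 f U ∧ ∀ w ∈ U, v =ᶠ[𝓝[≠] w] f := by
  have meromorphicOn : MeromorphicOn v U := fun w hw => by
    obtain ⟨G, hG, v_eq⟩ := hv w hw
    exact hG.meromorphicAt.congr v_eq.symm
  refine ⟨toMeromorphicNFOn v U, fun w hw => ?_, fun w hw =>
    (meromorphicOn.toMeromorphicNFOn_eq_self_on_nhdsNE hw).symm⟩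
  obtain ⟨G, hG, v_eq⟩ := hv w hw
  rw [← (meromorphicNFOn_toMeromorphicNFOn v U hw).meromorphicOrderAt_nonneg_iff_analyticAt,
    meromorphicOrderAt_toMeromorphicNFOn meromorphicOn hw, meromorphicOrderAt_congr v_eq]
  exact hG.meromorphicOrderAt_nonneg

variable {C : Type*} [TopologicalSpace C] [ChartedSpace ℂ C] [IsManifold 𝓘(ℂ, ℂ) ω C] {pinf : C}
  {Δ : C →₀ ℤ} {z : OpenPartialHomeomorph C ℂ} {σ : ℂ → ℂ} {u : MultiFun pinf Δ}

theorem HasLocalExpr.exists_branch_mul_eq {x₀ : C} {γ₀ : Path pinf x₀} {F : C → ℂ}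
    (hF : HasLocalExpr u x₀ γ₀ (-Δ x₀) F) (hγ₀ : ∀ t, γ₀ t ∈ z.source)
    (hz : z ∈ IsManifold.maximalAtlas 𝓘(ℂ, ℂ) ω C) (hz_sc : SimplyConnectedSpace z.source)
    (hσ : HasCoordDivisor Δ z σ) :
    ∃ G : ℂ → ℂ, AnalyticAt ℂ G (z x₀) ∧ (G (z x₀) = 0 ↔ F x₀ = 0) ∧
      ∀ᶠ w in 𝓝 (z x₀), z.symm w ≠ pinf → Δ (z.symm w) = 0 →
        branch z.source u (z.symm w) * σ w = G w := by
  have hx₀ : x₀ ∈ z.source := γ₀.target ▸ hγ₀ 1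
  obtain ⟨l, hl, l_ne_zero, hlσ⟩ := hσ.exists_zpow_mul_eq hz hx₀
  have hF_symm : AnalyticAt ℂ (fun w => F (z.symm w)) (z x₀) :=
    analyticAt_comp_symm (fun w hw => mdifferentiableAt_coord_symm hz hw) (z.map_source hx₀)
      ((z.left_inv hx₀).symm ▸ hF.1)
  refine ⟨fun w => l w * F (z.symm w), hl.mul hF_symm, by simp [l_ne_zero, z.left_inv hx₀], ?_⟩
  filter_upwards [hlσ, (z.tendsto_symm hx₀).eventually
    (eventually_branch_eq z.open_source hz_sc hγ₀ hF)] with w hlw hbw hwp hΔw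
  rw [hbw hwp hΔw, ← hlw hΔw, mul_right_comm]

theorem IsCoordExpr.apply_eq_zero_iff [T1Space C] {f : ℂ → ℂ}
    (hf : IsCoordExpr z σ u f) (hz : z ∈ IsManifold.maximalAtlas 𝓘(ℂ, ℂ) ω C)
    (hz_mem : pinf ∈ z.source) (hz_zero : z pinf = 0) (hz_sc : SimplyConnectedSpace z.source)
    (hσ : HasCoordDivisor Δ z σ) {x : C} (hxp : x ≠ pinf) {γ : Path pinf x}
    (hγ : ∀ t, γ t ∈ z.source) {F : C → ℂ} (hF : HasLocalExpr u x γ (-Δ x) F) :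
    f (z x) = 0 ↔ F x = 0 := by
  have hx : x ∈ z.source := γ.target ▸ hγ 1
  obtain ⟨G, hG, G_eq_zero_iff, branch_mul_eq⟩ := hF.exists_branch_mul_eq hγ hz hz_sc hσ
  rw [← G_eq_zero_iff, hf.apply_eq_of_eventually_branch_mul_eq hz_mem hz_zero hz_sc hx hxp
    hG.continuousAt]
  filter_upwards [branch_mul_eq.filter_mono nhdsWithin_le_nhds,
    eventually_symm_ne_and_apply_eq_zero pinf Δ hx] with w hw hwx using hw hwx.1 hwx.2

theorem exists_isCoordExpr [T1Space C] (hz : z ∈ IsManifold.maximalAtlas 𝓘(ℂ, ℂ) ω C)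
    (hz_mem : pinf ∈ z.source) (hz_zero : z pinf = 0) (hz_sc : SimplyConnectedSpace z.source)
    (hσ : HasCoordDivisor Δ z σ) {g : ℕ} {b : Module.Basis (Fin g ⊕ Fin g) ℤ (H1 C pinf)}
    {e : Fin g → ℂ} (hu : u ∈ sections b Δ e) : ∃ f, IsCoordExpr z σ u f := by
  set v : ℂ → ℂ := fun w => branch z.source u (z.symm w) * σ w
  have exists_germ (x : C) (hx : x ∈ z.source) (hxp : x ≠ pinf) : ∃ G : ℂ → ℂ,
      AnalyticAt ℂ G (z x) ∧ v =ᶠ[𝓝[≠] (z x)] G ∧ (Δ x = 0 → v (z x) = G (z x)) := by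
    obtain ⟨γ, hγ⟩ := exists_path_of_simplyConnected hz_sc hz_mem hx
    obtain ⟨n, hn, F, hF⟩ := (mem_sections_iff.1 hu).2 x γ
    obtain ⟨G, hG, -, v_eq⟩ := (hn hxp ▸ hF).exists_branch_mul_eq hγ hz hz_sc hσ
    refine ⟨G, hG, ?_, fun hΔx => v_eq.self_of_nhds ?_ ?_⟩
    · filter_upwards [v_eq.filter_mono nhdsWithin_le_nhds,
        eventually_symm_ne_and_apply_eq_zero pinf Δ hx] with w hvw hw using hvw hw.1 hw.2
    · rwa [z.left_inv hx]
    · rwa [z.left_inv hx]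
  obtain ⟨f, hf, v_eq_f⟩ : ∃ f : ℂ → ℂ, AnalyticOnNhd ℂ f (z.target \ {0}) ∧
      ∀ w ∈ z.target \ {0}, v =ᶠ[𝓝[≠] w] f := by
    refine exists_analyticOnNhd_eventuallyEq_nhdsNE fun w hw => ?_
    obtain ⟨G, hG, v_eq, -⟩ := exists_germ _ (z.map_target hw.1) (symm_ne hz_zero hw)
    rw [z.right_inv hw.1] at hG v_eq
    exact ⟨G, hG, v_eq⟩
  refine ⟨f, (isCoordExpr_iff hz_mem hz_sc).2 ⟨hf, fun x hx hxp hΔx => ?_⟩⟩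
  obtain ⟨G, hG, v_eq_G, v_apply⟩ := exists_germ x hx hxp
  have hzx := coord_mem hz_mem hz_zero hx hxp
  have f_eq_G := ((hf _ hzx).continuousAt.eventuallyEq_nhds_iff_eventuallyEq_nhdsNE
    hG.continuousAt).1 ((v_eq_f _ hzx).symm.trans v_eq_G)
  rw [f_eq_G.self_of_nhds, ← v_apply hΔx]
  simp only [v, z.left_inv hx]

end Existence

section Values

variable {C : Type*} [TopologicalSpace C] [T2Space C] [ChartedSpace ℂ C]
  [IsManifold 𝓘(ℂ, ℂ) ω C] [CompactSpace C] [ConnectedSpace C] {pinf : C} {Δ : C →₀ ℤ}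
  {z : OpenPartialHomeomorph C ℂ} {σ : ℂ → ℂ} {g : ℕ}
  {b : Module.Basis (Fin g ⊕ Fin g) ℤ (H1 C pinf)} {e : Fin g → ℂ}
  {f : {x : C // x ≠ pinf} → ℂ} {ι : Type*} {X : ι → {x : C // x ≠ pinf}}

theorem exists_section_eq_single [Finite ι] [DecidableEq ι]
    (hz : z ∈ IsManifold.maximalAtlas 𝓘(ℂ, ℂ) ω C) (hz_mem : pinf ∈ z.source)
    (hz_zero : z pinf = 0) (hz_sc : SimplyConnectedSpace z.source) (hσ : HasCoordDivisor Δ z σ)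
    (hf : f ∈ functionRing pinf) (hfc : ∃ x y, f x ≠ f y) (hX : Function.Injective X)
    (hXz : ∀ i, (X i : C) ∈ z.source) (i : ι) :
    ∃ u ∈ sections b Δ e, ∃ G, IsCoordExpr z σ u G ∧
      ∀ j, G (z (X j)) = (Pi.single i 1 : ι → ℂ) j := by
  set S : Set C := (fun j => (X j : C)) '' {i}ᶜ
  have hS : S.Finite := (Set.toFinite _).image _
  have X_notMem : (X i : C) ∉ hS.toFinset := by
    rw [hS.mem_toFinset]
    rintro ⟨j, hji, hj⟩
    exact hji (hX (Subtype.ext hj))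
  have pinf_notMem : pinf ∉ hS.toFinset := by
    rw [hS.mem_toFinset]
    rintro ⟨j, -, hj⟩
    exact (X j).2 hj
  have not_eventually_eq : ¬ ∀ᶠ x in 𝓝 (X i : C), zeroExtend f x = zeroExtend f (X i) := by
    intro h
    obtain ⟨x, y, hxy⟩ := hfc
    have eq_const (y : {x : C // x ≠ pinf}) : f y = zeroExtend f (X i) := by
      rw [← zeroExtend_of_ne f y.2]
      exact zeroExtend_eq_of_eventually_eq hf h y.2
    exact hxy ((eq_const x).trans (eq_const y).symm)
  obtain ⟨u, hu, ne_zero, eq_zero⟩ :=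
    exists_interpolating_section b Δ e hf (X i).2 X_notMem pinf_notMem not_eventually_eq
  obtain ⟨G, hG⟩ := exists_isCoordExpr hz hz_mem hz_zero hz_sc hσ hu
  have G_ne_zero : G (z (X i)) ≠ 0 := by
    obtain ⟨γ, hγ⟩ := exists_path_of_simplyConnected hz_sc hz_mem (hXz i)
    obtain ⟨F, hF, hFi⟩ := ne_zero γ
    exact (hG.apply_eq_zero_iff hz hz_mem hz_zero hz_sc hσ (X i).2 hγ hF).not.2 hFi
  have G_eq_zero (j : ι) (hji : j ≠ i) : G (z (X j)) = 0 := by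
    obtain ⟨γ, hγ⟩ := exists_path_of_simplyConnected hz_sc hz_mem (hXz j)
    obtain ⟨F, hF, hFj⟩ := eq_zero (X j) (hS.mem_toFinset.2 ⟨j, hji, rfl⟩) γ
    exact (hG.apply_eq_zero_iff hz hz_mem hz_zero hz_sc hσ (X j).2 hγ hF).2 hFj
  refine ⟨(G (z (X i)))⁻¹ • u, smul_mem_sections _ hu, _, hG.smul _, fun j => ?_⟩
  obtain rfl | hji := eq_or_ne j i
  · rw [Pi.single_eq_same, inv_mul_cancel₀ G_ne_zero]
  · rw [Pi.single_eq_of_ne hji, G_eq_zero j hji, mul_zero]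

theorem exists_section_eq [Finite ι] [Nonempty ι]
    (hz : z ∈ IsManifold.maximalAtlas 𝓘(ℂ, ℂ) ω C) (hz_mem : pinf ∈ z.source)
    (hz_zero : z pinf = 0) (hz_sc : SimplyConnectedSpace z.source) (hσ : HasCoordDivisor Δ z σ)
    (hf : f ∈ functionRing pinf) (hfc : ∃ x y, f x ≠ f y) (hX : Function.Injective X)
    (hXz : ∀ i, (X i : C) ∈ z.source) (t : ι → ℂ) :
    ∃ u ∈ sections b Δ e, ∃ G, IsCoordExpr z σ u G ∧ ∀ j, G (z (X j)) = t j := by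
  classical
  have := Fintype.ofFinite ι
  choose u hu G hG hGX using
    exists_section_eq_single (b := b) (e := e) hz hz_mem hz_zero hz_sc hσ hf hfc hX hXz
  refine ⟨∑ i, t i • u i, sum_mem_sections Finset.univ_nonempty fun i _ =>
    smul_mem_sections _ (hu i), _, IsCoordExpr.sum Finset.univ_nonempty fun i _ =>
    (hG i).smul (t i), fun j => ?_⟩
  simp [hGX, Pi.single_apply]

end Values

/-! ### The stabilizer -/

section Stabilizer

variable {C : Type*} [TopologicalSpace C] [T2Space C] [ChartedSpace ℂ C]
  [IsManifold 𝓘(ℂ, ℂ) ω C] {pinf : C} {g : ℕ} {b : Module.Basis (Fin g ⊕ Fin g) ℤ (H1 C pinf)}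
  {Δ : C →₀ ℤ} {e : Fin g → ℂ} {z : OpenPartialHomeomorph C ℂ} {σ : ℂ → ℂ} {M N : ℕ}
  {P : Fin N → {x : C // x ≠ pinf}} {Q : Fin M → {x : C // x ≠ pinf}}
  {B : Matrix (Fin N ⊕ Fin M) (Fin N) ℂ} {f : {x : C // x ≠ pinf} → ℂ}

theorem mem_stabilizer_spaceW (hz : z ∈ IsManifold.maximalAtlas 𝓘(ℂ, ℂ) ω C)
    (hz_zero : z pinf = 0) (hP : ∀ i, (P i : C) ∈ z.source) (hQ : ∀ j, (Q j : C) ∈ z.source)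
    (hf : f ∈ functionRing pinf) (hfB : ∀ i j, B (Sum.inr j) i ≠ 0 → f (P i) = f (Q j)) :
    f ∈ stabilizer (spaceW b Δ e z σ (fun i => z (P i)) (fun j => z (Q j)) B) := by
  refine ⟨hf, fun u ⟨hu, G, hG, hGW⟩ =>
    ⟨mulSection_mem_sections hf hu, _, hG.mulSection hz hz_zero hf, fun i => ?_⟩⟩
  simp only [z.left_inv (hP _), z.left_inv (hQ _), zeroExtend_of_ne f (P _).2,
    zeroExtend_of_ne f (Q _).2]
  rw [hGW i, mul_neg, Finset.mul_sum]
  refine congrArg Neg.neg (Finset.sum_congr rfl fun j _ => ?_)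
  obtain hBji | hBji := eq_or_ne (B (Sum.inr j) i) 0
  · simp only [hBji, zero_mul, mul_zero]
  · rw [hfB i j hBji, mul_left_comm]

theorem exists_mem_spaceW_eq_single [CompactSpace C] [ConnectedSpace C]
    (hz : z ∈ IsManifold.maximalAtlas 𝓘(ℂ, ℂ) ω C) (hz_mem : pinf ∈ z.source)
    (hz_zero : z pinf = 0) (hz_sc : SimplyConnectedSpace z.source) (hσ : HasCoordDivisor Δ z σ)
    (hP : ∀ i, (P i : C) ∈ z.source) (hQ : ∀ j, (Q j : C) ∈ z.source)
    (hPQ : Function.Injective (Sum.elim P Q)) (hf : f ∈ functionRing pinf)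
    (hfc : ∃ x y, f x ≠ f y) (j : Fin M) :
    ∃ u ∈ spaceW b Δ e z σ (fun i => z (P i)) (fun j => z (Q j)) B, ∃ G, IsCoordExpr z σ u G ∧
      (∀ i, G (z (P i)) = -(B (Sum.inr j) i * ((z (P i))⁻¹ * z (Q j)))) ∧
      ∀ k, G (z (Q k)) = (Pi.single j 1 : Fin M → ℂ) k := by
  have : Nonempty (Fin N ⊕ Fin M) := ⟨Sum.inr j⟩
  obtain ⟨u, hu, G, hG, hGt⟩ := exists_section_eq (b := b) (e := e) hz hz_mem hz_zero hz_sc hσ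
    hf hfc hPQ (Sum.forall.2 ⟨hP, hQ⟩)
    (Sum.elim (fun i => -(B (Sum.inr j) i * ((z (P i))⁻¹ * z (Q j)))) (Pi.single j 1))
  obtain ⟨hGP, hGQ⟩ := Sum.forall.1 hGt
  simp only [Sum.elim_inl, Sum.elim_inr] at hGP hGQ
  refine ⟨u, ⟨hu, G, hG, fun i => ?_⟩, G, hG, hGP, hGQ⟩
  simp [hGP, hGQ, Pi.single_apply]

theorem apply_eq_apply_of_mem_stabilizer_spaceW [CompactSpace C] [ConnectedSpace C]
    (hz : z ∈ IsManifold.maximalAtlas 𝓘(ℂ, ℂ) ω C)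
    (hz_mem : pinf ∈ z.source) (hz_zero : z pinf = 0) (hz_sc : SimplyConnectedSpace z.source)
    (hσ : HasCoordDivisor Δ z σ) (hP : ∀ i, (P i : C) ∈ z.source)
    (hQ : ∀ j, (Q j : C) ∈ z.source) (hPQ : Function.Injective (Sum.elim P Q))
    (hf : f ∈ stabilizer (spaceW b Δ e z σ (fun i => z (P i)) (fun j => z (Q j)) B))
    {i : Fin N} {j : Fin M} (hBji : B (Sum.inr j) i ≠ 0) : f (P i) = f (Q j) := by
  by_contra f_ne
  have z_ne_zero {x : {x : C // x ≠ pinf}} (hx : (x : C) ∈ z.source) : z x ≠ 0 :=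
    (coord_mem hz_mem hz_zero hx x.2).2
  obtain ⟨u, hu, G, hG, hGP, hGQ⟩ := exists_mem_spaceW_eq_single (B := B) hz hz_mem hz_zero hz_sc
    hσ hP hQ hPQ hf.1 ⟨_, _, f_ne⟩ j
  obtain ⟨-, G', hG', hG'W⟩ := hf.2 u hu
  have G'_eq {x : {x : C // x ≠ pinf}} (hx : (x : C) ∈ z.source) :
      G' (z x) = f x * G (z x) := by
    rw [hG'.apply_eq_apply (hG.mulSection hz hz_zero hf.1) hz_mem hz_zero hz_sc hx x.2,
      z.left_inv hx, zeroExtend_of_ne f x.2]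
  have b'_mul_eq : B (Sum.inr j) i * ((z (P i))⁻¹ * z (Q j)) * f (P i) =
      B (Sum.inr j) i * ((z (P i))⁻¹ * z (Q j)) * f (Q j) := by
    simpa [G'_eq (hP _), G'_eq (hQ _), hGP, hGQ, Pi.single_apply, mul_comm (f (P i))] using hG'W i
  exact f_ne (mul_left_cancel₀ (mul_ne_zero hBji
    (mul_ne_zero (inv_ne_zero (z_ne_zero (hP i))) (z_ne_zero (hQ j)))) b'_mul_eq)

end Stabilizer

end KPCurve

end

theorem mainTheorem5_general {C : Type*} [TopologicalSpace C] [T2Space C] [CompactSpace C]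
    [ConnectedSpace C] [ChartedSpace ℂ C] [IsManifold 𝓘(ℂ, ℂ) ω C]
    (pinf : C) (g : ℕ) (b : Module.Basis (Fin g ⊕ Fin g) ℤ (KPCurve.H1 C pinf)) (Δ : C →₀ ℤ)
    (z : OpenPartialHomeomorph C ℂ) (hz : z ∈ IsManifold.maximalAtlas 𝓘(ℂ, ℂ) ω C)
    (hz_mem : pinf ∈ z.source) (hz_zero : z pinf = 0) (hz_sc : SimplyConnectedSpace z.source)
    (η : KPCurve.OneForm C) (hη : KPCurve.HasDivisor η (2 • Δ))
    (σ : ℂ → ℂ) (hσ : KPCurve.IsSqrtCoeff η z σ) (e : Fin g → ℂ) (M N : ℕ)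
    (P : Fin N → {x : C // x ≠ pinf}) (Q : Fin M → {x : C // x ≠ pinf})
    (hP : ∀ i, (P i : C) ∈ z.source) (hQ : ∀ j, (Q j : C) ∈ z.source)
    (hPQ : Function.Injective (Sum.elim P Q)) (B : Matrix (Fin N ⊕ Fin M) (Fin N) ℂ) :
    KPCurve.stabilizer
        (KPCurve.spaceW b Δ e z σ (fun i => z (P i)) (fun j => z (Q j)) B) =
      {f | f ∈ KPCurve.functionRing pinf ∧
        ∀ (i : Fin N) (j : Fin M), B (Sum.inr j) i ≠ 0 → f (P i) = f (Q j)} :=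
  have hΔσ : KPCurve.HasCoordDivisor Δ z σ := hσ.hasCoordDivisor hz hη
  Set.Subset.antisymm
    (fun _ hf => ⟨hf.1, fun _ _ hBji => KPCurve.apply_eq_apply_of_mem_stabilizer_spaceW hz hz_mem
      hz_zero hz_sc hΔσ hP hQ hPQ hf hBji⟩)
    fun _ ⟨hf, hfB⟩ => KPCurve.mem_stabilizer_spaceW hz hz_zero hP hQ hf hfB

theorem mainTheorem5 {C : Type*} [TopologicalSpace C] [T2Space C] [CompactSpace C]
    [ConnectedSpace C] [ChartedSpace ℂ C] [IsManifold 𝓘(ℂ, ℂ) ω C]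
    (pinf : C) (g : ℕ) (hg : 0 < g)
    (b : Module.Basis (Fin g ⊕ Fin g) ℤ (KPCurve.H1 C pinf)) (hb : KPCurve.IsCanonicalBasis b)
    (dv : Fin g → KPCurve.OneForm C) (hdv : KPCurve.IsNormalizedForms b dv)
    (Ω : Matrix (Fin g) (Fin g) ℂ) (hΩ : KPCurve.IsPeriodMatrix b dv Ω)
    (Δ : C →₀ ℤ) (hΔ : KPCurve.IsRiemannDivisor pinf dv Ω Δ)
    (z : OpenPartialHomeomorph C ℂ) (hz : z ∈ IsManifold.maximalAtlas 𝓘(ℂ, ℂ) ω C)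
    (hz_mem : pinf ∈ z.source) (hz_zero : z pinf = 0) (hz_sc : SimplyConnectedSpace z.source)
    (η : KPCurve.OneForm C) (hη : KPCurve.HasDivisor η (2 • Δ))
    (σ : ℂ → ℂ) (hσ : KPCurve.IsSqrtCoeff η z σ)
    (e : Fin g → ℂ)
    (M N : ℕ) (hM : 0 < M) (hN : 0 < N)
    (P : Fin N → {x : C // x ≠ pinf}) (Q : Fin M → {x : C // x ≠ pinf})
    (hP : ∀ i, (P i : C) ∈ z.source) (hQ : ∀ j, (Q j : C) ∈ z.source)
    (hPQ : Function.Injective (Sum.elim P Q))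
    (a : Matrix (Fin M) (Fin N) ℂ) (B : Matrix (Fin N ⊕ Fin M) (Fin N) ℂ)
    (hB : B = KPCurve.matrixB (fun i => z (P i)) (fun j => z (Q j)) a) :
    KPCurve.stabilizer
        (KPCurve.spaceW b Δ e z σ (fun i => z (P i)) (fun j => z (Q j)) B) =
      {f | f ∈ KPCurve.functionRing pinf ∧
        ∀ (i : Fin N) (j : Fin M), B (Sum.inr j) i ≠ 0 → f (P i) = f (Q j)} :=
  mainTheorem5_general pinf g b Δ z hz hz_mem hz_zero hz_sc η hη σ hσ e M N P Q hP hQ hPQ B
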